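/- Let $X=\mathbb{C}^2$ with coordinates $(x,y)$, embedded in $\mathbb{P}^2$ by $(x,y)\mapsto[1:x:y]$. Let $\bar X$ be a normal compact complex analytic surface containing $X$ as a dense open subset, such that the identity of $X$ induces a bimeromorphic map $\sigma:\bar X\dashrightarrow\mathbb{P}^2$ (i.e. $x$ and $y$ are meromorphic on $\bar X$), and let $S$ be the set of points of indeterminacy of $\sigma$. Let $C_\nu$ be an irreducible component of the curve $\bar X\setminus X$, and let $\nu$ be the corresponding discrete valuation of $\mathbb{C}(x,y)$, i.e. $\nu(f)$ is the order of vanishing of $f$ along $C_\nu$. Assume $\nu(x)<0$. The center of $\nu$ on $\mathbb{P}^2$ is $\sigma(C_\nu\setminus S)$. A curvette at a point $\chi\in C_\nu$ that is non-singular on $\bar X$ and on $C_\nu$ is a smooth analytic curve germ at $\chi$ transversal to $C_\nu$. Let $\tilde\phi_\nu(x)+\xi x^{\tilde r_\nu}$ ($\xi$ an indeterminate) be a generic degree-wise Puiseux series of $\nu$: $\tilde\phi_\nu(x)$ is a finite sum of terms $a_e x^e$ with $e\in\mathbb{Q}$, $a_e\in\mathbb{C}\setminus\{0\}$; $\tilde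 r_\nu$ is a rational number smaller than all exponents $e$ of $\tilde\phi_\nu$; and $$\nu(f)=\nu(x)\,\deg_x f\bigl(x,\tilde\phi_\nu(x)+\xi x^{\tilde r_\nu}\bigr)\qquad\text{for all non-zero } f\in\mathbb{C}[x,y].$$ Then $\nu(y)>\nu(x)$ if and only if $\deg_x(\tilde\phi_\nu(x)+\xi x^{\tilde r_\nu})<1$. If $\nu(y)>\nu(x)$, then the following hold, where $(u,v)=(1/x,y/x)$. 1. The center of $\nu$ on $\mathbb{P}^2$ is the point $P=[0:1:0]$. 2. There is a finite set $F$ such that at each point of $C_\nu\setminus F$ there are curvettes, and for each $\chi\in C_\nu\setminus F$ there is $\tilde\xi\in\mathbb{C}$ such that the image under $\sigma$ of every curvette at $\chi$ is a curve germ at $P$ with a Puiseux expansion $$v=u\,\tilde\phi_\nu(1/u)+\tilde\xi\,u^{1-\tilde r_\nu}+\text{h.o.t.}$$ Here $\tilde\xi$ takes generic values: for each $c\in\mathbb{C}$ there are only finitely many $\chi\in C_\nu\setminus F$ such that the image of some curvette at $\chi$ has such an expansion with $\tilde\xi=c$; and for all but finitely many $c\in\mathbb{C}$ there is $\chi\in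 C_\nu\setminus F$ such that the image of every curvette at $\chi$ has such an expansion with $\tilde\xi=c$. 3. For each non-zero $f\in\mathbb{C}[u,v]$ there is a finite set $F_f$ such that for every $\chi\in C_\nu\setminus F_f$ and every curvette $\gamma$ at $\chi$, $\nu(f(1/x,y/x))$ is the intersection multiplicity at $P$ of the curve $f=0$ with $\sigma(\gamma)$. -/

import Mathlib

open Filter Topology

noncomputable section

namespace CurvesAtInfinity

/-! ### Reduced complex spaces and normality -/

/-- `HolAt` (holomorphy of functions at points) is, near `p`, the sheaf of holomorphic functions
of a local model: a neighbourhood `U` of `p` is embedded by `e` onto the common zero set, in an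
open `D ⊆ ℂⁿ`, of finitely many holomorphic functions, and a function is holomorphic at `q ∈ U` iff
near `q` it is the restriction of a function that is holomorphic near `e q` in `ℂⁿ`. -/
def HasLocalModel {M : Type*} [TopologicalSpace M] (HolAt : (M → ℂ) → M → Prop) (p : M) : Prop :=
  ∃ (n m : ℕ) (U : Set M) (e : M → (Fin n → ℂ)) (D : Set (Fin n → ℂ))
    (F : Fin m → (Fin n → ℂ) → ℂ),
    IsOpen U ∧ p ∈ U ∧ IsOpen D ∧ (∀ i, AnalyticOnNhd ℂ (F i) D) ∧
    IsEmbedding (U.domRestrict e) ∧ e '' U = {z | z ∈ D ∧ ∀ i, F i z = 0} ∧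
    ∀ q ∈ U, ∀ f : M → ℂ,
      HolAt f q ↔ ∃ G : (Fin n → ℂ) → ℂ, AnalyticAt ℂ G (e q) ∧ ∀ᶠ q' in 𝓝 q, f q' = G (e q')

/-- A reduced complex (analytic) space, given through its sheaf of holomorphic functions:
`HolAt f p` says that `f` is holomorphic on a neighbourhood of `p`. (The Hausdorff property is a
separate type class argument.) -/
class ReducedComplexSpace (M : Type*) [TopologicalSpace M] where
  HolAt : (M → ℂ) → M → Prop
  hasLocalModel : ∀ p, HasLocalModel HolAt p

open ReducedComplexSpace (HolAt)

section Space

variable {M : Type*} [TopologicalSpace M] [ReducedComplexSpace M]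

theorem holAt_const (c : ℂ) (p : M) : HolAt (fun _ => c) p := by
  obtain ⟨n, m, U, e, D, F, -, hp, -, -, -, -, h⟩ := ReducedComplexSpace.hasLocalModel p
  exact (h p hp _).2 ⟨fun _ => c, analyticAt_const, Eventually.of_forall fun _ => rfl⟩

theorem holAt_add {f g : M → ℂ} {p : M} (hf : HolAt f p) (hg : HolAt g p) :
    HolAt (f + g) p := by
  obtain ⟨n, m, U, e, D, F, -, hp, -, -, -, -, h⟩ := ReducedComplexSpace.hasLocalModel p
  obtain ⟨A, hA, hfA⟩ := (h p hp _).1 hf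
  obtain ⟨B, hB, hgB⟩ := (h p hp _).1 hg
  refine (h p hp _).2 ⟨A + B, hA.add hB, ?_⟩
  filter_upwards [hfA, hgB] with q h1 h2
  simp [h1, h2]

theorem holAt_mul {f g : M → ℂ} {p : M} (hf : HolAt f p) (hg : HolAt g p) :
    HolAt (f * g) p := by
  obtain ⟨n, m, U, e, D, F, -, hp, -, -, -, -, h⟩ := ReducedComplexSpace.hasLocalModel p
  obtain ⟨A, hA, hfA⟩ := (h p hp _).1 hf
  obtain ⟨B, hB, hgB⟩ := (h p hp _).1 hg
  refine (h p hp _).2 ⟨A * B, hA.mul hB, ?_⟩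
  filter_upwards [hfA, hgB] with q h1 h2
  simp [h1, h2]

theorem holAt_neg {f : M → ℂ} {p : M} (hf : HolAt f p) : HolAt (-f) p := by
  obtain ⟨n, m, U, e, D, F, -, hp, -, -, -, -, h⟩ := ReducedComplexSpace.hasLocalModel p
  obtain ⟨A, hA, hfA⟩ := (h p hp _).1 hf
  refine (h p hp _).2 ⟨-A, hA.neg, ?_⟩
  filter_upwards [hfA] with q h1
  simp [h1]

/-- The local ring at `p`: germs at `p` of holomorphic functions. -/
def localRing (p : M) : Subring (Germ (𝓝 p) ℂ) where
  carrier := {φ | ∃ f : M → ℂ, HolAt f p ∧ φ = (f : Germ (𝓝 p) ℂ)}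
  mul_mem' := by
    rintro _ _ ⟨f, hf, rfl⟩ ⟨g, hg, rfl⟩
    exact ⟨f * g, holAt_mul hf hg, rfl⟩
  one_mem' := ⟨fun _ => 1, holAt_const 1 p, rfl⟩
  add_mem' := by
    rintro _ _ ⟨f, hf, rfl⟩ ⟨g, hg, rfl⟩
    exact ⟨f + g, holAt_add hf hg, rfl⟩
  zero_mem' := ⟨fun _ => 0, holAt_const 0 p, rfl⟩
  neg_mem' := by
    rintro _ ⟨f, hf, rfl⟩
    exact ⟨-f, holAt_neg hf, rfl⟩

end Space

/-- A reduced complex space is normal if its local rings are integrally closed domains. -/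
def IsNormalSpace (M : Type*) [TopologicalSpace M] [ReducedComplexSpace M] : Prop :=
  ∀ p : M, IsDomain (localRing p) ∧ IsIntegrallyClosed (localRing p)

/-! ### Compactifications of `ℂ²` -/

/-- `M` (which will be compact and Hausdorff) as a normal analytic compactification of
`X = ℂ²`: `ι` identifies `X`, biholomorphically, with a dense open subset of `M`, and the
identity of `X` induces a bimeromorphic map from `M` to `ℙ²`, i.e. the coordinate functions
`x = w 0` and `y = w 1` of `X` are meromorphic on `M`. (`M` then has pure dimension two, since `X` is
dense in it.) -/
structure Compactification (M : Type*) [TopologicalSpace M] [ReducedComplexSpace M] where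
  ι : (Fin 2 → ℂ) → M
  isOpenEmbedding : IsOpenEmbedding ι
  denseRange : DenseRange ι
  holAt_iff : ∀ (f : M → ℂ) (w : Fin 2 → ℂ), HolAt f (ι w) ↔ AnalyticAt ℂ (f ∘ ι) w
  normal : IsNormalSpace M
  /-- Near each `p`, `x = a 0 / d` and `y = a 1 / d` with `a 0`, `a 1`, `d` holomorphic and `d` not
  identically zero on any non-empty open set. -/
  meromorphic : ∀ p : M, ∃ (d : M → ℂ) (a : Fin 2 → M → ℂ), HolAt d p ∧ (∀ i, HolAt (a i) p) ∧
    (∀ᶠ q in 𝓝 p, q ∈ closure {q' | d q' ≠ 0}) ∧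
    ∀ᶠ q in 𝓝 p, ∀ w, ι w = q → ∀ i, a i q = w i * d q

/-- `A` is a (closed) analytic subset of `M`. -/
def IsAnalyticSubset {M : Type*} [TopologicalSpace M] [ReducedComplexSpace M] (A : Set M) : Prop :=
  ∀ p : M, ∃ (m : ℕ) (F : Fin m → M → ℂ), (∀ i, HolAt (F i) p) ∧
    ∀ᶠ q in 𝓝 p, q ∈ A ↔ ∀ i, F i q = 0

/-- `A` is an irreducible analytic subset of `M`. -/
def IsIrreducibleAnalytic {M : Type*} [TopologicalSpace M] [ReducedComplexSpace M]
    (A : Set M) : Prop :=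
  IsAnalyticSubset A ∧ A.Nonempty ∧
    ∀ B B' : Set M, IsAnalyticSubset B → IsAnalyticSubset B' → A ⊆ B ∪ B' → A ⊆ B ∨ A ⊆ B'

section Surface

variable {M : Type*} [TopologicalSpace M] [ReducedComplexSpace M]

/-- `A` is an irreducible component of the curve at infinity `M ∖ X`. (Being a curve, it is not
a single point, i.e. it is infinite.) -/
def IsCurveAtInfinity (K : Compactification M) (A : Set M) : Prop :=
  Maximal (fun B => IsIrreducibleAnalytic B ∧ B ⊆ (Set.range K.ι)ᶜ) A ∧ A.Infinite

/-- `c` is a holomorphic chart of `M` around `χ ∈ A`, with coordinates `(s, t)`, in which the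
curve `A` is `s = 0`. Such a chart exists iff `M` and `A` are both non-singular at `χ`. -/
def IsAdaptedChart (A : Set M) (χ : M) (c : OpenPartialHomeomorph M (ℂ × ℂ)) : Prop :=
  χ ∈ A ∧ χ ∈ c.source ∧
    (∀ q ∈ c.source, ∀ f : M → ℂ, HolAt f q ↔ AnalyticAt ℂ (f ∘ c.symm) (c q)) ∧
    ∀ q ∈ c.source, q ∈ A ↔ (c q).1 = 0

/-! ### Rational functions and their order of vanishing -/

/-- The field `ℂ(x, y)`. -/
abbrev RatFun : Type := FractionRing (MvPolynomial (Fin 2) ℂ)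

/-- The polynomial `f`, as a rational function. -/
def toRat (f : MvPolynomial (Fin 2) ℂ) : RatFun := algebraMap (MvPolynomial (Fin 2) ℂ) RatFun f

/-- The rational functions `x` and `y`. -/
def ratX : RatFun := toRat (MvPolynomial.X 0)

def ratY : RatFun := toRat (MvPolynomial.X 1)

/-- Near the point `χ` of the curve `A`, the rational function `f` on `X` is `s ^ k` times a
nowhere vanishing holomorphic function, where `s = 0` is a reduced equation of `A`. (Denominators
are cleared in the equation.) -/
def HasOrderAt (K : Compactification M) (A : Set M) (χ : M) (f : RatFun) (k : ℤ) : Prop :=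
  ∃ (c : OpenPartialHomeomorph M (ℂ × ℂ)) (g : M → ℂ), IsAdaptedChart A χ c ∧ HolAt g χ ∧ g χ ≠ 0 ∧
    ∀ᶠ q in 𝓝 χ, ∀ w, K.ι w = q →
      MvPolynomial.eval w (IsFractionRing.num (MvPolynomial (Fin 2) ℂ) f) =
        (c q).1 ^ k * g q *
          MvPolynomial.eval w (IsFractionRing.den (MvPolynomial (Fin 2) ℂ) f).1

/-- `ν` is the discrete valuation corresponding to the curve `A`: for each non-zero rational
function `f`, `ν f` is the order of vanishing of `f` along `A`, i.e. its order at all but finitely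
many points of `A`. (The value `ν 0` is irrelevant.) -/
def IsOrderAlong (K : Compactification M) (A : Set M) (ν : RatFun → ℤ) : Prop :=
  ∀ f : RatFun, f ≠ 0 → {χ ∈ A | ¬ HasOrderAt K A χ f (ν f)}.Finite

/-! ### The center on `ℙ²` -/

/-- The map `σ` from `M` to `ℙ²` which is `(x, y) ↦ [1 : x : y]` on `X` is holomorphic at `χ`, with
value `P` there. -/
def SigmaMapsTo (K : Compactification M) (χ : M) (P : Projectivization ℂ (Fin 3 → ℂ)) : Prop :=
  ∃ (h : Fin 3 → M → ℂ) (h0 : (fun i => h i χ) ≠ 0), (∀ i, HolAt (h i) χ) ∧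
    (∀ᶠ q in 𝓝 χ, ∀ w, K.ι w = q → h 1 q = w 0 * h 0 q ∧ h 2 q = w 1 * h 0 q) ∧
    P = Projectivization.mk ℂ (fun i => h i χ) h0

/-- The center on `ℙ²` of the valuation corresponding to `A`: the set `σ(A ∖ S)`, where `S` is the set
of points of indeterminacy of `σ`. -/
def center (K : Compactification M) (A : Set M) : Set (Projectivization ℂ (Fin 3 → ℂ)) :=
  {P | ∃ χ ∈ A, SigmaMapsTo K χ P}

/-- The point `[0 : 1 : 0]` of `ℙ²`. -/
def pointP : Projectivization ℂ (Fin 3 → ℂ) :=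
  Projectivization.mk ℂ ![0, 1, 0] (fun h => by simpa using congrFun h 1)

/-! ### Curvettes -/

/-- `γ` is a local parametrization (`z ↦ γ z` for `z` near `0`) of a curvette at the point `χ` of
the curve `A`, i.e. of a smooth analytic curve germ at `χ` that is transversal to `A`. Here `χ` is a
non-singular point of both `M` and `A`; in local coordinates `(s, t)` with `A = {s = 0}`,
transversality of a parametrized germ is `d(s ∘ γ)/dz ≠ 0` at `0`, which also makes `γ` an immersion. -/
def IsCurvette (A : Set M) (χ : M) (γ : ℂ → M) : Prop :=
  γ 0 = χ ∧ ContinuousAt γ 0 ∧ ∃ c : OpenPartialHomeomorph M (ℂ × ℂ), IsAdaptedChart A χ c ∧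
    AnalyticAt ℂ (fun z => c (γ z)) 0 ∧ deriv (fun z => (c (γ z)).1) 0 ≠ 0

/-- `δ` is, for parameters near `0`, the parametrized curve germ `σ ∘ γ` at the point
`[0 : 1 : 0]`, in the coordinates `(u, v) = (1 / x, y / x)`; it is an injective parametrization. -/
def IsImageGerm (K : Compactification M) (γ : ℂ → M) (δ : ℂ → Fin 2 → ℂ) : Prop :=
  AnalyticAt ℂ δ 0 ∧ δ 0 = 0 ∧ (∃ W ∈ 𝓝 (0 : ℂ), Set.InjOn δ W) ∧
    ∀ᶠ z in 𝓝[≠] (0 : ℂ), ∃ w, K.ι w = γ z ∧ w 0 ≠ 0 ∧ δ z = ![1 / w 0, w 1 / w 0]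

end Surface

/-! ### Puiseux series

A (degree-wise) Puiseux polynomial `∑ₑ aₑ xᵉ` (finitely many terms, rational exponents) is the finitely
supported function `e ↦ aₑ` from `ℚ` to `ℂ`. -/

/-- `φ(x) + ξ x ^ r`, with an indeterminate `ξ`: the exponents of `x` are rational and the
coefficients lie in `ℂ[ξ]`. -/
def genericSeries (φ : ℚ →₀ ℂ) (r : ℚ) : AddMonoidAlgebra (Polynomial ℂ) ℚ :=
  (φ.sum fun e a => AddMonoidAlgebra.single e (Polynomial.C a)) +
    AddMonoidAlgebra.single r Polynomial.X

/-- `f(x, φ(x) + ξ x ^ r)`. -/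
def substSeries (φ : ℚ →₀ ℂ) (r : ℚ) (f : MvPolynomial (Fin 2) ℂ) :
    AddMonoidAlgebra (Polynomial ℂ) ℚ :=
  MvPolynomial.aeval ![AddMonoidAlgebra.single 1 1, genericSeries φ r] f

/-- `d` is the degree in `x` of `ψ`. -/
def IsDegree (ψ : AddMonoidAlgebra (Polynomial ℂ) ℚ) (d : ℚ) : Prop :=
  IsGreatest {e | ψ.coeff e ≠ 0} d

/-- `φ(x) + ξ x ^ r` is a generic degree-wise Puiseux series of `ν`: `r` is smaller than all
exponents of `φ`, and `ν(f) = ν(x) · deg_x f(x, φ(x) + ξ x ^ r)` for all non-zero `f ∈ ℂ[x, y]`. -/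
def IsGenericPuiseux (ν : RatFun → ℤ) (φ : ℚ →₀ ℂ) (r : ℚ) : Prop :=
  (∀ e ∈ φ.support, r < e) ∧
    ∀ f : MvPolynomial (Fin 2) ℂ, f ≠ 0 →
      ∃ d : ℚ, IsDegree (substSeries φ r f) d ∧ (ν (toRat f) : ℚ) = (ν ratX : ℚ) * d

/-- `u φ(1 / u)`, for `φ = ∑ₑ aₑ xᵉ`: the Puiseux polynomial `∑ₑ aₑ u ^ (1 - e)`. -/
def reversed (φ : ℚ →₀ ℂ) : ℚ →₀ ℂ := φ.mapDomain fun e => 1 - e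

/-- The curve germ with parametrization `δ = (u, v)` has a Puiseux expansion
`v = Φ(u) + ξ u ^ ρ + h.o.t.`: after an invertible holomorphic change `θ` of the parameter,
`u = τ ^ n` for some `n ≥ 1`, and `v` is the convergent power series in `τ = u ^ (1 / n)` obtained
from the expansion, i.e. `Φ(u) = ∑ₑ Φₑ τ ^ (n e)`, `u ^ ρ = τ ^ k` with `k = n ρ`, and the higher order
terms form a power series divisible by `τ ^ (k + 1)`. All the exponents `n e`, `n ρ` have to be natural
numbers. -/
def HasPuiseuxExpansion (δ : ℂ → Fin 2 → ℂ) (Φ : ℚ →₀ ℂ) (ρ : ℚ) (ξ : ℂ) : Prop :=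
  ∃ (n k : ℕ) (θ h : ℂ → ℂ), 0 < n ∧ (k : ℚ) = n * ρ ∧
    (∀ e ∈ Φ.support, ∃ j : ℕ, (j : ℚ) = n * e) ∧
    AnalyticAt ℂ θ 0 ∧ θ 0 = 0 ∧ deriv θ 0 ≠ 0 ∧ AnalyticAt ℂ h 0 ∧
    ∀ᶠ τ in 𝓝 (0 : ℂ), δ (θ τ) 0 = τ ^ n ∧
      δ (θ τ) 1 = (Φ.sum fun e a => a * τ ^ ⌊(n : ℚ) * e⌋₊) + ξ * τ ^ k + τ ^ (k + 1) * h τ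

/-- The image under `σ` of the curvette `γ` is a curve germ at `[0 : 1 : 0]` that has, in the
coordinates `(u, v) = (1 / x, y / x)`, a Puiseux expansion `v = Φ(u) + ξ u ^ ρ + h.o.t.` -/
def ImageHasExpansion {M : Type*} [TopologicalSpace M] [ReducedComplexSpace M]
    (K : Compactification M) (γ : ℂ → M) (Φ : ℚ →₀ ℂ) (ρ : ℚ) (ξ : ℂ) : Prop :=
  ∃ δ : ℂ → Fin 2 → ℂ, IsImageGerm K γ δ ∧ HasPuiseuxExpansion δ Φ ρ ξ

/-- The intersection multiplicity at the origin of the curve `f = 0` with the irreducible curve germ that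
has the injective parametrization `δ`: the order at `0` of `f ∘ δ`. -/
def intersectionMultiplicity (f : MvPolynomial (Fin 2) ℂ) (δ : ℂ → Fin 2 → ℂ) : ℕ∞ :=
  analyticOrderAt (fun z => MvPolynomial.eval (δ z) f) 0

/-- The rational function `f(u, v) = f(1 / x, y / x)`. -/
def inUV (f : MvPolynomial (Fin 2) ℂ) : RatFun :=
  MvPolynomial.aeval ![1 / ratX, ratY / ratX] f

end CurvesAtInfinity

end

/-! Everything follows from a normal form for the two coordinates near all but finitely many points
of C_ν: holomorphic coordinates (τ, ξ) on the surface with C_ν = {τ = 0}, x = τ^(-p) for p = -ν(x),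
and y = φ(x) + ξ x^r (`IsNormalChart`). If the generic series has degree less than 1, then u = τ^p
and v = y/x contain only positive powers of τ. Both therefore vanish on C_ν, and the center is P. A
curvette can be parametrized by τ, so its image has the required expansion with coefficient ξ(χ).
Finally f(u, v) is τ^ν(f(u, v)) times a unit, so its order along a curvette is ν(f(u, v)). The
criterion for ν(y) > ν(x) is the degree formula for f = y together with ν(x) < 0.

Existence of the normal form (`exists_isNormalChart`). A p-th root of a unit gives a chart (s, t)
with x = s^(-p), and y is s^l times a holomorphic function. The product over the conjugates of φ of
the factors y - φ is, up to a power of x, a polynomial f₀ in x and y. The degree formula prescribes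
ν(f₀), and an ultrametric comparison of y with the roots of f₀ (`exists_order_eq_of_sum_eq`) shows
that on each curve t = const y agrees with a conjugate of φ exactly up to the exponent r. There are
finitely many conjugates, so one of them serves all t, and y = φ((ω s)^(-p)) + s^k Ξ(s, t) with Ξ
holomorphic. The same argument for φ + c x^r shows that Ξ(0, t) is not constant. Off C_ν the pair
(x, y) is a coordinate system, so ∂Ξ/∂t has no zeros with s ≠ 0; by Hurwitz it has none on s = 0
either. Thus s and Ξ, suitably rotated by ω, are the coordinates wanted.

Genericity of ξ. The point χ is the limit of s ↦ (s^(-p), φ + ξ(χ) s^k), so the coefficient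
determines the point; an expansion determines the coefficient up to p-th roots of unity, which gives
finite fibres. Conversely, let V be the set of values of ξ and send c in V to its point β(c). The
set V is open, β is holomorphic, and compactness of the curve forces β(c) towards the finite
exceptional set F when c tends to a point outside V or to infinity. Functions cutting out F pull
back along β to continuous functions that vanish off V and are holomorphic on V. By Radó's theorem
they are holomorphic, so the complement of V is discrete on the Riemann sphere, hence finite
(`finite_compl_of_isLocalZeroSet`). No resolution of the singularities in F is needed. -/

noncomputable section

/-! ### Radó's theorem and open sets whose complement is locally a zero set. -/

namespace CurvesAtInfinity

open Metric

/-! ### Radó's theorem -/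

/-- A maximum principle: `g` is bounded by its size on the part of the frontier where the auxiliary
holomorphic function `E` does not vanish. -/
theorem norm_le_of_frontier_or_eq_zero {F : Type*} [NormedAddCommGroup F] [NormedSpace ℂ F]
    {U : Set ℂ} (hU : Bornology.IsBounded U) {E : ℂ → F} {g : ℂ → ℂ}
    (hE : DiffContOnCl ℂ E U) (hg : DiffContOnCl ℂ g U) {m : ℝ} (hm : 0 ≤ m)
    (h : ∀ z ∈ frontier U, E z = 0 ∨ ‖g z‖ ≤ m) {a : ℂ} (ha : a ∈ U) (hEa : E a ≠ 0) :
    ‖g a‖ ≤ m := by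
  obtain ⟨C, hC⟩ := (hU.isCompact_closure).exists_bound_of_continuousOn hE.continuousOn
  by_contra! hlt
  obtain ⟨m', hm1, hm2⟩ := exists_between hlt
  have hm' : 0 < m' := hm.trans_lt hm1
  have hC0 : 0 ≤ C := (norm_nonneg _).trans (hC a (subset_closure ha))
  -- This is the maximum principle for `g ^ n • E`, which vanishes on the bad part of the frontier.
  -- As n grows, the fixed factor `‖E a‖` cannot compensate for `‖g a‖ > m'`.
  have key : ∀ n : ℕ, ‖g a‖ ^ n * ‖E a‖ ≤ m' ^ n * C := by
    intro n
    have hd : DiffContOnCl ℂ (fun z => (g z) ^ n • E z) U :=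
      (((differentiable_id.pow n).comp_diffContOnCl hg : DiffContOnCl ℂ (fun z => g z ^ n) U)).smul hE
    have := Complex.norm_le_of_forall_mem_frontier_norm_le hU hd (C := m' ^ n * C) ?_
      (subset_closure ha)
    · simpa [norm_smul] using this
    · intro z hz
      rcases h z hz with h0 | h0
      · simp only [h0, smul_zero, norm_zero]; positivity
      · rw [norm_smul, norm_pow]
        gcongr
        · exact h0.trans hm1.le
        · exact hC z (frontier_subset_closure hz)
  have h1 : 1 < ‖g a‖ / m' := (one_lt_div hm').2 hm2
  have hEpos : 0 < ‖E a‖ := norm_pos_iff.2 hEa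
  obtain ⟨n, hn⟩ := pow_unbounded_of_one_lt (C / ‖E a‖) h1
  have := key n
  rw [div_pow, div_lt_div_iff₀ hEpos (by positivity)] at hn
  linarith

/-- On a circle, continuous functions are uniform limits of functions `g + conj h` with `g`, `h`
entire. -/
theorem exists_entire_add_conj_approx {f : ℂ → ℂ} {c : ℂ} {R : ℝ} (hR : 0 < R)
    (hf : ContinuousOn f (sphere c R)) {ε : ℝ} (hε : 0 < ε) :
    ∃ g h : ℂ → ℂ, Differentiable ℂ g ∧ Differentiable ℂ h ∧
      ∀ z ∈ sphere c R, ‖f z - g z - starRingEnd ℂ (h z)‖ ≤ ε := by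
  have : Fact (0 < 2 * Real.pi) := ⟨Real.two_pi_pos⟩
  let e : AddCircle (2 * Real.pi) → ℂ := fun θ => c + R * (AddCircle.toCircle θ : ℂ)
  have hec : Continuous e := by
    have : Continuous fun θ : AddCircle (2 * Real.pi) => (AddCircle.toCircle θ : ℂ) :=
      continuous_subtype_val.comp AddCircle.continuous_toCircle
    fun_prop
  have hes : ∀ θ, e θ ∈ sphere c R := by
    intro θ
    simp [e, abs_of_pos hR, Circle.norm_coe]
  have het : ∀ θ, (e θ - c) / R = (AddCircle.toCircle θ : ℂ) := by
    intro θ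
    have : (R : ℂ) ≠ 0 := by exact_mod_cast hR.ne'
    simp only [e]; field_simp; ring
  let F : C(AddCircle (2 * Real.pi), ℂ) := ⟨fun θ => f (e θ), hf.comp_continuous hec hes⟩
  let S : Submodule ℂ C(AddCircle (2 * Real.pi), ℂ) :=
    { carrier := {G | ∃ g h : ℂ → ℂ, Differentiable ℂ g ∧ Differentiable ℂ h ∧
        ∀ θ, G θ = g (e θ) + starRingEnd ℂ (h (e θ))}
      add_mem' := by
        rintro _ _ ⟨g, h, hg, hh, H⟩ ⟨g', h', hg', hh', H'⟩
        refine ⟨g + g', h + h', hg.add hg', hh.add hh', fun θ => ?_⟩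
        simp [H, H']; ring
      zero_mem' := ⟨0, 0, differentiable_const _, differentiable_const _, fun θ => by simp⟩
      smul_mem' := by
        rintro a _ ⟨g, h, hg, hh, H⟩
        refine ⟨fun z => a * g z, fun z => starRingEnd ℂ a * h z, hg.const_mul _, hh.const_mul _,
          fun θ => ?_⟩
        simp [H]; ring }
  -- The Fourier monomials with non-negative index are powers of (z - c)/R. On the circle those with
  -- negative index are conjugates of such powers.
  have hS : Submodule.span ℂ (Set.range (@fourier (2 * Real.pi))) ≤ S := by
    rw [Submodule.span_le]
    rintro _ ⟨n, rfl⟩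
    rcases Int.eq_nat_or_neg n with ⟨m, rfl | rfl⟩
    · refine ⟨fun z => ((z - c) / R) ^ m, 0, by fun_prop, differentiable_const _, fun θ => ?_⟩
      simp [het, AddCircle.toCircle_nsmul]
    · refine ⟨0, fun z => ((z - c) / R) ^ m, differentiable_const _, by fun_prop, fun θ => ?_⟩
      rw [fourier_neg]
      simp [het, AddCircle.toCircle_nsmul]
  have hF : F ∈ closure (S : Set C(AddCircle (2 * Real.pi), ℂ)) := by
    have h1 : F ∈ (Submodule.span ℂ (Set.range (@fourier (2 * Real.pi)))).topologicalClosure := by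
      rw [span_fourier_closure_eq_top]; trivial
    exact closure_mono hS h1
  obtain ⟨G, ⟨g, h, hg, hh, H⟩, hG⟩ := Metric.mem_closure_iff.1 hF ε hε
  refine ⟨g, h, hg, hh, fun z hz => ?_⟩
  obtain ⟨θ, rfl⟩ : ∃ θ, e θ = z := by
    have hz' : ‖(z - c) / R‖ = 1 := by
      rw [norm_div, ← dist_eq_norm, mem_sphere.1 hz]; simp [abs_of_pos hR, hR.ne']
    obtain ⟨θ, hθ⟩ := (AddCircle.homeomorphCircle Real.two_pi_pos.ne').surjective
      (⟨(z - c) / R, mem_sphere_zero_iff_norm.2 hz'⟩ : Circle)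
    refine ⟨θ, ?_⟩
    have h2 : (AddCircle.toCircle θ : ℂ) = (z - c) / R := by
      have := congrArg (fun t : Circle => (t : ℂ)) hθ
      simpa [AddCircle.homeomorphCircle_apply] using this
    have : (R : ℂ) ≠ 0 := by exact_mod_cast hR.ne'
    simp only [e, h2]; field_simp; ring
  have h3 := (ContinuousMap.dist_lt_iff hε).1 hG θ
  rw [dist_eq_norm, H] at h3
  calc _ = ‖F θ - (g (e θ) + starRingEnd ℂ (h (e θ)))‖ := by congr 1; simp [F]; ring
    _ ≤ ε := h3.le

/-- The circle integral of the conjugate of a holomorphic function. -/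
theorem circleIntegral_conj {h : ℂ → ℂ} (hh : Differentiable ℂ h) (a : ℂ) {ρ : ℝ} (hρ : 0 < ρ) :
    (∮ z in C(a, ρ), starRingEnd ℂ (h z)) =
      2 * Real.pi * Complex.I * ρ ^ 2 * starRingEnd ℂ (deriv h a) := by
  have h1 := Complex.two_pi_I_inv_smul_circleIntegral_sub_sq_inv_smul_of_differentiable
    (U := Set.univ) (c := a) (w₀ := a) (R := ρ) isOpen_univ (Set.subset_univ _)
    hh.differentiableOn (mem_ball_self hρ)
  -- On the circle the conjugate of z - a is ρ²/(z - a). This turns the integral into the conjugate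
  -- of Cauchy's integral for the derivative.
  have h2 : (∮ z in C(a, ρ), starRingEnd ℂ (h z)) =
      starRingEnd ℂ (-(ρ : ℂ) ^ 2 * ∮ z in C(a, ρ), ((z - a) ^ 2)⁻¹ • h z) := by
    rw [circleIntegral, circleIntegral, map_mul, ← intervalIntegral.intervalIntegral_conj,
      ← intervalIntegral.integral_const_mul]
    congr 1
    ext θ
    have h0 : circleMap 0 ρ θ ≠ 0 := by simp [circleMap, hρ.ne']
    have h3 : starRingEnd ℂ (circleMap 0 ρ θ) * circleMap 0 ρ θ = (ρ : ℂ) ^ 2 := by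
      rw [Complex.conj_mul', norm_circleMap_zero, abs_of_pos hρ]
    have h0' : starRingEnd ℂ (circleMap 0 ρ θ) ≠ 0 := by simpa using h0
    simp only [deriv_circleMap, circleMap_sub_center, smul_eq_mul, map_mul, map_inv₀, map_pow,
      Complex.conj_I, map_neg, ← h3]
    field_simp
    simp only [Complex.conj_conj, mul_comm]
  have h4 : (∮ z in C(a, ρ), ((z - a) ^ 2)⁻¹ • h z) = 2 * Real.pi * Complex.I * deriv h a := by
    rw [← h1, smul_eq_mul, ← mul_assoc, mul_inv_cancel₀ (by simp [Real.pi_ne_zero]), one_mul]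
  rw [h2, h4]
  simp only [map_mul, map_neg, map_pow, Complex.conj_ofReal, Complex.conj_I, map_ofNat]
  ring

/-- The values on a disc of `f - g - conj h` are controlled by the values on its boundary, for `f`
holomorphic off the zero set of the holomorphic function `E`. -/
theorem norm_sub_sub_conj_le {F : Type*} [NormedAddCommGroup F] [NormedSpace ℂ F] {E : ℂ → F}
    {V : Set ℂ} {c : ℂ} {R : ℝ} (hV : IsOpen V) (hdense : ball c R ⊆ closure (V ∩ ball c R))
    (hEc : ContinuousOn E (closedBall c R)) (hEd : DifferentiableOn ℂ E (V ∩ ball c R))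
    (hE0 : ∀ z ∈ closedBall c R, z ∉ V → E z = 0) (hEne : ∀ z ∈ V ∩ ball c R, E z ≠ 0)
    {f g h : ℂ → ℂ} (hfc : ContinuousOn f (closedBall c R))
    (hfd : DifferentiableOn ℂ f (V ∩ ball c R)) (hg : Differentiable ℂ g)
    (hh : Differentiable ℂ h) {ε : ℝ}
    (hs : ∀ z ∈ sphere c R, ‖f z - g z - starRingEnd ℂ (h z)‖ ≤ ε) :
    ∀ z ∈ ball c R, ‖f z - g z - starRingEnd ℂ (h z)‖ ≤ 2 * ε := by
  have hsub : closure (V ∩ ball c R) ⊆ closedBall c R :=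
    (closure_mono Set.inter_subset_right).trans closure_ball_subset_closedBall
  have hfr : ∀ z ∈ frontier (V ∩ ball c R), E z = 0 ∨ z ∈ sphere c R := by
    intro z hz
    have hz1 := hsub (frontier_subset_closure hz)
    by_cases hzV : z ∈ V
    · right
      rw [(hV.inter isOpen_ball).frontier_eq] at hz
      have : z ∉ ball c R := fun hb => hz.2 ⟨hzV, hb⟩
      rw [mem_ball, not_lt] at this
      exact le_antisymm (mem_closedBall.1 hz1) this
    · exact Or.inl (hE0 z hz1 hzV)
  have hE : DiffContOnCl ℂ E (V ∩ ball c R) := ⟨hEd, hEc.mono hsub⟩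
  -- Since |exp ψ| = exp(Re ψ), the maximum principle for exp ψ bounds the real part of ψ.
  have main : ∀ ψ : ℂ → ℂ, ContinuousOn ψ (closedBall c R) → DifferentiableOn ℂ ψ (V ∩ ball c R) →
      (∀ z ∈ sphere c R, (ψ z).re ≤ ε) → ∀ z ∈ V ∩ ball c R, (ψ z).re ≤ ε := by
    intro ψ hψc hψd hψ z hz
    have := norm_le_of_frontier_or_eq_zero (isBounded_ball.subset Set.inter_subset_right) hE
      (g := fun z => Complex.exp (ψ z)) ⟨hψd.cexp, (hψc.mono hsub).cexp⟩ (Real.exp_pos ε).le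
      (fun w hw => (hfr w hw).imp_right fun hw => by
        rw [Complex.norm_exp]; exact Real.exp_le_exp.2 (hψ w hw)) hz (hEne z hz)
    rwa [Complex.norm_exp, Real.exp_le_exp] at this
  have hgc := hg.continuous.continuousOn (s := closedBall c R)
  have hhc := hh.continuous.continuousOn (s := closedBall c R)
  have hgd := hg.differentiableOn (s := V ∩ ball c R)
  have hhd := hh.differentiableOn (s := V ∩ ball c R)
  have hre : ∀ z ∈ sphere c R, |(f z - g z - starRingEnd ℂ (h z)).re| ≤ ε := fun z hz =>
    (Complex.abs_re_le_norm _).trans (hs z hz)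
  have him : ∀ z ∈ sphere c R, |(f z - g z - starRingEnd ℂ (h z)).im| ≤ ε := fun z hz =>
    (Complex.abs_im_le_norm _).trans (hs z hz)
  simp only [Complex.sub_re, Complex.sub_im, Complex.conj_re, Complex.conj_im, abs_le] at hre him
  have hVb : ∀ z ∈ V ∩ ball c R, ‖f z - g z - starRingEnd ℂ (h z)‖ ≤ 2 * ε := by
    intro z hz
    -- The function f - g - conj h is not holomorphic, but its real part is that of f - g - h and
    -- its imaginary part is that of f - g + h. Each part costs one ε, whence the factor 2.
    have h1 := main (fun z => f z - g z - h z) ((hfc.sub hgc).sub hhc) ((hfd.sub hgd).sub hhd)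
      (fun w hw => by simp only [Complex.sub_re]; linarith [(hre w hw).2]) z hz
    have h2 := main (fun z => -(f z - g z - h z)) ((hfc.sub hgc).sub hhc).neg
      ((hfd.sub hgd).sub hhd).neg
      (fun w hw => by simp only [Complex.neg_re, Complex.sub_re]; linarith [(hre w hw).1]) z hz
    have h3 := main (fun z => Complex.I * (f z - g z + h z))
      (continuousOn_const.mul ((hfc.sub hgc).add hhc)) (((hfd.sub hgd).add hhd).const_mul _)
      (fun w hw => by
        simp only [Complex.mul_re, Complex.I_re, Complex.I_im, Complex.sub_im, Complex.add_im]
        linarith [(him w hw).1]) z hz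
    have h4 := main (fun z => -Complex.I * (f z - g z + h z))
      (continuousOn_const.mul ((hfc.sub hgc).add hhc)) (((hfd.sub hgd).add hhd).const_mul _)
      (fun w hw => by
        simp only [Complex.mul_re, Complex.neg_re, Complex.neg_im, Complex.I_re, Complex.I_im,
          Complex.sub_im, Complex.add_im]
        linarith [(him w hw).2]) z hz
    simp only [Complex.mul_re, Complex.neg_re, Complex.neg_im, Complex.I_re, Complex.I_im,
          Complex.sub_im, Complex.add_im, Complex.sub_re] at h1 h2 h3 h4
    refine (Complex.norm_le_abs_re_add_abs_im _).trans ?_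
    have h5 : |(f z - g z - starRingEnd ℂ (h z)).re| ≤ ε := by
      simp only [Complex.sub_re, Complex.conj_re, abs_le]; constructor <;> linarith
    have h6 : |(f z - g z - starRingEnd ℂ (h z)).im| ≤ ε := by
      simp only [Complex.sub_im, Complex.conj_im, abs_le]; constructor <;> linarith
    linarith
  intro z hz
  have hcont : ContinuousWithinAt (fun z => ‖f z - g z - starRingEnd ℂ (h z)‖) (V ∩ ball c R) z := by
    have : ContinuousOn (fun z => ‖f z - g z - starRingEnd ℂ (h z)‖) (closedBall c R) :=
      ((hfc.sub hgc).sub (Complex.continuous_conj.comp_continuousOn hhc)).norm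
    exact (this z (ball_subset_closedBall hz)).mono
      (Set.inter_subset_right.trans ball_subset_closedBall)
  have hz' : (𝓝[V ∩ ball c R] z).NeBot := mem_closure_iff_nhdsWithin_neBot.1 (hdense hz)
  exact le_of_tendsto hcont (eventually_nhdsWithin_of_forall hVb)

/-- **Radó's theorem**: a continuous function on a disc that is holomorphic off the zero set of a
function `E`, itself continuous and holomorphic off its zero set, is holomorphic. -/
theorem differentiableOn_ball_of_zero_set {F : Type*} [NormedAddCommGroup F] [NormedSpace ℂ F]
    {E : ℂ → F} {V : Set ℂ} {c : ℂ} {R : ℝ} (hR : 0 < R) (hV : IsOpen V)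
    (hdense : ball c R ⊆ closure (V ∩ ball c R))
    (hEc : ContinuousOn E (closedBall c R)) (hEd : DifferentiableOn ℂ E (V ∩ ball c R))
    (hE0 : ∀ z ∈ closedBall c R, z ∉ V → E z = 0) (hEne : ∀ z ∈ V ∩ ball c R, E z ≠ 0)
    {f : ℂ → ℂ} (hfc : ContinuousOn f (closedBall c R))
    (hfd : DifferentiableOn ℂ f (V ∩ ball c R)) : DifferentiableOn ℂ f (ball c R) := by
  have happ : ∀ ε > 0, ∃ g h : ℂ → ℂ, Differentiable ℂ g ∧ Differentiable ℂ h ∧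
      ∀ z ∈ ball c R, ‖f z - g z - starRingEnd ℂ (h z)‖ ≤ ε := by
    intro ε hε
    obtain ⟨g, h, hg, hh, H⟩ := exists_entire_add_conj_approx hR
      (hfc.mono sphere_subset_closedBall) (half_pos hε)
    refine ⟨g, h, hg, hh, fun z hz => ?_⟩
    have := norm_sub_sub_conj_le hV hdense hEc hEd hE0 hEne hfc hfd hg hh H z hz
    linarith
  -- the circle integrals of `f`
  have hcirc : ∀ {a : ℂ} {ρ ε : ℝ} {g h : ℂ → ℂ}, 0 < ρ → closedBall a ρ ⊆ ball c R →
      Differentiable ℂ g → Differentiable ℂ h →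
      (∀ z ∈ ball c R, ‖f z - g z - starRingEnd ℂ (h z)‖ ≤ ε) →
      ‖(∮ z in C(a, ρ), f z) - 2 * Real.pi * Complex.I * ρ ^ 2 * starRingEnd ℂ (deriv h a)‖ ≤
        2 * Real.pi * ρ * ε := by
    intro a ρ ε g h hρ hsub hg hh H
    have hs : sphere a ρ ⊆ closedBall c R :=
      (sphere_subset_closedBall.trans hsub).trans ball_subset_closedBall
    have hfi : CircleIntegrable f a ρ := (hfc.mono hs).circleIntegrable hρ.le
    have hgi : CircleIntegrable g a ρ := hg.continuous.continuousOn.circleIntegrable hρ.le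
    have hhi : CircleIntegrable (fun z => starRingEnd ℂ (h z)) a ρ :=
      (Complex.continuous_conj.comp hh.continuous).continuousOn.circleIntegrable hρ.le
    have hg0 : (∮ z in C(a, ρ), g z) = 0 :=
      Complex.circleIntegral_eq_zero_of_differentiable_on_off_countable hρ.le Set.countable_empty
        hg.continuous.continuousOn fun z _ => hg z
    have : (∮ z in C(a, ρ), (f z - g z - starRingEnd ℂ (h z))) =
        (∮ z in C(a, ρ), f z) - 2 * Real.pi * Complex.I * ρ ^ 2 * starRingEnd ℂ (deriv h a) := by
      rw [circleIntegral.integral_sub (f := fun z => f z - g z) (hfi.sub hgi) hhi, circleIntegral.integral_sub hfi hgi, hg0,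
        circleIntegral_conj hh a hρ, sub_zero]
    rw [← this]
    exact circleIntegral.norm_integral_le_of_norm_le_const hρ.le fun z hz =>
      H z (hsub (sphere_subset_closedBall hz))
  -- A small circle around a point a of V has integral zero by Cauchy, so h'(a) is small for every
  -- good approximation g + conj h. That smallness in turn makes the integral over the large circle
  -- small.
  have hfzero : ∀ {a : ℂ} {ρ : ℝ}, 0 < ρ → closedBall a ρ ⊆ ball c R → a ∈ V →
      (∮ z in C(a, ρ), f z) = 0 := by
    intro a ρ hρ hsub haV
    have haR : a ∈ ball c R := hsub (mem_closedBall_self hρ.le)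
    obtain ⟨ρ₀, hρ₀, hsub₀⟩ := Metric.nhds_basis_closedBall.mem_iff.1
      ((hV.inter isOpen_ball).mem_nhds ⟨haV, haR⟩)
    have h0 : (∮ z in C(a, ρ₀), f z) = 0 :=
      Complex.circleIntegral_eq_zero_of_differentiable_on_off_countable hρ₀.le Set.countable_empty
        (hfd.continuousOn.mono hsub₀) fun z hz =>
          hfd.differentiableAt ((hV.inter isOpen_ball).mem_nhds
            (hsub₀ (ball_subset_closedBall hz.1)))
    have hbound : ∀ ε > 0, ‖∮ z in C(a, ρ), f z‖ ≤
        (2 * Real.pi * ρ + 2 * Real.pi * ρ ^ 2 / ρ₀) * ε := by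
      intro ε hε
      obtain ⟨g, h, hg, hh, H⟩ := happ ε hε
      have h1 := hcirc hρ hsub hg hh H
      have h2 := hcirc hρ₀ (hsub₀.trans Set.inter_subset_right) hg hh H
      rw [h0, zero_sub, norm_neg] at h2
      simp only [norm_mul, Complex.norm_I, norm_pow, Complex.norm_real, Real.norm_eq_abs,
        abs_of_pos Real.pi_pos, abs_of_pos hρ₀, Complex.norm_ofNat, RCLike.norm_conj, mul_one] at h2
      have h3 : ‖deriv h a‖ ≤ ε / ρ₀ := by
        rw [le_div_iff₀ hρ₀]
        have : 0 < 2 * Real.pi * ρ₀ := by positivity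
        nlinarith
      have h4 : ‖2 * Real.pi * Complex.I * (ρ : ℂ) ^ 2 * starRingEnd ℂ (deriv h a)‖ ≤
          2 * Real.pi * ρ ^ 2 * (ε / ρ₀) := by
        simp only [norm_mul, Complex.norm_I, norm_pow, Complex.norm_real, Real.norm_eq_abs,
          abs_of_pos Real.pi_pos, abs_of_pos hρ, Complex.norm_ofNat, RCLike.norm_conj, mul_one]
        gcongr
      calc _ = ‖((∮ z in C(a, ρ), f z) - 2 * Real.pi * Complex.I * ρ ^ 2 *
            starRingEnd ℂ (deriv h a)) + 2 * Real.pi * Complex.I * (ρ : ℂ) ^ 2 *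
            starRingEnd ℂ (deriv h a)‖ := by rw [sub_add_cancel]
        _ ≤ 2 * Real.pi * ρ * ε + 2 * Real.pi * ρ ^ 2 * (ε / ρ₀) := norm_add_le_of_le h1 h4
        _ = _ := by ring
    refine norm_le_zero_iff.1 (le_of_forall_pos_le_add fun δ hδ => ?_)
    have hK : 0 < 2 * Real.pi * ρ + 2 * Real.pi * ρ ^ 2 / ρ₀ := by positivity
    have := hbound (δ / (2 * Real.pi * ρ + 2 * Real.pi * ρ ^ 2 / ρ₀)) (by positivity)
    rw [mul_div_cancel₀ _ hK.ne'] at this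
    linarith
  -- on smaller discs, `f` is a uniform limit of entire functions
  have hsmall : ∀ ρ, 0 < ρ → ρ < R → DifferentiableOn ℂ f (ball c (R - ρ)) := by
    intro ρ hρ hρR
    have hstep : ∀ ε > 0, ∃ g : ℂ → ℂ, Differentiable ℂ g ∧
        ∀ z ∈ ball c (R - ρ), ‖f z - g z‖ ≤ (1 + R / ρ) * ε := by
      intro ε hε
      obtain ⟨g, h, hg, hh, H⟩ := happ ε hε
      have hsub : ∀ a ∈ ball c (R - ρ), closedBall a ρ ⊆ ball c R := fun a ha =>
        closedBall_subset_ball' (by rw [mem_ball] at ha; linarith)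
      -- Circles of the fixed radius ρ around points of V have integral zero, which bounds h' on V
      -- uniformly; density of V and continuity of h' extend the bound. Hence conj h is almost
      -- constant and f is close to the entire function g + conj(h c).
      have hd : ∀ a ∈ ball c (R - ρ), ‖deriv h a‖ ≤ ε / ρ := by
        have hdV : ∀ a ∈ V ∩ ball c (R - ρ), ‖deriv h a‖ ≤ ε / ρ := by
          intro a ha
          have h2 := hcirc hρ (hsub a ha.2) hg hh H
          rw [hfzero hρ (hsub a ha.2) ha.1, zero_sub, norm_neg] at h2
          simp only [norm_mul, Complex.norm_I, norm_pow, Complex.norm_real, Real.norm_eq_abs,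
            abs_of_pos Real.pi_pos, abs_of_pos hρ, Complex.norm_ofNat, RCLike.norm_conj,
            mul_one] at h2
          rw [le_div_iff₀ hρ]
          have : 0 < 2 * Real.pi * ρ := by positivity
          nlinarith
        intro a ha
        have hcl : a ∈ closure (V ∩ ball c (R - ρ)) := by
          have h1 : a ∈ closure (V ∩ ball c R) := hdense (ball_subset_ball (by linarith) ha)
          have h2 : a ∈ closure (ball c (R - ρ) ∩ (V ∩ ball c R)) :=
            isOpen_ball.inter_closure ⟨ha, h1⟩
          refine closure_mono ?_ h2
          exact fun z hz => ⟨hz.2.1, hz.1⟩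
        have hdc : Continuous (deriv h) :=
          (hh.contDiff (n := 1)).continuous_deriv le_rfl
        have : (𝓝[V ∩ ball c (R - ρ)] a).NeBot := mem_closure_iff_nhdsWithin_neBot.1 hcl
        exact le_of_tendsto (hdc.norm.continuousWithinAt (s := V ∩ ball c (R - ρ)) (x := a))
          (eventually_nhdsWithin_of_forall hdV)
      refine ⟨fun z => g z + starRingEnd ℂ (h c), hg.add_const _, fun z hz => ?_⟩
      have hz1 : ‖h z - h c‖ ≤ ε / ρ * ‖z - c‖ :=
        (convex_ball c (R - ρ)).norm_image_sub_le_of_norm_deriv_le (fun x _ => hh x) hd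
          (mem_ball_self (by linarith)) hz
      have hz2 : ‖z - c‖ ≤ R := by rw [← dist_eq_norm]; rw [mem_ball] at hz; linarith
      have hz3 := H z (ball_subset_ball (by linarith) hz)
      calc ‖f z - (g z + starRingEnd ℂ (h c))‖
          = ‖(f z - g z - starRingEnd ℂ (h z)) + starRingEnd ℂ (h z - h c)‖ := by
            rw [map_sub]; congr 1; ring
        _ ≤ ε + ε / ρ * R := by
            refine norm_add_le_of_le hz3 ?_
            rw [RCLike.norm_conj]
            exact hz1.trans (by gcongr)
        _ = _ := by ring
    choose! G hGd hG using hstep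
    have hu : TendstoUniformlyOn (fun n : ℕ => G (1 / (n + 1) : ℝ)) f atTop (ball c (R - ρ)) := by
      rw [Metric.tendstoUniformlyOn_iff]
      intro ε hε
      have hlim : Tendsto (fun n : ℕ => (1 + R / ρ) * (1 / (n + 1) : ℝ)) atTop (𝓝 ((1 + R / ρ) * 0)) :=
        tendsto_one_div_add_atTop_nhds_zero_nat.const_mul _
      rw [mul_zero] at hlim
      filter_upwards [hlim.eventually (gt_mem_nhds hε)] with n hn z hz
      rw [dist_eq_norm]
      exact (hG _ Nat.one_div_pos_of_nat z hz).trans_lt hn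
    exact hu.tendstoLocallyUniformlyOn.differentiableOn
      (Eventually.of_forall fun n => (hGd _ Nat.one_div_pos_of_nat).differentiableOn) isOpen_ball
  intro z hz
  rw [mem_ball] at hz
  have h1 := hsmall ((R - dist z c) / 2) (by linarith) (by linarith [dist_nonneg (x := z) (y := c)])
  exact (h1.differentiableAt (isOpen_ball.mem_nhds (by rw [mem_ball]; linarith))).differentiableWithinAt

/-- Near `z`, the complement of `V` is the zero set of a continuous vector-valued function that is
holomorphic on `V`. -/
def IsLocalZeroSet (V : Set ℂ) (z : ℂ) : Prop :=
  ∃ (m : ℕ) (R : ℝ) (E : ℂ → Fin m → ℂ), 0 < R ∧ ContinuousOn E (closedBall z R) ∧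
    DifferentiableOn ℂ E (V ∩ ball z R) ∧ (∀ w ∈ closedBall z R, w ∉ V → E w = 0) ∧
    ∀ w ∈ V ∩ ball z R, E w ≠ 0

/-- The closure of V is open. Otherwise some c outside it lies close to a point of V, and 1/(w - c)
is holomorphic on V near c. On the frontier it is at most 2/R wherever `E` does not vanish, so by
the maximum principle it is at most 2/R at a point of V nearer to c than R/2, a contradiction. -/
theorem dense_of_isLocalZeroSet {V : Set ℂ} (hV : IsOpen V) (hne : V.Nonempty)
    (h : ∀ z ∉ V, IsLocalZeroSet V z) : Dense V := by
  have hopen : IsOpen (closure V) := by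
    rw [isOpen_iff_mem_nhds]
    intro z hz
    by_cases hzV : z ∈ V
    · exact Filter.mem_of_superset (hV.mem_nhds hzV) subset_closure
    obtain ⟨m, R, E, hR, hEc, hEd, hE0, hEne⟩ := h z hzV
    refine Filter.mem_of_superset (ball_mem_nhds z (show 0 < R / 4 by linarith)) fun c hc => ?_
    by_contra hcV
    obtain ⟨α, hαV, hα⟩ := Metric.mem_closure_iff.1 hz (R / 4) (by linarith)
    rw [mem_ball] at hc
    have hsub : closedBall c (R / 2) ⊆ ball z R := closedBall_subset_ball' (by linarith)
    have hαc : dist α c < R / 2 := by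
      have := dist_triangle α z c
      rw [dist_comm α z, dist_comm z c] at this; linarith
    have hα0 : 0 < dist α c := dist_pos.2 fun h => hcV (subset_closure (h ▸ hαV))
    have hUsub : closure (V ∩ ball c (R / 2)) ⊆ closedBall c (R / 2) :=
      (closure_mono Set.inter_subset_right).trans closure_ball_subset_closedBall
    have hUne : ∀ w ∈ closure (V ∩ ball c (R / 2)), w - c ≠ 0 := fun w hw h0 =>
      hcV (closure_mono Set.inter_subset_left (sub_eq_zero.1 h0 ▸ hw))
    have := norm_le_of_frontier_or_eq_zero (U := V ∩ ball c (R / 2)) (E := E)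
      (g := fun w => (w - c)⁻¹) (m := (R / 2)⁻¹) (a := α)
      (isBounded_ball.subset Set.inter_subset_right)
      ⟨hEd.mono fun w hw => ⟨hw.1, hsub (ball_subset_closedBall hw.2)⟩,
        hEc.mono (hUsub.trans (hsub.trans ball_subset_closedBall))⟩
      ⟨fun w hw => ((differentiableAt_id.sub_const c).inv
          (hUne w (subset_closure hw))).differentiableWithinAt,
        (continuousOn_id.sub continuousOn_const).inv₀ hUne⟩ (by positivity) ?_ ⟨hαV, hαc⟩
      (hEne α ⟨hαV, hsub hαc.le⟩)
    · rw [norm_inv, ← dist_eq_norm, inv_le_inv₀ hα0 (by linarith)] at this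
      linarith
    · intro w hw
      have hw1 := hUsub (frontier_subset_closure hw)
      by_cases hwV : w ∈ V
      · right
        rw [(hV.inter isOpen_ball).frontier_eq] at hw
        have : ¬ dist w c < R / 2 := fun hb => hw.2 ⟨hwV, hb⟩
        rw [norm_inv, ← dist_eq_norm]
        exact inv_anti₀ (by linarith) (not_lt.1 this)
      · exact Or.inl (hE0 w (ball_subset_closedBall (hsub hw1)) hwV)
  exact dense_iff_closure_eq.2 (IsClopen.eq_univ ⟨isClosed_closure, hopen⟩ hne.closure)

/-- Radó's theorem applied to the components of `E` themselves shows that they are holomorphic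
around z. By density of V one of them is not identically zero there, so its zeros are isolated. -/
theorem IsLocalZeroSet.eventually_mem {V : Set ℂ} {z : ℂ} (h : IsLocalZeroSet V z)
    (hV : IsOpen V) (hdense : Dense V) : ∀ᶠ w in 𝓝[≠] z, w ∈ V := by
  obtain ⟨m, R, E, hR, hEc, hEd, hE0, hEne⟩ := h
  have hz : z ∈ ball z R := mem_ball_self hR
  have hd : ball z R ⊆ closure (V ∩ ball z R) := by
    intro w hw
    rw [Set.inter_comm]
    exact isOpen_ball.inter_closure ⟨hw, hdense w⟩
  have hdiff : ∀ i, DifferentiableOn ℂ (fun w => E w i) (ball z R) := fun i =>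
    differentiableOn_ball_of_zero_set hR hV hd hEc hEd hE0 hEne
      ((continuous_apply i).comp_continuousOn hEc) (differentiableOn_pi.1 hEd i)
  by_cases hall : ∀ i, ∀ᶠ w in 𝓝 z, E w i = 0
  · exfalso
    have h1 : ∀ᶠ w in 𝓝 z, E w = 0 := by
      filter_upwards [eventually_all.2 hall] with w hw
      exact funext hw
    obtain ⟨w, hw1, hw2, hw3⟩ := ((mem_closure_iff_frequently.1 (hdense z)).and_eventually
      (h1.and (ball_mem_nhds z hR))).exists
    exact hEne w ⟨hw1, hw3⟩ hw2
  · push Not at hall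
    obtain ⟨i, hi⟩ := hall
    have han : AnalyticAt ℂ (fun w => E w i) z := (hdiff i).analyticAt (ball_mem_nhds z hR)
    rcases han.eventually_eq_zero_or_eventually_ne_zero with h0 | h0
    · exact absurd h0 (by simpa [Filter.not_eventually] using hi)
    · filter_upwards [h0, mem_nhdsWithin_of_mem_nhds (closedBall_mem_nhds z hR)] with w hw hwb
      by_contra hwV
      exact hw (by rw [hE0 w hwb hwV]; rfl)

/-- The hypothesis in the coordinate 1/w at infinity makes the complement of V bounded, hence
compact, and each of its points is isolated. -/
theorem finite_compl_of_isLocalZeroSet {V : Set ℂ} (hV : IsOpen V) (hne : V.Nonempty)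
    (h : ∀ z ∉ V, IsLocalZeroSet V z) (hinf : IsLocalZeroSet {w | w ≠ 0 ∧ w⁻¹ ∈ V} 0) :
    Vᶜ.Finite := by
  have hdense := dense_of_isLocalZeroSet hV hne h
  have hV' : IsOpen {w : ℂ | w ≠ 0 ∧ w⁻¹ ∈ V} :=
    (continuousOn_inv₀ (G₀ := ℂ)).isOpen_inter_preimage isOpen_compl_singleton hV
  have hdense' : Dense {w : ℂ | w ≠ 0 ∧ w⁻¹ ∈ V} := by
    have h1 : ({0}ᶜ : Set ℂ) ⊆ closure {w : ℂ | w ≠ 0 ∧ w⁻¹ ∈ V} := by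
      intro w hw
      have hw' : w ≠ 0 := hw
      rw [mem_closure_iff_frequently]
      have h2 : ∃ᶠ v in 𝓝 w⁻¹, v ∈ V := mem_closure_iff_frequently.1 (hdense _)
      have h3 : Tendsto (fun v : ℂ => v⁻¹) (𝓝 w⁻¹) (𝓝 w) := by
        simpa using (continuousAt_inv₀ (inv_ne_zero hw')).tendsto
      refine h3.frequently ((h2.and_eventually
        (isOpen_compl_singleton.mem_nhds (inv_ne_zero hw'))).mono fun v hv => ?_)
      exact ⟨inv_ne_zero hv.2, by simpa using hv.1⟩
    refine dense_closure.1 (Dense.mono h1 ?_)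
    exact dense_compl_singleton 0
  have h0 := hinf.eventually_mem hV' hdense'
  obtain ⟨ε, hε, hε'⟩ := Metric.mem_nhdsWithin_iff.1 h0
  have hcpt : IsCompact Vᶜ := by
    refine (isCompact_closedBall (0 : ℂ) ε⁻¹).of_isClosed_subset hV.isClosed_compl fun z hz => ?_
    rw [mem_closedBall_zero_iff]
    by_contra! hlt
    have hz0 : z ≠ 0 := norm_pos_iff.1 ((inv_pos.2 hε).trans hlt)
    have := hε' ⟨by simpa using inv_lt_of_inv_lt₀ hε hlt, inv_ne_zero hz0⟩
    exact hz (by simpa using this.2)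
  by_contra hinf'
  obtain ⟨z, hz, hacc⟩ := Set.Infinite.exists_accPt_of_subset_isCompact hinf' hcpt subset_rfl
  have h1 := (h z hz).eventually_mem hV hdense
  rw [accPt_iff_frequently_nhdsNE] at hacc
  exact hacc (h1.mono fun w hw => by simpa using hw)

end CurvesAtInfinity
end

/-! ### Holomorphic division by powers of a coordinate in two variables. -/

noncomputable section

namespace CurvesAtInfinity

open Metric

/-! ### Division by a power of a coordinate -/

/-- A continuous family of functions `H (·, t)` on a compact space, each holomorphic in `t`, is
holomorphic in `t` with respect to the supremum norm. -/
theorem exists_analyticAt_curry {K : Type*} [TopologicalSpace K] [CompactSpace K] {H : K → ℂ → ℂ}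
    {t₀ : ℂ} {ρ : ℝ} (hρ : 0 < ρ)
    (hc : ContinuousOn (fun q : K × ℂ => H q.1 q.2) (Set.univ ×ˢ closedBall t₀ ρ))
    (hd : ∀ k, DifferentiableOn ℂ (H k) (ball t₀ ρ)) :
    ∃ v : ℂ → C(K, ℂ), AnalyticAt ℂ v t₀ ∧ ∀ t ∈ ball t₀ ρ, ∀ k, v t k = H k t := by
  classical
  let F : C(closedBall t₀ ρ × K, ℂ) := ⟨fun q => H q.2 q.1, by
    have := hc.comp_continuous (f := fun q : closedBall t₀ ρ × K => ((q.2, (q.1 : ℂ)) : K × ℂ))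
      (by fun_prop) (fun q => ⟨trivial, q.1.2⟩)
    exact this⟩
  let v : ℂ → C(K, ℂ) := fun t => if h : t ∈ closedBall t₀ ρ then F.curry ⟨t, h⟩ else 0
  have hv : ContinuousOn v (closedBall t₀ ρ) := by
    rw [continuousOn_iff_continuous_domRestrict]
    convert! F.curry.continuous using 1
    ext t k
    have ht : dist (t : ℂ) t₀ ≤ ρ := t.2
    simp [v, Set.domRestrict, ht]
  have hvk : ∀ t ∈ closedBall t₀ ρ, ∀ k, v t k = H k t := by
    intro t ht k
    simp only [v, dif_pos ht]
    rfl
  refine ⟨v, ?_, fun t ht => hvk t (ball_subset_closedBall ht)⟩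
  have hci : CircleIntegrable v t₀ ρ := (hv.mono sphere_subset_closedBall).circleIntegrable hρ.le
  lift ρ to NNReal using hρ.le
  have hρ' : 0 < ρ := by exact_mod_cast hρ
  -- The Cauchy integral of a continuous function with values in the Banach space C(K, ℂ) is a power
  -- series. Evaluation at each k reduces its identification with `v` to the scalar Cauchy formula.
  refine (hasFPowerSeriesOn_cauchy_integral hci hρ').analyticAt.congr ?_
  filter_upwards [ball_mem_nhds t₀ hρ] with t ht
  ext k
  have hne : ∀ z ∈ sphere t₀ (ρ : ℝ), z - t ≠ 0 := by
    intro z hz h0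
    rw [sub_eq_zero.1 h0, mem_sphere] at hz
    exact absurd (mem_ball.1 ht) (by rw [hz]; exact lt_irrefl _)
  have hci' : CircleIntegrable (fun z => (z - t)⁻¹ • v z) t₀ ρ :=
    (((continuousOn_id.sub continuousOn_const).inv₀ hne).smul
      (hv.mono sphere_subset_closedBall)).circleIntegrable hρ.le
  have h1 : (∮ z in C(t₀, ρ), (z - t)⁻¹ • v z) k = ∮ z in C(t₀, ρ), (z - t)⁻¹ • H k z := by
    have := (ContinuousMap.evalCLM ℂ k : C(K, ℂ) →L[ℂ] ℂ).intervalIntegral_comp_comm hci'.out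
    simp only [ContinuousMap.evalCLM_apply] at this
    rw [circleIntegral, ← this, circleIntegral]
    refine intervalIntegral.integral_congr fun θ _ => ?_
    simp [hvk _ (sphere_subset_closedBall (circleMap_mem_sphere t₀ hρ.le θ)) k]
  rw [ContinuousMap.smul_apply, h1]
  have hkc : ContinuousOn (H k) (closedBall t₀ ρ) :=
    hc.comp (f := fun t => ((k, t) : K × ℂ)) (by fun_prop) (fun t ht => ⟨trivial, ht⟩)
  rw [Complex.two_pi_I_inv_smul_circleIntegral_sub_inv_smul_of_differentiable_on_off_countable
    Set.countable_empty ht hkc fun z hz => (hd k).differentiableAt (isOpen_ball.mem_nhds hz.1)]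
  exact (hvk t (ball_subset_closedBall ht) k).symm

/-- Integration along a circle against a continuous weight. -/
theorem exists_clm_circleIntegral {ρ : ℝ} (hρ : 0 < ρ) {κ : ℂ → ℂ}
    (hκ : ContinuousOn κ (sphere 0 ρ)) :
    ∃ L : C(sphere (0 : ℂ) ρ, ℂ) →L[ℂ] ℂ, ∀ (f : C(sphere (0 : ℂ) ρ, ℂ)) (g : ℂ → ℂ),
      (∀ w : sphere (0 : ℂ) ρ, f w = g w) → L f = ∮ z in C(0, ρ), κ z * g z := by
  let e : C(ℝ, sphere (0 : ℂ) ρ) :=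
    ⟨fun θ => ⟨circleMap 0 ρ θ, circleMap_mem_sphere 0 hρ.le θ⟩, by
      exact (continuous_circleMap 0 ρ).subtype_mk _⟩
  let k : ℝ → ℂ := fun θ => deriv (circleMap 0 ρ) θ * κ (e θ)
  have hk : Continuous k := by
    have : Continuous fun θ => κ (e θ) :=
      hκ.comp_continuous (continuous_subtype_val.comp e.continuous) fun θ => (e θ).2
    simp only [k, deriv_circleMap]
    exact (((continuous_circleMap 0 ρ).mul continuous_const)).mul this
  let L₀ : C(sphere (0 : ℂ) ρ, ℂ) →ₗ[ℂ] ℂ :=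
    { toFun := fun f => ∫ θ in (0 : ℝ)..2 * Real.pi, k θ * f (e θ)
      map_add' := by
        intro f g
        rw [← intervalIntegral.integral_add]
        · exact intervalIntegral.integral_congr fun θ _ => by simp; ring
        · exact (hk.mul (f.continuous.comp e.continuous)).intervalIntegrable _ _
        · exact (hk.mul (g.continuous.comp e.continuous)).intervalIntegrable _ _
      map_smul' := by
        intro c f
        rw [RingHom.id_apply, ← intervalIntegral.integral_smul]
        exact intervalIntegral.integral_congr fun θ _ => by simp; ring }
  obtain ⟨C, hC⟩ := (isCompact_Icc (a := (0 : ℝ)) (b := 2 * Real.pi)).exists_bound_of_continuousOn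
    hk.continuousOn
  have hb : ∀ f, ‖L₀ f‖ ≤ (C * (2 * Real.pi)) * ‖f‖ := by
    intro f
    have := intervalIntegral.norm_integral_le_of_norm_le_const (a := (0 : ℝ)) (b := 2 * Real.pi)
      (f := fun θ => k θ * f (e θ)) (C := C * ‖f‖) ?_
    · rw [sub_zero, abs_of_pos Real.two_pi_pos] at this
      calc _ ≤ C * ‖f‖ * (2 * Real.pi) := this
        _ = _ := by ring
    · intro θ hθ
      rw [Set.uIoc_of_le Real.two_pi_pos.le] at hθ
      rw [norm_mul]
      have h1 := hC θ ⟨hθ.1.le, hθ.2⟩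
      exact mul_le_mul h1 (f.norm_coe_le_norm _) (norm_nonneg _) ((norm_nonneg _).trans h1)
  refine ⟨L₀.mkContinuous _ hb, fun f g hfg => ?_⟩
  rw [LinearMap.mkContinuous_apply, circleIntegral]
  refine intervalIntegral.integral_congr fun θ _ => ?_
  simp only [k, hfg, smul_eq_mul]
  simp only [e, ContinuousMap.coe_mk]
  ring

/-- If `H (·, t)` vanishes at `0` to order at least `m` for each `t` near `t₀`, then `H` is divisible
by the `m`-th power of the first coordinate. -/
theorem exists_analyticAt_eq_pow_mul {H : ℂ × ℂ → ℂ} {t₀ : ℂ} (hH : AnalyticAt ℂ H (0, t₀)) (m : ℕ)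
    (hm : ∀ᶠ t in 𝓝 t₀, (m : ℕ∞) ≤ analyticOrderAt (fun s => H (s, t)) 0) :
    ∃ Ξ : ℂ × ℂ → ℂ, AnalyticAt ℂ Ξ (0, t₀) ∧ ∀ᶠ z in 𝓝 ((0 : ℂ), t₀), H z = z.1 ^ m * Ξ z := by
  obtain ⟨ρ, hρ, hball⟩ : ∃ ρ > 0, closedBall (0 : ℂ) ρ ×ˢ closedBall t₀ ρ ⊆
      {z | AnalyticAt ℂ H z ∧ (m : ℕ∞) ≤ analyticOrderAt (fun s => H (s, z.2)) 0} := by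
    have h1 : ∀ᶠ z in 𝓝 ((0 : ℂ), t₀), (m : ℕ∞) ≤ analyticOrderAt (fun s => H (s, z.2)) 0 :=
      (continuous_snd.tendsto ((0 : ℂ), t₀)).eventually hm
    obtain ⟨ρ, hρ, h⟩ := Metric.nhds_basis_closedBall.mem_iff.1 (hH.eventually_analyticAt.and h1)
    exact ⟨ρ, hρ, by rwa [closedBall_prod_same]⟩
  have hHc : ContinuousOn H (closedBall (0 : ℂ) ρ ×ˢ closedBall t₀ ρ) := fun z hz =>
    (hball hz).1.continuousAt.continuousWithinAt
  obtain ⟨v, hv, hvH⟩ := exists_analyticAt_curry (K := sphere (0 : ℂ) ρ)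
    (H := fun w t => H ((w : ℂ), t)) hρ
    (hHc.comp (f := fun q : sphere (0 : ℂ) ρ × ℂ => (((q.1 : ℂ), q.2) : ℂ × ℂ)) (by fun_prop)
      (fun q hq => ⟨sphere_subset_closedBall q.1.2, hq.2⟩))
    (fun w t ht => by
      have h1 := (hball (show ((w : ℂ), t) ∈ _ from ⟨sphere_subset_closedBall w.2,
        ball_subset_closedBall ht⟩)).1
      have h2 : AnalyticAt ℂ (fun t => H ((w : ℂ), t)) t :=
        h1.comp_of_eq (f := fun t : ℂ => (((w : ℂ), t) : ℂ × ℂ)) (by fun_prop) rfl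
      exact h2.differentiableAt.differentiableWithinAt)
  -- For fixed t the quotient H(s, t)/s^m has a removable singularity at 0, so it is given by its
  -- Cauchy integral over a circle, which only sees values with w ≠ 0.
  have hmain : ∀ t ∈ ball t₀ ρ, ∀ s ∈ ball (0 : ℂ) ρ, H (s, t) = s ^ m *
      ((2 * Real.pi * Complex.I : ℂ)⁻¹ • ∮ w in C(0, ρ), (w - s)⁻¹ • (H (w, t) / w ^ m)) := by
    intro t ht s hs
    have han : ∀ w ∈ closedBall (0 : ℂ) ρ, AnalyticAt ℂ (fun s => H (s, t)) w := fun w hw =>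
      (hball (show (w, t) ∈ _ from ⟨hw, ball_subset_closedBall ht⟩)).1.comp_of_eq
        (f := fun s : ℂ => ((s, t) : ℂ × ℂ)) (by fun_prop) rfl
    have h0 := han 0 (mem_closedBall_self hρ.le)
    obtain ⟨q, hq, hqe⟩ := (natCast_le_analyticOrderAt h0).1
      (hball (show ((0 : ℂ), t) ∈ _ from ⟨mem_closedBall_self hρ.le, ball_subset_closedBall ht⟩)).2
    simp only [sub_zero, smul_eq_mul] at hqe
    let Q : ℂ → ℂ := fun w => if w = 0 then q 0 else H (w, t) / w ^ m
    have hQd : ∀ w ∈ closedBall (0 : ℂ) ρ, DifferentiableAt ℂ Q w := by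
      intro w hw
      by_cases hw0 : w = 0
      · subst hw0
        refine hq.differentiableAt.congr_of_eventuallyEq ?_
        filter_upwards [hqe] with w hw
        by_cases hw0 : w = 0
        · simp [Q, hw0]
        · simp only [Q, if_neg hw0, hw]
          field_simp
      · have h1 : DifferentiableAt ℂ (fun w => H (w, t) / w ^ m) w :=
          (han w hw).differentiableAt.div (differentiableAt_id.pow m) (pow_ne_zero m hw0)
        refine h1.congr_of_eventuallyEq ?_
        filter_upwards [isOpen_compl_singleton.mem_nhds hw0] with w' hw'
        exact if_neg hw'
    have hcauchy :=
      Complex.two_pi_I_inv_smul_circleIntegral_sub_inv_smul_of_differentiable_on_off_countable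
        Set.countable_empty hs (fun w hw => (hQd w hw).continuousAt.continuousWithinAt)
        fun w hw => hQd w (ball_subset_closedBall hw.1)
    have hcongr : (∮ w in C(0, ρ), (w - s)⁻¹ • (H (w, t) / w ^ m)) =
        ∮ w in C(0, ρ), (w - s)⁻¹ • Q w := by
      refine circleIntegral.integral_congr hρ.le fun w hw => ?_
      have hw0 : w ≠ 0 := by
        rintro rfl
        rw [mem_sphere, dist_self] at hw
        exact hρ.ne hw
      simp only [Q, if_neg hw0]
    rw [hcongr, hcauchy]
    by_cases hs0 : s = 0
    · have := hqe.self_of_nhds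
      simp only [Q, hs0, if_true]
      exact this
    · simp only [Q, if_neg hs0]
      field_simp
  obtain ⟨L, hL⟩ := exists_clm_circleIntegral hρ
    (κ := fun w => (2 * Real.pi * Complex.I : ℂ)⁻¹ * (w ^ m)⁻¹)
    (continuousOn_const.mul ((continuousOn_id.pow m).inv₀ fun w hw => pow_ne_zero m (by
      rintro rfl
      rw [mem_sphere, dist_self] at hw
      exact hρ.ne hw)))
  let idK : C(sphere (0 : ℂ) ρ, ℂ) := ⟨Subtype.val, continuous_subtype_val⟩
  have hunit : ∀ s ∈ ball (0 : ℂ) ρ, IsUnit (idK - s • (1 : C(sphere (0 : ℂ) ρ, ℂ))) := by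
    intro s hs
    rw [ContinuousMap.isUnit_iff_forall_ne_zero]
    intro w h0
    have h1 : (w : ℂ) = s := by simpa [idK, sub_eq_zero] using h0
    rw [← h1, mem_ball, mem_sphere.1 w.2] at hs
    exact lt_irrefl _ hs
  -- Joint analyticity in (s, t) is obtained in the Banach algebra of continuous functions on the
  -- circle. The kernel 1/(w - s) is an inverse there, hence analytic in s, and it is multiplied by
  -- the analytic curve `v` before a continuous functional is applied.
  have hu : AnalyticAt ℂ
      (fun s : ℂ => Ring.inverse (idK - s • (1 : C(sphere (0 : ℂ) ρ, ℂ)))) 0 := by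
    obtain ⟨U, hU⟩ := hunit 0 (mem_ball_self hρ)
    refine AnalyticAt.comp_of_eq (analyticAt_inverse (𝕜 := ℂ) U) (f := fun s : ℂ =>
      idK - s • (1 : C(sphere (0 : ℂ) ρ, ℂ))) ?_ hU.symm
    exact analyticAt_const.sub (analyticAt_id.smul analyticAt_const)
  refine ⟨fun z => L (v z.2 * Ring.inverse (idK - z.1 • (1 : C(sphere (0 : ℂ) ρ, ℂ)))), ?_, ?_⟩
  · refine (L.analyticAt _).comp ?_
    exact (hv.comp_of_eq (f := Prod.snd) (analyticAt_snd) rfl).mul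
      (hu.comp_of_eq (f := Prod.fst) (analyticAt_fst) rfl)
  · filter_upwards [(continuous_fst.isOpen_preimage _ isOpen_ball).mem_nhds
        (show ((0 : ℂ), t₀) ∈ Prod.fst ⁻¹' ball (0 : ℂ) ρ from mem_ball_self hρ),
      (continuous_snd.isOpen_preimage _ isOpen_ball).mem_nhds
        (show ((0 : ℂ), t₀) ∈ Prod.snd ⁻¹' ball t₀ ρ from mem_ball_self hρ)] with z hz1 hz2
    rw [hL _ (fun w => H (w, z.2) * (w - z.1)⁻¹)]
    · have := hmain z.2 hz2 z.1 hz1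
      rw [Prod.mk.eta] at this
      rw [this, ← circleIntegral.integral_smul]
      congr 1
      refine congrArg (fun f : ℂ → ℂ => ∮ w in C(0, ρ), f w) (funext fun w => ?_)
      simp only [smul_eq_mul]
      ring
    · intro w
      rw [ContinuousMap.mul_apply, hvH _ hz2]
      congr 1
      have h1 := congrArg (fun f : C(sphere (0 : ℂ) ρ, ℂ) => f w)
        (Ring.mul_inverse_cancel _ (hunit z.1 hz1))
      simp only [ContinuousMap.mul_apply, ContinuousMap.sub_apply, ContinuousMap.smul_apply,
        ContinuousMap.one_apply, smul_eq_mul, mul_one] at h1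
      exact eq_inv_of_mul_eq_one_right h1

/-- A holomorphic function vanishing on the line `s = 0` is divisible by `s`. -/
theorem exists_analyticAt_eq_mul {H : ℂ × ℂ → ℂ} {t₀ : ℂ} (hH : AnalyticAt ℂ H (0, t₀))
    (h0 : ∀ᶠ t in 𝓝 t₀, H (0, t) = 0) :
    ∃ Ξ : ℂ × ℂ → ℂ, AnalyticAt ℂ Ξ (0, t₀) ∧ ∀ᶠ z in 𝓝 ((0 : ℂ), t₀), H z = z.1 * Ξ z := by
  have h1 : ∀ᶠ t in 𝓝 t₀, ((1 : ℕ) : ℕ∞) ≤ analyticOrderAt (fun s => H (s, t)) 0 := by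
    have h2 : ∀ᶠ t in 𝓝 t₀, AnalyticAt ℂ H (0, t) :=
      (Continuous.prodMk_right (0 : ℂ)).continuousAt.eventually hH.eventually_analyticAt
    filter_upwards [h0, h2] with t ht ht2
    have h3 : AnalyticAt ℂ (fun s => H (s, t)) 0 :=
      ht2.comp_of_eq (f := fun s : ℂ => ((s, t) : ℂ × ℂ)) (by fun_prop) rfl
    rw [Nat.cast_one, Order.one_le_iff_pos, pos_iff_ne_zero, h3.analyticOrderAt_ne_zero]
    exact ht
  simpa using exists_analyticAt_eq_pow_mul hH 1 h1

end CurvesAtInfinity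
end

/-! ### Orders of Puiseux polynomials, the ultrametric comparison, and test polynomials. -/

noncomputable section

namespace CurvesAtInfinity

/-! ### Orders of Laurent polynomials -/

/-- The exponent of `τ` in `x ^ e`, for `x = τ ^ (-N)`. -/
def expo (N : ℕ) (e : ℚ) : ℤ := ⌊-((N : ℚ) * e)⌋

/-- `φ(x)` for `x = τ ^ (-N)`. -/
def evalPuiseux (φ : ℚ →₀ ℂ) (N : ℕ) (τ : ℂ) : ℂ := φ.sum fun e a => a * τ ^ expo N e

/-- The exponents of `φ` lie in `(1 / N) ℤ`. -/
def HasDenominator (φ : ℚ →₀ ℂ) (N : ℕ) : Prop := ∀ e ∈ φ.support, ∃ j : ℤ, (j : ℚ) = N * e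

theorem expo_cast {N : ℕ} {e : ℚ} (h : ∃ j : ℤ, (j : ℚ) = N * e) : (expo N e : ℚ) = -(N * e) := by
  obtain ⟨j, hj⟩ := h
  rw [expo, ← hj, ← Int.cast_neg, Int.floor_intCast]

theorem evalPuiseux_eq_sum {φ : ℚ →₀ ℂ} {S : Finset ℚ} (h : φ.support ⊆ S) (N : ℕ) (τ : ℂ) :
    evalPuiseux φ N τ = ∑ e ∈ S, φ e * τ ^ expo N e :=
  Finsupp.sum_of_support_subset _ h _ (by simp)

theorem evalPuiseux_add (φ ψ : ℚ →₀ ℂ) (N : ℕ) (τ : ℂ) :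
    evalPuiseux (φ + ψ) N τ = evalPuiseux φ N τ + evalPuiseux ψ N τ :=
  Finsupp.sum_add_index' (by simp) (by intros; ring)

theorem evalPuiseux_single (r : ℚ) (c : ℂ) (N : ℕ) (τ : ℂ) :
    evalPuiseux (Finsupp.single r c) N τ = c * τ ^ expo N r :=
  Finsupp.sum_single_index (by simp)

theorem meromorphicAt_sum_zpow {ι : Type*} (S : Finset ι) (b : ι → ℂ) (m : ι → ℤ) (x : ℂ) :
    MeromorphicAt (fun τ : ℂ => ∑ e ∈ S, b e * τ ^ m e) x := by
  refine MeromorphicAt.fun_sum fun e _ => ?_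
  fun_prop

theorem meromorphicAt_evalPuiseux (φ : ℚ →₀ ℂ) (N : ℕ) (ω x : ℂ) :
    MeromorphicAt (fun τ => evalPuiseux φ N (ω * τ)) x := by
  simp only [evalPuiseux_eq_sum subset_rfl, mul_zpow, ← mul_assoc]
  exact meromorphicAt_sum_zpow _ _ _ _

theorem le_meromorphicOrderAt_sub {f g : ℂ → ℂ} {x : ℂ} (hf : MeromorphicAt f x)
    (hg : MeromorphicAt g x) :
    min (meromorphicOrderAt f x) (meromorphicOrderAt g x) ≤
      meromorphicOrderAt (fun z => f z - g z) x := by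
  have h := meromorphicOrderAt_add hf hg.neg
  rw [← meromorphicOrderAt_neg (f := g)] at h
  refine h.trans_eq (meromorphicOrderAt_congr ?_)
  exact Eventually.of_forall fun z => by simp [sub_eq_add_neg]

theorem le_meromorphicOrderAt_add {f g : ℂ → ℂ} {x : ℂ} (hf : MeromorphicAt f x)
    (hg : MeromorphicAt g x) :
    min (meromorphicOrderAt f x) (meromorphicOrderAt g x) ≤
      meromorphicOrderAt (fun z => f z + g z) x :=
  meromorphicOrderAt_add hf hg

theorem meromorphicOrderAt_const_mul_zpow {b : ℂ} (hb : b ≠ 0) (m : ℤ) :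
    meromorphicOrderAt (fun τ : ℂ => b * τ ^ m) 0 = m := by
  rw [meromorphicOrderAt_eq_int_iff (by fun_prop)]
  exact ⟨fun _ => b, analyticAt_const, hb, Eventually.of_forall fun z => by simp; ring⟩

theorem le_meromorphicOrderAt_sum {ι : Type*} {S : Finset ι} {f : ι → ℂ → ℂ} {x : ℂ}
    {n : WithTop ℤ} (hf : ∀ i ∈ S, MeromorphicAt (f i) x)
    (h : ∀ i ∈ S, n ≤ meromorphicOrderAt (f i) x) :
    n ≤ meromorphicOrderAt (fun z => ∑ i ∈ S, f i z) x := by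
  classical
  induction S using Finset.induction with
  | empty =>
    have : meromorphicOrderAt (fun _ : ℂ => (0 : ℂ)) x = ⊤ :=
      meromorphicOrderAt_eq_top_iff.2 (Eventually.of_forall fun _ => rfl)
    simp [this]
  | insert a S ha ih =>
    simp only [Finset.sum_insert ha]
    have h1 := ih (fun i hi => hf i (Finset.mem_insert_of_mem hi))
      (fun i hi => h i (Finset.mem_insert_of_mem hi))
    refine (le_min (h a (Finset.mem_insert_self a S)) h1).trans (le_meromorphicOrderAt_add
      (hf a (Finset.mem_insert_self a S)) (MeromorphicAt.fun_sum fun i hi => hf i (Finset.mem_insert_of_mem hi)))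

/-- The order of a Laurent polynomial is at most each of its exponents. -/
theorem meromorphicOrderAt_sum_zpow_le {ι : Type*} {S : Finset ι} {b : ι → ℂ} {m : ι → ℤ}
    (hm : Set.InjOn m S) {i : ι} (hi : i ∈ S) (hb : b i ≠ 0) :
    meromorphicOrderAt (fun τ : ℂ => ∑ e ∈ S, b e * τ ^ m e) 0 ≤ m i := by
  classical
  obtain ⟨j, hj, hmin⟩ := Finset.exists_min_image (S.filter fun e => b e ≠ 0) m
    ⟨i, Finset.mem_filter.2 ⟨hi, hb⟩⟩
  rw [Finset.mem_filter] at hj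
  have hsplit : (fun τ : ℂ => ∑ e ∈ S, b e * τ ^ m e) =
      (fun τ : ℂ => b j * τ ^ m j) + fun τ : ℂ => ∑ e ∈ S.erase j, b e * τ ^ m e := by
    ext τ
    exact (Finset.add_sum_erase S (fun e => b e * τ ^ m e) hj.1).symm
  have hrest : ((m j + 1 : ℤ) : WithTop ℤ) ≤
      meromorphicOrderAt (fun τ : ℂ => ∑ e ∈ S.erase j, b e * τ ^ m e) 0 := by
    refine le_meromorphicOrderAt_sum (fun e _ => by fun_prop) fun e he => ?_
    rw [Finset.mem_erase] at he
    by_cases hbe : b e = 0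
    · have : meromorphicOrderAt (fun τ : ℂ => b e * τ ^ m e) 0 = ⊤ :=
        meromorphicOrderAt_eq_top_iff.2 (Eventually.of_forall fun _ => by simp [hbe])
      simp [this]
    · rw [meromorphicOrderAt_const_mul_zpow hbe]
      have h1 := hmin e (Finset.mem_filter.2 ⟨he.2, hbe⟩)
      have h2 : m j ≠ m e := fun h => he.1 (hm he.2 hj.1 h.symm)
      exact_mod_cast lt_of_le_of_ne h1 h2
  rw [hsplit, meromorphicOrderAt_add_eq_left_of_lt (meromorphicAt_sum_zpow _ _ _ _),
    meromorphicOrderAt_const_mul_zpow hj.2]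
  · exact_mod_cast hmin i (Finset.mem_filter.2 ⟨hi, hb⟩)
  · rw [meromorphicOrderAt_const_mul_zpow hj.2]
    refine lt_of_lt_of_le ?_ hrest
    exact_mod_cast lt_add_one (m j)

theorem expo_injOn {N : ℕ} (hN : 0 < N) {S : Set ℚ} (hS : ∀ e ∈ S, ∃ j : ℤ, (j : ℚ) = N * e) :
    Set.InjOn (expo N) S := by
  intro e he e' he' h
  have h1 := expo_cast (hS e he)
  have h2 := expo_cast (hS e' he')
  rw [h, h2] at h1
  have : (N : ℚ) ≠ 0 := by positivity
  exact (mul_left_cancel₀ this (neg_injective h1)).symm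

/-- Scaling the parameter does not change orders. -/
theorem meromorphicOrderAt_comp_mul_left (f : ℂ → ℂ) {ω : ℂ} (hω : ω ≠ 0) :
    meromorphicOrderAt (fun τ => f (ω * τ)) 0 = meromorphicOrderAt f 0 := by
  have h := meromorphicOrderAt_comp_of_deriv_ne_zero (f := f) (g := fun τ : ℂ => ω * τ) (x := 0)
    (by fun_prop) (by simpa [deriv_const_mul_field'] using hω)
  simpa [Function.comp_def] using h

theorem meromorphicOrderAt_comp_pow {f : ℂ → ℂ} (hf : MeromorphicAt f 0) {D : ℕ} (hD : 0 < D) :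
    meromorphicOrderAt (fun τ => f (τ ^ D)) 0 = meromorphicOrderAt f 0 * (D : WithTop ℤ) := by
  have hord : analyticOrderAt (fun τ : ℂ => τ ^ D) 0 = D := by
    rw [AnalyticAt.analyticOrderAt_eq_natCast (by fun_prop)]
    exact ⟨fun _ => 1, analyticAt_const, one_ne_zero, Eventually.of_forall fun z => by simp⟩
  have h := MeromorphicAt.meromorphicOrderAt_comp (f := f) (g := fun τ : ℂ => τ ^ D) (x := 0)
    (by simpa [hD.ne'] using hf) (by fun_prop) (by
      rw [eventuallyConst_iff_analyticOrderAt_sub_eq_top]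
      simp only [zero_pow hD.ne', sub_zero, hord]
      simp)
  simp only [zero_pow hD.ne', sub_zero, hord] at h
  simpa [Function.comp_def] using h

theorem sum_withTop_false {ι : Type*} [Fintype ι] {a b : ι → WithTop ℤ} (hab : ∀ j, a j ≤ b j)
    {i : ι} (hi : a i < b i) (h : ∑ j, a j = ∑ j, b j) (ha : ∀ j, a j ≠ ⊤) : False := by
  have hb : ∀ j, b j ≠ ⊤ := by
    intro j hj
    have : ∑ j, b j = ⊤ := WithTop.sum_eq_top.2 ⟨j, Finset.mem_univ _, hj⟩
    rw [← h, WithTop.sum_eq_top] at this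
    obtain ⟨j', -, hj'⟩ := this
    exact ha j' hj'
  lift a to ι → ℤ using ha
  lift b to ι → ℤ using hb
  simp only [← WithTop.coe_sum, WithTop.coe_inj] at h
  refine (Finset.sum_lt_sum (fun j _ => ?_) ⟨i, Finset.mem_univ _, ?_⟩).ne h
  · exact WithTop.coe_le_coe.1 (hab j)
  · exact WithTop.coe_lt_coe.1 hi

/-- The ultrametric argument comparing a function `Y` with the roots `P j` of a polynomial, using
that the orders of the value at `Y` and at the generic elements `Q i` agree. -/
theorem exists_order_eq_of_sum_eq {ι : Type*} [Fintype ι] [Nonempty ι] {Y : ℂ → ℂ}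
    {P Q : ι → ℂ → ℂ} {k : ℤ} (hY : MeromorphicAt Y 0) (hP : ∀ j, MeromorphicAt (P j) 0)
    (hQ : ∀ j, MeromorphicAt (Q j) 0)
    (hsum : ∀ i, ∑ j, meromorphicOrderAt (fun τ => Y τ - P j τ) 0 =
      ∑ j, meromorphicOrderAt (fun τ => Q i τ - P j τ) 0)
    (hle : ∀ i j, meromorphicOrderAt (fun τ => Q i τ - P j τ) 0 ≤ k)
    (heq : ∀ i, meromorphicOrderAt (fun τ => Q i τ - P i τ) 0 = k) :
    (∀ j, meromorphicOrderAt (fun τ => Y τ - P j τ) 0 ≤ k) ∧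
      ∃ j, meromorphicOrderAt (fun τ => Y τ - P j τ) 0 = k := by
  -- If Y were closer than k to some root P i, then Y would be at least as close to every root P j
  -- as Q i is, and strictly closer to P i. The sums of orders would then differ.
  have hub : ∀ j, meromorphicOrderAt (fun τ => Y τ - P j τ) 0 ≤ k := by
    by_contra! hlt
    obtain ⟨i, hi⟩ := hlt
    refine sum_withTop_false (i := i) (fun j => ?_) ((heq i).trans_lt hi) (hsum i).symm
      fun j hj => by simpa [hj] using hle i j
    have h1 := le_meromorphicOrderAt_sub ((hQ i).sub (hP j)) ((hQ i).sub (hP i))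
    have h2 := le_meromorphicOrderAt_add (hY.sub (hP i)) (((hQ i).sub (hP j)).sub ((hQ i).sub (hP i)))
    have e1 : (fun z => ((Y - P i) z) + ((Q i - P j) - (Q i - P i)) z) = fun z => Y z - P j z := by
      ext z; simp
    rw [e1] at h2
    refine le_trans (le_min ?_ ?_) h2
    · exact (hle i j).trans hi.le
    · exact le_trans (le_min le_rfl ((hle i j).trans_eq (heq i).symm)) h1
  refine ⟨hub, ?_⟩
  -- Take the root P i nearest to Y. If its order were below k, then Q i would be at least as close
  -- to every root as Y, and strictly closer to P i, again contradicting the equality of sums.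
  obtain ⟨i, hi⟩ := Finite.exists_max fun j => meromorphicOrderAt (fun τ => Y τ - P j τ) 0
  refine ⟨i, le_antisymm (hub i) ?_⟩
  by_contra! hlt
  refine sum_withTop_false (i := i) (fun j => ?_) (hlt.trans_eq (heq i).symm) (hsum i)
    fun j hj => by simpa [hj] using hub j
  have h1 := le_meromorphicOrderAt_sub (hY.sub (hP i)) ((hQ i).sub (hP i))
  have h2 := le_meromorphicOrderAt_sub (hY.sub (hP j)) ((hY.sub (hP i)).sub ((hQ i).sub (hP i)))
  have e1 : (fun z => ((Y - P j) z) - ((Y - P i) - (Q i - P i)) z) = fun z => Q i z - P j z := by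
    ext z; simp
  rw [e1] at h2
  refine le_trans (le_min le_rfl ?_) h2
  refine (hi j).trans (le_trans (le_min le_rfl ?_) h1)
  exact hlt.le.trans_eq (heq i).symm

/-! ### Test polynomials -/

/-- A polynomial whose coefficients are invariant under `σ ↦ η σ` is a polynomial in `σ ^ N`. -/
theorem expand_contract_of_comp_eq {N : ℕ} (hN : 0 < N) {η : ℂ} (hη : IsPrimitiveRoot η N)
    {q : Polynomial ℂ} (h : q.comp (Polynomial.C η * Polynomial.X) = q) :
    Polynomial.expand ℂ N (Polynomial.contract N q) = q := by
  ext n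
  rw [Polynomial.coeff_expand hN, Polynomial.coeff_contract hN.ne']
  split_ifs with hd
  · rw [Nat.div_mul_cancel hd]
  · have h1 := congrArg (fun p => Polynomial.coeff p n) h
    simp only [Polynomial.comp_C_mul_X_coeff] at h1
    by_contra h0
    have h2 : η ^ n = 1 := mul_left_cancel₀ (Ne.symm h0) (by rw [h1, mul_one])
    exact hd ((hη.pow_eq_one_iff_dvd n).1 h2)

/-- There is a polynomial in `x` and `y` with value `∏ⱼ (x ^ L y - q(η ^ j σ))` for `x = σ ^ N`. -/
theorem exists_prod_conjugates {N : ℕ} (hN : 0 < N) {η : ℂ} (hη : IsPrimitiveRoot η N)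
    (q : Polynomial ℂ) (L : ℕ) :
    ∃ f : MvPolynomial (Fin 2) ℂ, ∀ σ y : ℂ, MvPolynomial.eval ![σ ^ N, y] f =
      ∏ j : Fin N, ((σ ^ N) ^ L * y - q.eval (η ^ (j : ℕ) * σ)) := by
  let g : ℕ → Polynomial (Polynomial ℂ) := fun j =>
    Polynomial.X - Polynomial.C (q.comp (Polynomial.C (η ^ j) * Polynomial.X))
  let Q : Polynomial (Polynomial ℂ) := ∏ j ∈ Finset.range N, g j
  let S : Polynomial ℂ →+* Polynomial ℂ := Polynomial.compRingHom (Polynomial.C η * Polynomial.X)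
  -- The substitution σ ↦ η σ permutes the N factors cyclically. The coefficients of the product are
  -- therefore invariant, that is, polynomials in σ^N = x.
  have hSg : ∀ j, (g j).map S = g (j + 1) := by
    intro j
    simp only [g, S, Polynomial.map_sub, Polynomial.map_X, Polynomial.map_C,
      Polynomial.coe_compRingHom_apply, Polynomial.comp_assoc]
    congr 3
    simp [pow_succ, mul_assoc]
  have hgN : g N = g 0 := by simp only [g, hη.pow_eq_one, pow_zero]
  have hQ : Q.map S = Q := by
    rw [Polynomial.map_prod]
    simp only [hSg]
    have h1 := Finset.prod_range_succ g N
    rw [Finset.prod_range_succ', hgN] at h1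
    exact mul_right_cancel₀ (Polynomial.X_sub_C_ne_zero _) h1
  have hcoef : ∀ i, Polynomial.expand ℂ N (Polynomial.contract N (Q.coeff i)) = Q.coeff i := by
    intro i
    refine expand_contract_of_comp_eq hN hη ?_
    have := congrArg (fun p => Polynomial.coeff p i) hQ
    simpa [S, Polynomial.coeff_map] using this
  refine ⟨∑ i ∈ Finset.range (Q.natDegree + 1),
    Polynomial.aeval (MvPolynomial.X 0) (Polynomial.contract N (Q.coeff i)) *
      (MvPolynomial.X 0 ^ L * MvPolynomial.X 1) ^ i, fun σ y => ?_⟩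
  have h1 : ∀ p : Polynomial ℂ, MvPolynomial.eval ![σ ^ N, y]
      (Polynomial.aeval (MvPolynomial.X 0) p) = p.eval (σ ^ N) := by
    intro p
    rw [Polynomial.aeval_def, Polynomial.hom_eval₂]
    simp [Polynomial.eval₂_eq_eval_map, MvPolynomial.algebraMap_eq]
    congr 1
    ext; simp
  have h2 : ∀ i, (Polynomial.contract N (Q.coeff i)).eval (σ ^ N) = (Q.coeff i).eval σ := by
    intro i
    rw [← Polynomial.expand_eval, hcoef]
  rw [map_sum]
  simp only [map_mul, map_pow, h1, h2, MvPolynomial.eval_X, Matrix.cons_val_zero,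
    Matrix.cons_val_one]
  have h3 : (Q.map (Polynomial.evalRingHom σ)).eval ((σ ^ N) ^ L * y) =
      ∑ i ∈ Finset.range (Q.natDegree + 1), (Q.coeff i).eval σ * ((σ ^ N) ^ L * y) ^ i := by
    rw [Polynomial.eval_map, Polynomial.eval₂_eq_sum_range]
    simp
  rw [← h3, Polynomial.map_prod, Polynomial.eval_prod,
    ← Fin.prod_univ_eq_prod_range (fun j => Polynomial.eval ((σ ^ N) ^ L * y)
      ((g j).map (Polynomial.evalRingHom σ))) N]
  refine Finset.prod_congr rfl fun j _ => ?_
  simp [g]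

/-- There is a non-zero polynomial whose roots over `x = τ ^ (-N)` are the conjugates of `ψ`. -/
theorem exists_test_polynomial {ψ : ℚ →₀ ℂ} {N : ℕ} (hN : 0 < N) (hψ : HasDenominator ψ N) {ζ : ℂ}
    (hζ : IsPrimitiveRoot ζ N) :
    ∃ (f : MvPolynomial (Fin 2) ℂ) (K : ℕ), f ≠ 0 ∧ ∀ τ y : ℂ, τ ≠ 0 →
      MvPolynomial.eval ![(τ ^ N)⁻¹, y] f =
        (τ ^ K)⁻¹ * ∏ j : Fin N, (y - evalPuiseux ψ N (ζ ^ (j : ℕ) * τ)) := by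
  obtain ⟨L, hL⟩ : ∃ L : ℕ, ∀ e ∈ ψ.support, -e ≤ L := by
    obtain ⟨b, hb⟩ := (ψ.support.image fun e => -e).bddAbove
    obtain ⟨L, hL⟩ := exists_nat_ge b
    exact ⟨L, fun e he => (hb (Finset.mem_image_of_mem _ he)).trans hL⟩
  -- The exponent N (L + e) of σ = τ⁻¹ in x^L x^e. The choice of `L` makes it non-negative, so
  -- `toNat` loses nothing.
  let d : ℚ → ℕ := fun e => (N * L - expo N e).toNat
  have hd : ∀ e ∈ ψ.support, (d e : ℤ) = N * L - expo N e := by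
    intro e he
    refine Int.toNat_of_nonneg ?_
    have h1 := expo_cast (hψ e he)
    have : (0 : ℚ) ≤ ((N * L - expo N e : ℤ) : ℚ) := by
      push_cast
      rw [h1]
      have h3 := mul_le_mul_of_nonneg_left (hL e he) (Nat.cast_nonneg (α := ℚ) N)
      linarith
    exact_mod_cast this
  -- The inverse root of unity appears because the construction uses the parameter σ = τ⁻¹.
  obtain ⟨f, hf⟩ := exists_prod_conjugates hN hζ.inv
    (∑ e ∈ ψ.support, Polynomial.C (ψ e) * Polynomial.X ^ d e) L
  have hmain : ∀ τ y : ℂ, τ ≠ 0 → MvPolynomial.eval ![(τ ^ N)⁻¹, y] f =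
        (τ ^ (N * L * N))⁻¹ * ∏ j : Fin N, (y - evalPuiseux ψ N (ζ ^ (j : ℕ) * τ)) := by
    intro τ y hτ
    have h1 : (τ ^ N)⁻¹ = τ⁻¹ ^ N := (inv_pow τ N).symm
    have h2 : (τ ^ (N * L * N))⁻¹ = ∏ j : Fin N, (τ ^ (N * L))⁻¹ := by
      rw [Finset.prod_const, Finset.card_univ, Fintype.card_fin, inv_pow, pow_mul]
    rw [h1, hf, h2, ← Finset.prod_mul_distrib]
    refine Finset.prod_congr rfl fun j _ => ?_
    have hζ0 : ζ ≠ 0 := hζ.ne_zero hN.ne'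
    have hζj : (ζ ^ (j : ℕ)) ^ (N * L) = 1 := by
      rw [← pow_mul, mul_comm, mul_assoc, pow_mul, hζ.pow_eq_one, one_pow]
    rw [mul_sub]
    congr 1
    · rw [← pow_mul, inv_pow]
    · rw [evalPuiseux_eq_sum subset_rfl, Polynomial.eval_finsetSum, Finset.mul_sum]
      refine Finset.sum_congr rfl fun e he => ?_
      have h4 : (ζ⁻¹ ^ (j : ℕ) * τ⁻¹) ^ d e =
          (τ ^ (N * L))⁻¹ * (ζ ^ (j : ℕ) * τ) ^ expo N e := by
        have h5 : ζ⁻¹ ^ (j : ℕ) * τ⁻¹ = (ζ ^ (j : ℕ) * τ)⁻¹ := by rw [mul_inv, inv_pow]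
        have h6 : ζ ^ (j : ℕ) * τ ≠ 0 := mul_ne_zero (pow_ne_zero _ hζ0) hτ
        rw [h5, ← zpow_natCast, hd e he, inv_zpow', neg_sub, zpow_sub₀ h6, div_eq_inv_mul]
        congr 2
        have : ((N : ℤ) * L) = ((N * L : ℕ) : ℤ) := by push_cast; ring
        rw [this, zpow_natCast, mul_pow, hζj, one_mul]
      simp only [Polynomial.eval_mul, Polynomial.eval_C, Polynomial.eval_pow, Polynomial.eval_X, h4]
      ring
  refine ⟨f, N * L * N, ?_, hmain⟩
  rintro rfl
  -- At τ = 1, a value y different from all N conjugates makes the product non-zero.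
  obtain ⟨y, hy⟩ := Infinite.exists_notMem_finset
    (Finset.univ.image fun j : Fin N => evalPuiseux ψ N (ζ ^ (j : ℕ) * 1))
  have h1 := hmain 1 y one_ne_zero
  rw [map_zero, one_pow, inv_one, one_mul] at h1
  obtain ⟨j, -, hj⟩ := Finset.prod_eq_zero_iff.1 h1.symm
  exact hy (Finset.mem_image.2 ⟨j, Finset.mem_univ _, (sub_eq_zero.1 hj).symm⟩)

end CurvesAtInfinity
end

/-! ### From the degree formula to the agreement of an arc with the generic series. -/

noncomputable section

namespace CurvesAtInfinity

/-! ### The degree of a substituted series as an order -/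

/-- Evaluation at a real `x > 0` and at `ξ = c`. -/
def evalSeries (c : ℂ) (x : ℝ) (hx : 0 < x) : AddMonoidAlgebra (Polynomial ℂ) ℚ →+* ℂ :=
  AddMonoidAlgebra.liftNCRingHom (Polynomial.evalRingHom c)
    -- For real x > 0 rational powers need no choice of roots and are multiplicative in the
    -- exponent, so evaluation is a ring homomorphism.
    { toFun := fun e => ((x ^ ((e.toAdd : ℚ) : ℝ) : ℝ) : ℂ)
      map_one' := by simp
      map_mul' := fun a b => by
        rw [← Complex.ofReal_mul, ← Real.rpow_add hx, toAdd_mul]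
        push_cast
        rfl } fun _ _ => Commute.all _ _

theorem evalSeries_single (c : ℂ) {x : ℝ} (hx : 0 < x) (e : ℚ) (q : Polynomial ℂ) :
    evalSeries c x hx (AddMonoidAlgebra.single e q) = q.eval c * ((x ^ (e : ℝ) : ℝ) : ℂ) :=
  AddMonoidAlgebra.liftNC_single _ _ _ _

theorem evalSeries_eq_sum (c : ℂ) {x : ℝ} (hx : 0 < x) (ψ : AddMonoidAlgebra (Polynomial ℂ) ℚ) :
    evalSeries c x hx ψ =
      ∑ e ∈ ψ.coeff.support, (ψ.coeff e).eval c * ((x ^ (e : ℝ) : ℝ) : ℂ) := by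
  conv_lhs => rw [← AddMonoidAlgebra.sum_coeff_single ψ]
  rw [Finsupp.sum, map_sum]
  exact Finset.sum_congr rfl fun e _ => evalSeries_single c hx e _

theorem rpow_eq_zpow_expo {N : ℕ} {e : ℚ} (he : ∃ j : ℤ, (j : ℚ) = N * e) {t : ℝ} (ht : 0 < t) :
    ((t ^ N)⁻¹ : ℝ) ^ (e : ℝ) = t ^ expo N e := by
  have h1 : ((expo N e : ℤ) : ℝ) = -(N * (e : ℝ)) := by exact_mod_cast congrArg (Rat.cast (K := ℝ)) (expo_cast he)
  rw [← Real.rpow_intCast, h1, ← Real.rpow_natCast, ← Real.rpow_neg ht.le, ← Real.rpow_mul ht.le]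
  congr 1
  ring

theorem evalSeries_substSeries {φ : ℚ →₀ ℂ} {r : ℚ} {N : ℕ} (hφ : HasDenominator φ N)
    (hr : ∃ j : ℤ, (j : ℚ) = N * r) (c : ℂ) (f : MvPolynomial (Fin 2) ℂ) {t : ℝ} (ht : 0 < t) :
    evalSeries c ((t ^ N)⁻¹) (by positivity) (substSeries φ r f) =
      MvPolynomial.eval ![((t : ℂ) ^ N)⁻¹, evalPuiseux (φ + Finsupp.single r c) N t] f := by
  have hx : 0 < (t ^ N)⁻¹ := by positivity
  have hgen : evalSeries c ((t ^ N)⁻¹) hx (genericSeries φ r) =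
      evalPuiseux (φ + Finsupp.single r c) N t := by
    rw [genericSeries, map_add, evalPuiseux_add, evalPuiseux_single, evalSeries_single,
      rpow_eq_zpow_expo hr ht, Finsupp.sum, map_sum, evalPuiseux_eq_sum subset_rfl]
    congr 1
    · refine Finset.sum_congr rfl fun e he => ?_
      rw [evalSeries_single, rpow_eq_zpow_expo (hφ e he) ht]
      simp
    · simp
  have hX : evalSeries c ((t ^ N)⁻¹) hx (AddMonoidAlgebra.single 1 1) = ((t : ℂ) ^ N)⁻¹ := by
    rw [evalSeries_single]
    simp
  rw [substSeries, MvPolynomial.aeval_def, MvPolynomial.hom_eval₂, MvPolynomial.eval,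
    MvPolynomial.coe_eval₂Hom]
  congr 1
  · ext a
    · simp [evalSeries_single]
  · ext i
    fin_cases i
    · simpa using hX
    · simpa using hgen

/-- The leading behaviour of the evaluation. -/
theorem tendsto_evalSeries {ψ : AddMonoidAlgebra (Polynomial ℂ) ℚ} {d : ℚ} (hd : IsDegree ψ d)
    (c : ℂ) {N : ℕ} (hN : 0 < N) :
    Tendsto (fun t : ℝ => if h : 0 < t then
        evalSeries c ((t ^ N)⁻¹) (by positivity) ψ * ((t ^ (N * d : ℝ) : ℝ) : ℂ) else 0)
      (𝓝[>] 0) (𝓝 ((ψ.coeff d).eval c)) := by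
  have hmem : d ∈ ψ.coeff.support := Finsupp.mem_support_iff.2 hd.1
  have hterm : ∀ e ∈ ψ.coeff.support, Tendsto (fun t : ℝ =>
      (ψ.coeff e).eval c * ((t ^ (N * (d - e) : ℝ) : ℝ) : ℂ)) (𝓝[>] 0)
      (𝓝 (if e = d then (ψ.coeff d).eval c else 0)) := by
    intro e he
    split_ifs with h
    · subst h
      simp
    · have hlt : e < d := lt_of_le_of_ne (hd.2 (Finsupp.mem_support_iff.1 he)) h
      have hpos : (0 : ℝ) < N * (d - e) :=
        mul_pos (by exact_mod_cast hN) (sub_pos.2 (by exact_mod_cast hlt))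
      have h1 : Tendsto (fun t : ℝ => t ^ (N * (d - e) : ℝ)) (𝓝[>] 0) (𝓝 0) := by
        have := (Real.continuousAt_rpow_const 0 (N * (d - e) : ℝ) (Or.inr hpos.le)).tendsto
        rw [Real.zero_rpow hpos.ne'] at this
        exact this.mono_left nhdsWithin_le_nhds
      have h2 := ((Complex.continuous_ofReal.tendsto 0).comp h1).const_mul ((ψ.coeff e).eval c)
      simpa using h2
  have hsum := tendsto_finsetSum _ hterm
  rw [Finset.sum_ite_eq' , if_pos hmem] at hsum
  refine hsum.congr' ?_
  filter_upwards [self_mem_nhdsWithin] with t ht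
  have ht : 0 < t := ht
  rw [dif_pos ht, evalSeries_eq_sum, Finset.sum_mul]
  refine Finset.sum_congr rfl fun e _ => ?_
  rw [mul_assoc, ← Complex.ofReal_mul, ← Real.rpow_natCast, ← Real.rpow_neg ht.le,
    ← Real.rpow_mul ht.le, ← Real.rpow_add ht]
  congr 4
  ring

theorem meromorphicAt_eval {g h : ℂ → ℂ} {x : ℂ} (hg : MeromorphicAt g x) (hh : MeromorphicAt h x)
    (f : MvPolynomial (Fin 2) ℂ) :
    MeromorphicAt (fun τ => MvPolynomial.eval ![g τ, h τ] f) x := by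
  induction f using MvPolynomial.induction_on with
  | C a => simp
  | add p q hp hq =>
    simp only [map_add]
    exact hp.fun_add hq
  | mul_X p i hp =>
    simp only [map_mul, MvPolynomial.eval_X]
    refine hp.mul ?_
    fin_cases i
    · simpa using hg
    · simpa using hh

/-- The leading coefficient of the substituted series is a non-zero polynomial in ξ, and only its
roots c are excluded. For other c the value along real t > 0 times t^(N d) has a non-zero limit,
while the value itself is t^n times a unit. So t^(n + N d) has a non-zero limit, which forces n = -N
d. -/
theorem exists_order_eval_of_isDegree {φ : ℚ →₀ ℂ} {r : ℚ} {N : ℕ} (hN : 0 < N)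
    (hφ : HasDenominator φ N) (hr : ∃ j : ℤ, (j : ℚ) = N * r) {f : MvPolynomial (Fin 2) ℂ} {d : ℚ}
    (hd : IsDegree (substSeries φ r f) d) :
    ∃ B : Finset ℂ, ∀ c ∉ B, ∃ n : ℤ, (n : ℚ) = -(N * d) ∧ meromorphicOrderAt (fun τ : ℂ =>
      MvPolynomial.eval ![(τ ^ N)⁻¹, evalPuiseux (φ + Finsupp.single r c) N τ] f) 0 = n := by
  classical
  refine ⟨((substSeries φ r f).coeff d).roots.toFinset, fun c hc => ?_⟩
  have hL : ((substSeries φ r f).coeff d).eval c ≠ 0 := by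
    intro h0
    exact hc (Multiset.mem_toFinset.2 ((Polynomial.mem_roots hd.1).2 h0))
  set L := ((substSeries φ r f).coeff d).eval c
  set F : ℂ → ℂ := fun τ =>
    MvPolynomial.eval ![(τ ^ N)⁻¹, evalPuiseux (φ + Finsupp.single r c) N τ] f with hF
  have hFm : MeromorphicAt F 0 := by
    refine meromorphicAt_eval (by fun_prop) ?_ f
    simpa using meromorphicAt_evalPuiseux (φ + Finsupp.single r c) N 1 0
  have hlim : Tendsto (fun t : ℝ => F t * ((t ^ (N * d : ℝ) : ℝ) : ℂ)) (𝓝[>] 0) (𝓝 L) := by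
    refine (tendsto_evalSeries hd c hN).congr' ?_
    filter_upwards [self_mem_nhdsWithin] with t ht
    have ht : 0 < t := ht
    rw [dif_pos ht, evalSeries_substSeries hφ hr c f ht]
  have hto : Tendsto (fun t : ℝ => (t : ℂ)) (𝓝[>] 0) (𝓝[≠] 0) := by
    refine tendsto_nhdsWithin_iff.2 ⟨?_, ?_⟩
    · exact (Complex.continuous_ofReal.tendsto' 0 0 (by simp)).mono_left nhdsWithin_le_nhds
    · filter_upwards [self_mem_nhdsWithin] with t ht
      exact Complex.ofReal_ne_zero.2 (ne_of_gt ht)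
  have htop : meromorphicOrderAt F 0 ≠ ⊤ := by
    intro htop
    have h1 := hto.eventually (meromorphicOrderAt_eq_top_iff.1 htop)
    have h2 : Tendsto (fun t : ℝ => F t * ((t ^ (N * d : ℝ) : ℝ) : ℂ)) (𝓝[>] 0) (𝓝 0) :=
      tendsto_const_nhds.congr' (h1.mono fun t ht => by simp [ht])
    exact hL (tendsto_nhds_unique hlim h2)
  lift meromorphicOrderAt F 0 to ℤ using htop with n hn
  refine ⟨n, ?_, rfl⟩
  obtain ⟨g, hg, hg0, hge⟩ := (meromorphicOrderAt_eq_int_iff hFm).1 hn.symm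
  set a : ℝ := n + N * d with ha
  have hlim2 : Tendsto (fun t : ℝ => ((t ^ a : ℝ) : ℂ)) (𝓝[>] 0) (𝓝 (L / g 0)) := by
    have h1 : Tendsto (fun t : ℝ => g t) (𝓝[>] 0) (𝓝 (g 0)) :=
      hg.continuousAt.tendsto.comp (hto.mono_right nhdsWithin_le_nhds)
    refine (hlim.div h1 hg0).congr' ?_
    filter_upwards [hto.eventually hge, self_mem_nhdsWithin, h1.eventually_ne hg0] with t ht ht0 htg
    have ht0 : 0 < t := ht0
    simp only [Pi.div_apply]
    rw [ht, sub_zero, smul_eq_mul, ha, Real.rpow_add ht0, Real.rpow_intCast]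
    push_cast
    field_simp
  have hlim3 : Tendsto (fun t : ℝ => t ^ a) (𝓝[>] 0) (𝓝 ‖L / g 0‖) := by
    refine hlim2.norm.congr' ?_
    filter_upwards [self_mem_nhdsWithin] with t ht
    rw [Complex.norm_real, Real.norm_of_nonneg (Real.rpow_nonneg (le_of_lt ht) _)]
  have hne : ‖L / g 0‖ ≠ 0 := norm_ne_zero_iff.2 (div_ne_zero hL hg0)
  have hzero : ∀ b : ℝ, 0 < b → Tendsto (fun t : ℝ => t ^ b) (𝓝[>] 0) (𝓝 0) := by
    intro b hb
    have := (Real.continuousAt_rpow_const 0 b (Or.inr hb.le)).tendsto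
    rw [Real.zero_rpow hb.ne'] at this
    exact this.mono_left nhdsWithin_le_nhds
  have ha0 : a = 0 := by
    rcases lt_trichotomy a 0 with h | h | h
    · exfalso
      have h1 := hlim3.mul (hzero (-a) (neg_pos.2 h))
      rw [mul_zero] at h1
      have h2 : Tendsto (fun t : ℝ => t ^ a * t ^ (-a)) (𝓝[>] 0) (𝓝 1) := by
        refine tendsto_const_nhds.congr' ?_
        filter_upwards [self_mem_nhdsWithin] with t ht
        rw [← Real.rpow_add ht, add_neg_cancel, Real.rpow_zero]
      exact one_ne_zero (tendsto_nhds_unique h2 h1)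
    · exact h
    · exact absurd (tendsto_nhds_unique hlim3 (hzero a h)) hne
  have : (n : ℝ) = -(N * d) := by linarith
  exact_mod_cast this

/-! ### Functions with the same orders as the generic series -/

/-- The polynomial has the conjugates P j of φ + c x^r as its roots. It is evaluated at Y and at the
conjugates Q i of φ + c' x^r for generic c', and the degree formula gives both the same order. Since
Q i - P j always has a non-zero term of exponent r, and Q i - P i has no other term, the ultrametric
comparison applies. -/
theorem order_sub_conjugates {φ : ℚ →₀ ℂ} {r : ℚ} (hr : ∀ e ∈ φ.support, r < e) {N : ℕ}
    (hN : 0 < N) (hφN : HasDenominator φ N) (hrN : ∃ j : ℤ, (j : ℚ) = N * r) {ζ : ℂ}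
    (hζ : IsPrimitiveRoot ζ N) (c : ℂ) :
    ∃ f : MvPolynomial (Fin 2) ℂ, f ≠ 0 ∧ ∀ d : ℚ, IsDegree (substSeries φ r f) d →
      ∀ (Y : ℂ → ℂ) (n : ℤ), MeromorphicAt Y 0 → (n : ℚ) = -(N * d) →
        meromorphicOrderAt (fun τ => MvPolynomial.eval ![(τ ^ N)⁻¹, Y τ] f) 0 = n →
        (∀ j : Fin N, meromorphicOrderAt (fun τ =>
          Y τ - evalPuiseux (φ + Finsupp.single r c) N (ζ ^ (j : ℕ) * τ)) 0 ≤ expo N r) ∧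
        ∃ j : Fin N, meromorphicOrderAt (fun τ =>
          Y τ - evalPuiseux (φ + Finsupp.single r c) N (ζ ^ (j : ℕ) * τ)) 0 = expo N r := by
  classical
  have hζ0 : ζ ≠ 0 := hζ.ne_zero hN.ne'
  have hr0 : φ r = 0 := by
    by_contra h
    exact lt_irrefl _ (hr r (Finsupp.mem_support_iff.2 h))
  have hS : ∀ e ∈ insert r φ.support, ∃ j : ℤ, (j : ℚ) = N * e := by
    intro e he
    rcases Finset.mem_insert.1 he with rfl | he
    · exact hrN
    · exact hφN e he
  have hsub : ∀ c : ℂ, (φ + Finsupp.single r c).support ⊆ insert r φ.support := by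
    intro c e he
    by_contra hne
    rw [Finset.mem_insert, not_or, Finsupp.notMem_support_iff] at hne
    rw [Finsupp.mem_support_iff, Finsupp.add_apply, hne.2, zero_add,
      Finsupp.single_eq_of_ne hne.1] at he
    exact he rfl
  obtain ⟨f, K, hf0, hf⟩ := exists_test_polynomial (ψ := φ + Finsupp.single r c) hN
    (fun e he => hS e (hsub c he)) hζ
  refine ⟨f, hf0, fun d hd Y n hY hn hord => ?_⟩
  obtain ⟨B, hB⟩ := exists_order_eval_of_isDegree hN hφN hrN hd
  -- Besides the roots of the leading coefficient, `c'` avoids the finitely many values for which a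
  -- conjugate of c' x^r equals a conjugate of c x^r.
  obtain ⟨c', hc'⟩ := Infinite.exists_notMem_finset (B ∪ Finset.univ.image
    fun q : Fin N × Fin N => c * (ζ ^ (q.2 : ℕ)) ^ expo N r / (ζ ^ (q.1 : ℕ)) ^ expo N r)
  rw [Finset.mem_union, not_or] at hc'
  obtain ⟨n', hn', hord'⟩ := hB c' hc'.1
  have hnn : n' = n := by
    have : (n' : ℚ) = n := by rw [hn', hn]
    exact_mod_cast this
  subst hnn
  have hne : ∀ i j : Fin N, c' * (ζ ^ (i : ℕ)) ^ expo N r - c * (ζ ^ (j : ℕ)) ^ expo N r ≠ 0 := by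
    intro i j h
    refine hc'.2 (Finset.mem_image.2 ⟨(i, j), Finset.mem_univ _, ?_⟩)
    rw [div_eq_iff (zpow_ne_zero _ (pow_ne_zero _ hζ0))]
    exact (sub_eq_zero.1 h).symm
  let P : Fin N → ℂ → ℂ := fun j τ =>
    evalPuiseux (φ + Finsupp.single r c) N (ζ ^ (j : ℕ) * τ)
  let Q : Fin N → ℂ → ℂ := fun j τ =>
    evalPuiseux (φ + Finsupp.single r c') N (ζ ^ (j : ℕ) * τ)
  have hP : ∀ j, MeromorphicAt (P j) 0 := fun j => meromorphicAt_evalPuiseux _ _ _ _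
  have hQ : ∀ j, MeromorphicAt (Q j) 0 := fun j => meromorphicAt_evalPuiseux _ _ _ _
  have hprod : ∀ Z : ℂ → ℂ, MeromorphicAt Z 0 →
      meromorphicOrderAt (fun τ => MvPolynomial.eval ![(τ ^ N)⁻¹, Z τ] f) 0 = n' →
      ((-K : ℤ) : WithTop ℤ) + ∑ j, meromorphicOrderAt (fun τ => Z τ - P j τ) 0 = n' := by
    intro Z hZ hZn
    have h1 : meromorphicOrderAt (fun τ : ℂ => (τ ^ K)⁻¹) 0 = ((-K : ℤ) : WithTop ℤ) := by
      have := meromorphicOrderAt_const_mul_zpow (b := 1) one_ne_zero (-K : ℤ)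
      simpa using this
    have h2 : MeromorphicAt (fun τ => ∏ j, (Z τ - P j τ)) 0 :=
      MeromorphicAt.fun_prod fun j _ => hZ.fun_sub (hP j)
    rw [← h1, ← meromorphicOrderAt_fun_prod (fun j _ => hZ.fun_sub (hP j)), ← hZn]
    refine (meromorphicOrderAt_mul (f := fun τ : ℂ => (τ ^ K)⁻¹) (by fun_prop) h2).symm.trans
      (meromorphicOrderAt_congr ?_)
    filter_upwards [self_mem_nhdsWithin] with τ hτ
    exact (hf τ (Z τ) hτ).symm
  have hQord : ∀ i, meromorphicOrderAt (fun τ => MvPolynomial.eval ![(τ ^ N)⁻¹, Q i τ] f) 0 =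
      n' := by
    intro i
    -- Rotating τ by a power of ζ fixes x = τ^(-N), so all conjugates give the same order.
    rw [← hord', ← meromorphicOrderAt_comp_mul_left (fun τ => MvPolynomial.eval
      ![(τ ^ N)⁻¹, evalPuiseux (φ + Finsupp.single r c') N τ] f) (pow_ne_zero (i : ℕ) hζ0)]
    refine congrArg (fun g => meromorphicOrderAt g 0) (funext fun τ => ?_)
    have : (ζ ^ (i : ℕ) * τ) ^ N = τ ^ N := by
      rw [mul_pow, ← pow_mul, mul_comm, mul_comm (i : ℕ), pow_mul, hζ.pow_eq_one, one_pow, mul_one]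
    rw [this]
  have : Nonempty (Fin N) := ⟨⟨0, hN⟩⟩
  refine exists_order_eq_of_sum_eq (P := P) (Q := Q) hY hP hQ (fun i => ?_) (fun i j => ?_)
    fun i => ?_
  · have h1 := (hprod Y hY hord).trans (hprod (Q i) (hQ i) (hQord i)).symm
    exact WithTop.add_left_cancel (WithTop.coe_ne_top) h1
  · have heq : (fun τ => Q i τ - P j τ) = fun τ => ∑ e ∈ insert r φ.support,
        ((φ + Finsupp.single r c') e * (ζ ^ (i : ℕ)) ^ expo N e -
          (φ + Finsupp.single r c) e * (ζ ^ (j : ℕ)) ^ expo N e) * τ ^ expo N e := by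
      ext τ
      simp only [P, Q]
      rw [evalPuiseux_eq_sum (hsub c'), evalPuiseux_eq_sum (hsub c), ← Finset.sum_sub_distrib]
      refine Finset.sum_congr rfl fun e _ => ?_
      rw [mul_zpow, mul_zpow]
      ring
    rw [heq]
    refine meromorphicOrderAt_sum_zpow_le (expo_injOn hN hS) (Finset.mem_insert_self _ _) ?_
    simpa [hr0] using hne i j
  · have heq : (fun τ => Q i τ - P i τ) = fun τ => ((c' - c) * (ζ ^ (i : ℕ)) ^ expo N r) *
        τ ^ expo N r := by
      ext τ
      simp only [P, Q, evalPuiseux_add, evalPuiseux_single, mul_zpow]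
      ring
    rw [heq]
    refine meromorphicOrderAt_const_mul_zpow ?_ _
    rw [sub_mul]
    exact hne i i

theorem expo_mul {p D : ℕ} {e : ℚ} (h : ∃ j : ℤ, (j : ℚ) = p * e) :
    expo (p * D) e = D * expo p e := by
  have h1 := expo_cast h
  have h2 : ∃ j : ℤ, (j : ℚ) = (p * D : ℕ) * e := by
    obtain ⟨j, hj⟩ := h
    exact ⟨D * j, by push_cast; rw [hj]; ring⟩
  have h3 := expo_cast h2
  have : ((expo (p * D) e : ℤ) : ℚ) = ((D * expo p e : ℤ) : ℚ) := by
    rw [h3]; push_cast; rw [h1]; ring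
  exact_mod_cast this

theorem evalPuiseux_mul {ψ : ℚ →₀ ℂ} {p D : ℕ} (h : HasDenominator ψ p) (ω τ : ℂ) :
    evalPuiseux ψ (p * D) (ω * τ) = evalPuiseux ψ p (ω ^ D * τ ^ D) := by
  rw [evalPuiseux_eq_sum subset_rfl, evalPuiseux_eq_sum subset_rfl]
  refine Finset.sum_congr rfl fun e he => ?_
  rw [expo_mul (h e he), ← mul_pow, zpow_mul, zpow_natCast]

theorem exists_common_denominator (S : Finset ℚ) :
    ∃ D : ℕ, 0 < D ∧ ∀ e ∈ S, ∃ j : ℤ, (j : ℚ) = D * e := by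
  refine ⟨∏ e ∈ S, e.den, Finset.prod_pos fun e _ => e.den_pos, fun e he => ?_⟩
  obtain ⟨k, hk⟩ := Finset.dvd_prod_of_mem Rat.den he
  refine ⟨k * e.num, ?_⟩
  rw [hk]
  push_cast
  have := Rat.den_mul_eq_num e
  linear_combination (-(k : ℚ)) * this

theorem order_comp_pow_eval {p D : ℕ} (hD : 0 < D) {y : ℂ → ℂ} (hy : MeromorphicAt y 0) {n : ℤ}
    {f : MvPolynomial (Fin 2) ℂ}
    (h : meromorphicOrderAt (fun s => MvPolynomial.eval ![(s ^ p)⁻¹, y s] f) 0 = n) :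
    meromorphicOrderAt (fun τ => MvPolynomial.eval ![(τ ^ (p * D))⁻¹, y (τ ^ D)] f) 0 =
      ((n * D : ℤ) : WithTop ℤ) := by
  have h1 := meromorphicOrderAt_comp_pow
    (f := fun s => MvPolynomial.eval ![(s ^ p)⁻¹, y s] f) (meromorphicAt_eval (by fun_prop) hy f) hD
  simp only [← pow_mul, mul_comm D p] at h1
  rw [h1, h]
  push_cast
  rfl

/-- A polynomial detecting the generic series on arcs `(s ^ (-p), y(s))`: if its order on the arc is
the one prescribed by the generic series, `y` agrees with a conjugate of `φ` precisely up to the exponent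
`r`. -/
theorem exists_polynomial_order_sub_eq {φ : ℚ →₀ ℂ} {r : ℚ} (hr : ∀ e ∈ φ.support, r < e) {p : ℕ}
    (hp : 0 < p) :
    ∃ f : MvPolynomial (Fin 2) ℂ, f ≠ 0 ∧ ∀ d : ℚ, IsDegree (substSeries φ r f) d →
      ∀ (y : ℂ → ℂ) (n : ℤ), MeromorphicAt y 0 → (n : ℚ) = -(p * d) →
        meromorphicOrderAt (fun s => MvPolynomial.eval ![(s ^ p)⁻¹, y s] f) 0 = n →
        HasDenominator φ p ∧ (∃ j : ℤ, (j : ℚ) = p * r) ∧ ∃ ω : ℂ, ω ^ p = 1 ∧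
          meromorphicOrderAt (fun s => y s - evalPuiseux φ p (ω * s)) 0 = expo p r := by
  classical
  -- The parameter s = τ^D makes all exponents integral. That p alone is a denominator is only
  -- proved below.
  obtain ⟨D, hD, hDS⟩ := exists_common_denominator (insert r φ.support)
  have hS : ∀ e ∈ insert r φ.support, ∃ j : ℤ, (j : ℚ) = (p * D : ℕ) * e := by
    intro e he
    obtain ⟨j, hj⟩ := hDS e he
    exact ⟨p * j, by push_cast; rw [hj]; ring⟩
  have hN : 0 < p * D := Nat.mul_pos hp hD
  have hφN : HasDenominator φ (p * D) := fun e he => hS e (Finset.mem_insert_of_mem he)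
  have hrN := hS r (Finset.mem_insert_self _ _)
  have hζ := Complex.isPrimitiveRoot_exp (p * D) hN.ne'
  set ζ := Complex.exp (2 * Real.pi * Complex.I / (p * D : ℕ))
  obtain ⟨f, hf0, hf⟩ := order_sub_conjugates hr hN hφN hrN hζ 0
  refine ⟨f, hf0, fun d hd y n hy hn hord => ?_⟩
  have hyD : MeromorphicAt (fun τ => y (τ ^ D)) 0 :=
    MeromorphicAt.comp_analyticAt (g := fun τ : ℂ => τ ^ D) (f := y)
      (by simpa [hD.ne'] using hy) (by fun_prop)
  obtain ⟨-, j, hj⟩ := hf d hd (fun τ => y (τ ^ D)) (n * D) hyD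
    (by push_cast; rw [hn]; ring) (order_comp_pow_eval hD hy hord)
  simp only [Finsupp.single_zero, add_zero] at hj
  have hε : IsPrimitiveRoot (ζ ^ p) D := hζ.pow hN rfl
  have hζ0 : ζ ≠ 0 := hζ.ne_zero hN.ne'
  have hj2 : meromorphicOrderAt (fun τ => y (τ ^ D) -
      evalPuiseux φ (p * D) (ζ ^ (j : ℕ) * (ζ ^ p * τ))) 0 = expo (p * D) r := by
    rw [← hj, ← meromorphicOrderAt_comp_mul_left (fun τ => y (τ ^ D) -
      evalPuiseux φ (p * D) (ζ ^ (j : ℕ) * τ)) (pow_ne_zero p hζ0)]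
    refine congrArg (fun g => meromorphicOrderAt g 0) (funext fun τ => ?_)
    rw [mul_pow, hε.pow_eq_one, one_mul]
  -- The function y(τ^D) is invariant under τ ↦ ζ^p τ, a rotation of order D. Hence the conjugate of
  -- φ and its rotation agree up to the order belonging to r. Every term of φ has smaller order in
  -- τ, so each term is itself invariant.
  have hdvd : ∀ e ∈ φ.support, (D : ℤ) ∣ expo (p * D) e := by
    intro e he
    by_contra hnd
    have h1 := le_meromorphicOrderAt_sub
      (hyD.fun_sub (meromorphicAt_evalPuiseux φ (p * D) (ζ ^ (j : ℕ)) 0))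
      (hyD.fun_sub (by simpa [mul_assoc] using
        meromorphicAt_evalPuiseux φ (p * D) (ζ ^ (j : ℕ) * ζ ^ p) 0 :
        MeromorphicAt (fun τ => evalPuiseux φ (p * D) (ζ ^ (j : ℕ) * (ζ ^ p * τ))) 0))
    rw [hj, hj2, min_self] at h1
    have heq : (fun τ => (y (τ ^ D) - evalPuiseux φ (p * D) (ζ ^ (j : ℕ) * τ)) -
        (y (τ ^ D) - evalPuiseux φ (p * D) (ζ ^ (j : ℕ) * (ζ ^ p * τ)))) =
        fun τ => ∑ e ∈ φ.support, (φ e * (ζ ^ (j : ℕ)) ^ expo (p * D) e *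
          ((ζ ^ p) ^ expo (p * D) e - 1)) * τ ^ expo (p * D) e := by
      ext τ
      rw [sub_sub_sub_cancel_left, evalPuiseux_eq_sum subset_rfl, evalPuiseux_eq_sum subset_rfl,
        ← Finset.sum_sub_distrib]
      refine Finset.sum_congr rfl fun e _ => ?_
      rw [mul_zpow, mul_zpow, mul_zpow]
      ring
    rw [heq] at h1
    have h2 := h1.trans (meromorphicOrderAt_sum_zpow_le (expo_injOn hN hφN) he
      (mul_ne_zero (mul_ne_zero (Finsupp.mem_support_iff.1 he)
        (zpow_ne_zero _ (pow_ne_zero _ hζ0))) (sub_ne_zero.2 fun h =>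
          hnd ((hε.zpow_eq_one_iff_dvd _).1 h))))
    have h3 : expo (p * D) r ≤ expo (p * D) e := WithTop.coe_le_coe.1 h2
    have h4 : ((expo (p * D) r : ℤ) : ℚ) ≤ (expo (p * D) e : ℤ) := by exact_mod_cast h3
    rw [expo_cast hrN, expo_cast (hφN e he)] at h4
    have h5 : (0 : ℚ) < (p * D : ℕ) := by exact_mod_cast hN
    nlinarith [hr e he]
  have hmain : ∀ e : ℚ, (∃ j : ℤ, (j : ℚ) = (p * D : ℕ) * e) → (D : ℤ) ∣ expo (p * D) e →
      ∃ j : ℤ, (j : ℚ) = p * e := by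
    rintro e he ⟨k, hk⟩
    have h1 := expo_cast he
    rw [hk] at h1
    refine ⟨-k, ?_⟩
    have hD0 : (D : ℚ) ≠ 0 := by positivity
    push_cast at h1 ⊢
    refine mul_left_cancel₀ hD0 ?_
    linear_combination -h1
  have hφp : HasDenominator φ p := fun e he => hmain e (hφN e he) (hdvd e he)
  have hωp : ((ζ ^ (j : ℕ)) ^ D) ^ p = 1 := by
    rw [← pow_mul, ← pow_mul, mul_comm D p, mul_comm, pow_mul, hζ.pow_eq_one, one_pow]
  have hgm : MeromorphicAt (fun s => y s - evalPuiseux φ p ((ζ ^ (j : ℕ)) ^ D * s)) 0 :=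
    hy.fun_sub (meromorphicAt_evalPuiseux _ _ _ _)
  -- The substitution s = τ^D multiplies orders by D. So the order belonging to r is divisible by D,
  -- which gives r the denominator p as well.
  have hg : meromorphicOrderAt (fun s => y s - evalPuiseux φ p ((ζ ^ (j : ℕ)) ^ D * s)) 0 *
      (D : WithTop ℤ) = expo (p * D) r := by
    rw [← meromorphicOrderAt_comp_pow hgm hD, ← hj]
    refine congrArg (fun g => meromorphicOrderAt g 0) (funext fun τ => ?_)
    rw [evalPuiseux_mul hφp]
  have hne : meromorphicOrderAt (fun s => y s - evalPuiseux φ p ((ζ ^ (j : ℕ)) ^ D * s)) 0 ≠ ⊤ := by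
    intro h
    have hD' : ((D : ℕ) : WithTop ℤ) ≠ 0 := by exact_mod_cast hD.ne'
    rw [h, WithTop.top_mul hD'] at hg
    exact WithTop.top_ne_coe hg
  lift meromorphicOrderAt (fun s => y s - evalPuiseux φ p ((ζ ^ (j : ℕ)) ^ D * s)) 0 to ℤ using hne
    with k hk
  have hk2 : k * D = expo (p * D) r := by exact_mod_cast hg
  have hrp := hmain r hrN ⟨k, by rw [← hk2, mul_comm]⟩
  refine ⟨hφp, hrp, _, hωp, ?_⟩
  rw [← hk]
  have : k = expo p r := by
    rw [expo_mul hrp, mul_comm] at hk2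
    exact mul_left_cancel₀ (by exact_mod_cast hD.ne') hk2
  rw [this]

/-- A polynomial detecting the special value `c` of the generic coefficient. -/
theorem exists_polynomial_order_sub_le {φ : ℚ →₀ ℂ} {r : ℚ} (hr : ∀ e ∈ φ.support, r < e) {p : ℕ}
    (hp : 0 < p) (hφp : HasDenominator φ p) (hrp : ∃ j : ℤ, (j : ℚ) = p * r) (c : ℂ) :
    ∃ f : MvPolynomial (Fin 2) ℂ, f ≠ 0 ∧ ∀ d : ℚ, IsDegree (substSeries φ r f) d →
      ∀ (y : ℂ → ℂ) (n : ℤ), MeromorphicAt y 0 → (n : ℚ) = -(p * d) →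
        meromorphicOrderAt (fun s => MvPolynomial.eval ![(s ^ p)⁻¹, y s] f) 0 = n →
        ∀ ω : ℂ, ω ^ p = 1 → meromorphicOrderAt (fun s =>
          y s - evalPuiseux (φ + Finsupp.single r c) p (ω * s)) 0 ≤ expo p r := by
  have hζ := Complex.isPrimitiveRoot_exp p hp.ne'
  obtain ⟨f, hf0, hf⟩ := order_sub_conjugates hr hp hφp hrp hζ c
  refine ⟨f, hf0, fun d hd y n hy hn hord ω hω => ?_⟩
  have : NeZero p := ⟨hp.ne'⟩
  obtain ⟨i, hi, rfl⟩ := hζ.eq_pow_of_pow_eq_one hω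
  exact (hf d hd y n hy hn hord).1 ⟨i, hi⟩

end CurvesAtInfinity
end

/-! ### Adapted charts, curvettes, and local properties of the curve at infinity. -/

noncomputable section

namespace CurvesAtInfinity

open ReducedComplexSpace (HolAt)

/-! ### Holomorphic functions and adapted charts -/

section Charts

variable {M : Type*} [TopologicalSpace M] [ReducedComplexSpace M]

theorem HolAt.congr {f g : M → ℂ} {p : M} (hf : HolAt f p) (h : f =ᶠ[𝓝 p] g) : HolAt g p := by
  obtain ⟨n, m, U, e, D, F, -, hp, -, -, -, -, H⟩ := ReducedComplexSpace.hasLocalModel p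
  obtain ⟨G, hG, hfG⟩ := (H p hp _).1 hf
  exact (H p hp _).2 ⟨G, hG, by filter_upwards [hfG, h] with q h1 h2; rw [← h2, h1]⟩

/-- Local coordinates coming from a local model. -/
theorem exists_local_embedding (p : M) :
    ∃ (n : ℕ) (U : Set M) (e : M → Fin n → ℂ), IsOpen U ∧ p ∈ U ∧ ContinuousOn e U ∧
      Set.InjOn e U ∧ (∀ i, ∀ q ∈ U, HolAt (fun q => e q i) q) ∧ ∀ q ∈ U, ∀ f : M → ℂ, HolAt f q →
        ∃ G : (Fin n → ℂ) → ℂ, AnalyticAt ℂ G (e q) ∧ ∀ᶠ q' in 𝓝 q, f q' = G (e q') := by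
  obtain ⟨n, m, U, e, D, F, hU, hp, -, -, he, -, H⟩ := ReducedComplexSpace.hasLocalModel p
  refine ⟨n, U, e, hU, hp, ?_, ?_, fun i q hq => (H q hq _).2 ⟨fun z => z i, ?_,
    Eventually.of_forall fun _ => rfl⟩, fun q hq f hf => (H q hq f).1 hf⟩
  · exact continuousOn_iff_continuous_domRestrict.2 he.continuous
  · exact Set.injOn_iff_injective.2 he.injective
  · exact (ContinuousLinearMap.proj (R := ℂ) (φ := fun _ : Fin n => ℂ) i).analyticAt _

theorem HolAt.continuousAt {f : M → ℂ} {p : M} (hf : HolAt f p) : ContinuousAt f p := by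
  obtain ⟨n, U, e, hU, hp, he, -, -, H⟩ := exists_local_embedding p
  obtain ⟨G, hG, hfG⟩ := H p hp f hf
  exact ContinuousAt.congr (ContinuousAt.comp (g := G) (f := e) hG.continuousAt
    (he.continuousAt (hU.mem_nhds hp))) (hfG.mono fun _ h => h.symm)

theorem HolAt.eventually {f : M → ℂ} {p : M} (hf : HolAt f p) : ∀ᶠ q in 𝓝 p, HolAt f q := by
  obtain ⟨n, m, U, e, D, F, hU, hp, -, -, he, -, H⟩ := ReducedComplexSpace.hasLocalModel p
  obtain ⟨G, hG, hfG⟩ := (H p hp f).1 hf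
  have hec : ContinuousAt e p :=
    (continuousOn_iff_continuous_domRestrict.2 he.continuous).continuousAt (hU.mem_nhds hp)
  filter_upwards [hU.mem_nhds hp, hec.eventually hG.eventually_analyticAt, hfG.eventually_nhds]
    with q hq hGq hfq
  exact (H q hq f).2 ⟨G, hGq, hfq⟩

variable {A : Set M} {χ : M} {c c' : OpenPartialHomeomorph M (ℂ × ℂ)}

theorem IsAdaptedChart.fst_eq_zero (hc : IsAdaptedChart A χ c) : (c χ).1 = 0 :=
  (hc.2.2.2 χ hc.2.1).1 hc.1

theorem IsAdaptedChart.eq_mk (hc : IsAdaptedChart A χ c) : c χ = (0, (c χ).2) :=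
  Prod.ext hc.fst_eq_zero rfl

theorem IsAdaptedChart.of_mem (hc : IsAdaptedChart A χ c) {q : M} (hq : q ∈ A)
    (hqc : q ∈ c.source) : IsAdaptedChart A q c :=
  ⟨hq, hqc, hc.2.2⟩

/-- A holomorphic function in a holomorphic chart. -/
theorem IsAdaptedChart.analyticAt_comp_symm (hc : IsAdaptedChart A χ c) {f : M → ℂ} {q : M}
    (hq : q ∈ c.source) (hf : HolAt f q) : AnalyticAt ℂ (f ∘ c.symm) (c q) :=
  (hc.2.2.1 q hq f).1 hf

theorem IsAdaptedChart.holAt_comp (hc : IsAdaptedChart A χ c) {G : ℂ × ℂ → ℂ} {q : M}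
    (hq : q ∈ c.source) (hG : AnalyticAt ℂ G (c q)) : HolAt (fun q => G (c q)) q := by
  refine (hc.2.2.1 q hq _).2 (hG.congr ?_)
  filter_upwards [c.open_target.mem_nhds (c.map_source hq)] with z hz
  simp [c.right_inv hz]

theorem IsAdaptedChart.analyticAt_transition (hc : IsAdaptedChart A χ c)
    (hc' : IsAdaptedChart A χ c') {q : M} (hq : q ∈ c.source) (hq' : q ∈ c'.source) :
    AnalyticAt ℂ (fun z => c' (c.symm z)) (c q) := by
  have h1 := hc.analyticAt_comp_symm hq (hc'.holAt_comp hq' analyticAt_fst)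
  have h2 := hc.analyticAt_comp_symm hq (hc'.holAt_comp hq' analyticAt_snd)
  exact h1.prod h2

/-- The first coordinates of two adapted charts differ by a unit. -/
theorem IsAdaptedChart.exists_fst_eq_mul (hc : IsAdaptedChart A χ c) (hc' : IsAdaptedChart A χ c') :
    ∃ G : ℂ × ℂ → ℂ, AnalyticAt ℂ G (c χ) ∧ G (c χ) ≠ 0 ∧
      ∀ᶠ q in 𝓝 χ, (c' q).1 = (c q).1 * G (c q) := by
  have key : ∀ {c c' : OpenPartialHomeomorph M (ℂ × ℂ)}, IsAdaptedChart A χ c →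
      IsAdaptedChart A χ c' → ∃ G : ℂ × ℂ → ℂ, AnalyticAt ℂ G (c χ) ∧
        ∀ᶠ q in 𝓝 χ, (c' q).1 = (c q).1 * G (c q) := by
    intro c c' hc hc'
    have h1 : AnalyticAt ℂ (fun z => (c' (c.symm z)).1) (0, (c χ).2) := by
      rw [← hc.eq_mk]
      exact analyticAt_fst.comp (hc.analyticAt_transition hc' hc.2.1 hc'.2.1)
    have h2 : ∀ᶠ t in 𝓝 (c χ).2, (c' (c.symm ((0 : ℂ), t))).1 = 0 := by
      have h3 : ∀ᶠ z in 𝓝 ((0 : ℂ), (c χ).2), z ∈ c.target ∧ c.symm z ∈ c'.source := by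
        rw [← hc.eq_mk]
        exact Filter.inter_mem (c.open_target.mem_nhds (c.map_source hc.2.1))
          ((c.tendsto_symm hc.2.1).eventually (c'.open_source.mem_nhds hc'.2.1))
      have h4 := (Continuous.prodMk_right (Y := ℂ) (0 : ℂ)).continuousAt.eventually h3
      filter_upwards [h4] with t ht
      rw [← hc'.2.2.2 _ ht.2, hc.2.2.2 _ (c.map_target ht.1), c.right_inv ht.1]
    obtain ⟨G, hG, hGe⟩ := exists_analyticAt_eq_mul h1 h2
    rw [← hc.eq_mk] at hG hGe
    refine ⟨G, hG, ?_⟩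
    filter_upwards [(c.continuousAt hc.2.1).eventually hGe, c.eventually_left_inverse hc.2.1]
      with q hq hq'
    rwa [hq'] at hq
  obtain ⟨G, hG, hGe⟩ := key hc hc'
  obtain ⟨G', hG', hGe'⟩ := key hc' hc
  -- Each first coordinate is a multiple of the other, and the two quotients are inverse to each
  -- other wherever s ≠ 0. Such points accumulate at χ, so neither quotient can vanish there.
  refine ⟨G, hG, fun h0 => ?_, hGe⟩
  have hcont : ContinuousAt (fun q => G (c q) * G' (c' q)) χ :=
    (ContinuousAt.comp (g := G) hG.continuousAt (c.continuousAt hc.2.1)).mul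
      (ContinuousAt.comp (g := G') hG'.continuousAt (c'.continuousAt hc'.2.1))
  have hlim : Tendsto (fun q => G (c q) * G' (c' q)) (𝓝 χ) (𝓝 0) := by
    have := hcont.tendsto
    rwa [h0, zero_mul] at this
  have hfreq : ∃ᶠ q in 𝓝 χ, (c q).1 ≠ 0 := by
    have h1 : ∃ᶠ z in 𝓝 (c χ), z.1 ≠ 0 := by
      have h2 : Tendsto (fun s : ℂ => (s, (c χ).2)) (𝓝[≠] 0) (𝓝 (c χ)) := by
        rw [hc.eq_mk]
        exact ((Continuous.prodMk_left (X := ℂ) (c χ).2).tendsto 0).mono_left nhdsWithin_le_nhds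
      exact h2.frequently (eventually_mem_nhdsWithin (a := (0 : ℂ)) (s := {0}ᶜ)).frequently
    refine (c.tendsto_symm hc.2.1).frequently (p := fun q => (c q).1 ≠ 0) ?_
    refine (h1.and_eventually (c.open_target.mem_nhds (c.map_source hc.2.1))).mono fun z hz => ?_
    rw [c.right_inv hz.2]
    exact hz.1
  obtain ⟨q, hq, hq1, hq2, hq3⟩ := (hfreq.and_eventually (hGe.and (hGe'.and
    (hlim.eventually_ne (zero_ne_one (α := ℂ)))))).exists
  refine hq3 (mul_left_cancel₀ hq ?_)
  rw [← mul_assoc, ← hq1, mul_one, ← hq2]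

/-- Near `χ`, the function `P` on `X` is the `k`-th power of the first coordinate of the chart times
a unit. -/
def HasOrderInChart (K : Compactification M) (χ : M) (c : OpenPartialHomeomorph M (ℂ × ℂ))
    (P : (Fin 2 → ℂ) → ℂ) (k : ℤ) : Prop :=
  ∃ G : ℂ × ℂ → ℂ, AnalyticAt ℂ G (c χ) ∧ G (c χ) ≠ 0 ∧
    ∀ᶠ q in 𝓝 χ, ∀ w, K.ι w = q → P w = (c q).1 ^ k * G (c q)

variable {K : Compactification M}

/-- The order of a rational function can be read off in any adapted chart. -/
theorem HasOrderAt.exists_eq {f : RatFun} {k : ℤ} (h : HasOrderAt K A χ f k)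
    (hc : IsAdaptedChart A χ c) : ∃ G : ℂ × ℂ → ℂ, AnalyticAt ℂ G (c χ) ∧ G (c χ) ≠ 0 ∧
      ∀ᶠ q in 𝓝 χ, ∀ w, K.ι w = q →
        MvPolynomial.eval w (IsFractionRing.num (MvPolynomial (Fin 2) ℂ) f) =
          (c q).1 ^ k * G (c q) *
            MvPolynomial.eval w (IsFractionRing.den (MvPolynomial (Fin 2) ℂ) f).1 := by
  obtain ⟨c', g, hc', hg, hg0, he⟩ := h
  obtain ⟨H, hH, hH0, hHe⟩ := hc.exists_fst_eq_mul hc'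
  have hgc := hc.analyticAt_comp_symm hc.2.1 hg
  refine ⟨fun z => H z ^ k * g (c.symm z), (hH.zpow hH0).mul hgc, ?_, ?_⟩
  · simp only [c.left_inv hc.2.1]
    exact mul_ne_zero (zpow_ne_zero _ hH0) hg0
  · filter_upwards [he, hHe, c.eventually_left_inverse hc.2.1] with q h1 h2 h3 w hw
    rw [h1 w hw, h2, h3, mul_zpow]
    ring

/-- The canonical denominator of a polynomial is only known to be a unit, not 1. A unit has no
zeros, so it cancels at every point. -/
theorem HasOrderAt.inChart {f : MvPolynomial (Fin 2) ℂ} {k : ℤ}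
    (h : HasOrderAt K A χ (toRat f) k) (hc : IsAdaptedChart A χ c) :
    HasOrderInChart K χ c (fun w => MvPolynomial.eval w f) k := by
  obtain ⟨G, hG, hG0, he⟩ := HasOrderAt.exists_eq h hc
  refine ⟨G, hG, hG0, he.mono fun q hq w hw => ?_⟩
  have h1 := hq w hw
  set d := IsFractionRing.den (MvPolynomial (Fin 2) ℂ) (toRat f)
  have hd : IsUnit (d : MvPolynomial (Fin 2) ℂ) :=
    (IsFractionRing.isUnit_den_iff _).2 ⟨f, rfl⟩
  have hd0 : algebraMap (MvPolynomial (Fin 2) ℂ) RatFun d ≠ 0 :=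
    (hd.map (algebraMap (MvPolynomial (Fin 2) ℂ) RatFun)).ne_zero
  have h2 : IsFractionRing.num (MvPolynomial (Fin 2) ℂ) (toRat f) = f * d := by
    have h3 := IsFractionRing.mk'_num_den' (MvPolynomial (Fin 2) ℂ) (toRat f)
    rw [div_eq_iff hd0, toRat, ← map_mul] at h3
    exact IsFractionRing.injective (MvPolynomial (Fin 2) ℂ) RatFun h3
  rw [h2, map_mul] at h1
  exact mul_right_cancel₀ (hd.map (MvPolynomial.eval w)).ne_zero h1

/-! ### Curvettes -/

/-- Transversality does not depend on the adapted chart: the first coordinates differ by a unit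
factor and vanish at the base point, so their derivatives along the curve vanish together. -/
theorem IsCurvette.chart {γ : ℂ → M} (h : IsCurvette A χ γ) (hc : IsAdaptedChart A χ c) :
    AnalyticAt ℂ (fun z => c (γ z)) 0 ∧ deriv (fun z => (c (γ z)).1) 0 ≠ 0 := by
  obtain ⟨rfl, hγ, c', hc', ha, hd⟩ := h
  have hev : ∀ᶠ z in 𝓝 (0 : ℂ), c'.symm (c' (γ z)) = γ z :=
    hγ.eventually (c'.eventually_left_inverse hc'.2.1)
  have han : AnalyticAt ℂ (fun z => c (γ z)) 0 := by
    have h1 := hc'.analyticAt_transition hc hc'.2.1 hc.2.1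
    refine (AnalyticAt.comp (g := fun z => c (c'.symm z)) (f := fun z => c' (γ z)) h1 ha).congr ?_
    filter_upwards [hev] with z hz
    simp [hz]
  refine ⟨han, fun h0 => hd ?_⟩
  obtain ⟨G, hG, hG0, hGe⟩ := hc.exists_fst_eq_mul hc'
  have h1 : (fun z => (c' (γ z)).1) =ᶠ[𝓝 0] fun z => (c (γ z)).1 * G (c (γ z)) :=
    hγ.eventually hGe
  have h2 : DifferentiableAt ℂ (fun z => (c (γ z)).1) 0 :=
    (analyticAt_fst.comp han).differentiableAt
  have h3 : DifferentiableAt ℂ (fun z => G (c (γ z))) 0 :=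
    (AnalyticAt.comp (g := G) (f := fun z => c (γ z)) hG han).differentiableAt
  rw [h1.deriv_eq, deriv_fun_mul h2 h3, h0, hc.fst_eq_zero]
  simp

/-- The vertical curve through `χ` is a curvette. -/
theorem IsAdaptedChart.isCurvette (hc : IsAdaptedChart A χ c) :
    IsCurvette A χ fun z => c.symm (z, (c χ).2) := by
  have hlim : Tendsto (fun z : ℂ => (z, (c χ).2)) (𝓝 0) (𝓝 (c χ)) := by
    rw [hc.eq_mk]
    exact (Continuous.prodMk_left (X := ℂ) (c χ).2).tendsto 0
  have h0 : c.symm ((0 : ℂ), (c χ).2) = χ := by rw [← hc.eq_mk, c.left_inv hc.2.1]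
  have hev : (fun z : ℂ => c (c.symm (z, (c χ).2))) =ᶠ[𝓝 0] fun z => (z, (c χ).2) :=
    (hlim.eventually (c.open_target.mem_nhds (c.map_source hc.2.1))).mono fun z hz => c.right_inv hz
  refine ⟨h0, ?_, c, hc, ?_, ?_⟩
  · have := (c.tendsto_symm hc.2.1).comp hlim
    rw [ContinuousAt, h0]
    exact this
  · refine AnalyticAt.congr ?_ hev.symm
    fun_prop
  · have : (fun z : ℂ => (c (c.symm (z, (c χ).2))).1) =ᶠ[𝓝 0] fun z => z :=
      hev.mono fun z hz => by simp only [hz]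
    rw [this.deriv_eq]
    simp

/-! ### The curve at infinity -/

/-- A point of `M` at which the coordinates of `X` have finite limits lies in `X`. -/
theorem mem_range_of_tendsto [T2Space M] {q : M} {w₀ : Fin 2 → ℂ}
    (h : Tendsto id (comap K.ι (𝓝 q)) (𝓝 w₀)) : K.ι w₀ = q := by
  have hne : (comap K.ι (𝓝 q)).NeBot := by
    rw [comap_neBot_iff]
    intro t ht
    obtain ⟨x, hx, w, rfl⟩ := mem_closure_iff_nhds.1 (K.denseRange q) t ht
    exact ⟨w, hx⟩
  exact tendsto_nhds_unique ((K.isOpenEmbedding.continuous.tendsto w₀).comp h) tendsto_comap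

/-- Where s ≠ 0, the expressions s^k G and s^l H are continuous and finite, so x and y have finite
limits there and the point belongs to X. Near χ nothing but the curve itself is thus missing from X.
-/
theorem eventually_mem_range [T2Space M] {k l : ℤ} (hc : IsAdaptedChart A χ c)
    (hx : HasOrderInChart K χ c (fun w => w 0) k) (hy : HasOrderInChart K χ c (fun w => w 1) l) :
    ∀ᶠ q in 𝓝 χ, (c q).1 ≠ 0 → q ∈ Set.range K.ι := by
  obtain ⟨G, hG, -, hGe⟩ := hx
  obtain ⟨H, hH, -, hHe⟩ := hy
  filter_upwards [hGe.eventually_nhds, hHe.eventually_nhds, c.open_source.mem_nhds hc.2.1,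
    (c.continuousAt hc.2.1).eventually hG.eventually_continuousAt,
    (c.continuousAt hc.2.1).eventually hH.eventually_continuousAt] with q h1 h2 h3 h4 h5 h0
  have hfst : ContinuousAt (fun q => (c q).1) q := continuousAt_fst.comp (c.continuousAt h3)
  have hcont : ∀ (k : ℤ) (G : ℂ × ℂ → ℂ), ContinuousAt G (c q) →
      ContinuousAt (fun q => (c q).1 ^ k * G (c q)) q := fun k G hG =>
    (hfst.zpow₀ k (Or.inl h0)).mul (ContinuousAt.comp (g := G) hG (c.continuousAt h3))
  refine ⟨![(c q).1 ^ k * G (c q), (c q).1 ^ l * H (c q)], mem_range_of_tendsto ?_⟩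
  rw [tendsto_pi_nhds]
  have hcom : Tendsto K.ι (comap K.ι (𝓝 q)) (𝓝 q) := tendsto_comap
  intro i
  fin_cases i
  · refine Tendsto.congr' ?_ ((hcont k G h4).tendsto.comp hcom)
    filter_upwards [hcom.eventually h1] with w hw
    exact (hw w rfl).symm
  · refine Tendsto.congr' ?_ ((hcont l H h5).tendsto.comp hcom)
    filter_upwards [hcom.eventually h2] with w hw
    exact (hw w rfl).symm

theorem IsCurveAtInfinity.notMem {w : Fin 2 → ℂ} (hA : IsCurveAtInfinity K A) : K.ι w ∉ A :=
  fun h => hA.1.1.2 h ⟨w, rfl⟩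

theorem isAnalyticSubset_singleton [T2Space M] (χ : M) : IsAnalyticSubset ({χ} : Set M) := by
  intro p
  by_cases h : p = χ
  · subst h
    obtain ⟨n, U, e, hU, hp, -, hinj, hhol, -⟩ := exists_local_embedding p
    refine ⟨n, fun i q => e q i - e p i, fun i => ?_, ?_⟩
    · have := holAt_add (hhol i p hp) (holAt_const (-(e p i)) p)
      exact HolAt.congr this (Eventually.of_forall fun q => by simp [sub_eq_add_neg])
    · filter_upwards [hU.mem_nhds hp] with q hq
      simp only [Set.mem_singleton_iff, sub_eq_zero]
      exact ⟨fun h i => by rw [h], fun h => hinj hq hp (funext h)⟩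
  · refine ⟨1, fun _ _ => 1, fun _ => holAt_const 1 p, ?_⟩
    filter_upwards [isOpen_compl_singleton.mem_nhds h] with q hq
    simpa using hq

/-- A curve at infinity has no isolated points. -/
theorem IsCurveAtInfinity.frequently_mem [T2Space M] (hA : IsCurveAtInfinity K A) (hχ : χ ∈ A) :
    ∃ᶠ q in 𝓝[≠] χ, q ∈ A := by
  intro hiso
  obtain ⟨hAan, -, hirr⟩ := hA.1.1.1
  have hiso' : ∀ᶠ q in 𝓝 χ, q ≠ χ → q ∉ A := eventually_nhdsWithin_iff.1 hiso
  -- Removing an isolated point would leave an analytic set, so the infinite set `A` would split,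
  -- against irreducibility.
  have hdiff : IsAnalyticSubset (A \ {χ}) := by
    intro p
    by_cases h : p = χ
    · subst h
      refine ⟨1, fun _ _ => 1, fun _ => holAt_const 1 p, ?_⟩
      filter_upwards [hiso'] with q hq
      simp only [Set.mem_sdiff, Set.mem_singleton_iff, one_ne_zero, forall_const, iff_false, not_and,
        not_not]
      exact fun hqA => by_contra fun hne => hq hne hqA
    · obtain ⟨m, F, hF, hFe⟩ := hAan p
      refine ⟨m, F, hF, ?_⟩
      filter_upwards [hFe, isOpen_compl_singleton.mem_nhds h] with q hq hq'
      rw [← hq]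
      exact ⟨fun h => h.1, fun h => ⟨h, hq'⟩⟩
  rcases hirr {χ} (A \ {χ}) (isAnalyticSubset_singleton χ) hdiff (fun q hq => by
    by_cases h : q = χ
    · exact Or.inl h
    · exact Or.inr ⟨hq, h⟩) with h | h
  · exact hA.2 ((Set.finite_singleton χ).subset h)
  · exact (h hχ).2 rfl

theorem IsCurveAtInfinity.frequently_mem_diff [T2Space M] (hA : IsCurveAtInfinity K A) (hχ : χ ∈ A)
    {F : Set M} (hF : F.Finite) : ∃ᶠ q in 𝓝 χ, q ∈ A \ F := by
  have h1 : ∀ᶠ q in 𝓝[≠] χ, q ∉ F := by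
    have h2 : ∀ᶠ q in 𝓝 χ, q ∉ F \ {χ} :=
      (hF.subset Set.sdiff_subset).isClosed.isOpen_compl.mem_nhds fun h => h.2 rfl
    filter_upwards [mem_nhdsWithin_of_mem_nhds h2, self_mem_nhdsWithin] with q hq hne hqF
    exact hq ⟨hqF, hne⟩
  exact ((hA.frequently_mem hχ).and_eventually h1).filter_mono nhdsWithin_le_nhds

theorem IsCurveAtInfinity.isClosed (hA : IsCurveAtInfinity K A) : IsClosed A := by
  rw [← isOpen_compl_iff, isOpen_iff_mem_nhds]
  intro p hp
  obtain ⟨m, F, hF, hFe⟩ := hA.1.1.1.1 p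
  have h1 : ¬ ∀ i, F i p = 0 := fun h => hp (hFe.self_of_nhds.2 h)
  push Not at h1
  obtain ⟨i, hi⟩ := h1
  filter_upwards [hFe, (HolAt.continuousAt (hF i)).eventually_ne hi] with q hq hqi hqA
  exact hqi (hq.1 hqA i)

end Charts

end CurvesAtInfinity
end

/-! ### Holomorphic families of one-variable functions, and changes of adapted charts. -/

noncomputable section

namespace CurvesAtInfinity

open ReducedComplexSpace (HolAt)

/-! ### Families of holomorphic functions of one variable -/

theorem exists_analyticAt_pow_eq {E : Type*} [NormedAddCommGroup E] [NormedSpace ℂ E] {G : E → ℂ}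
    {z : E} (hG : AnalyticAt ℂ G z) (hG0 : G z ≠ 0) {p : ℕ} (hp : 0 < p) :
    ∃ R : E → ℂ, AnalyticAt ℂ R z ∧ R z ≠ 0 ∧ ∀ᶠ w in 𝓝 z, R w ^ p = G w := by
  obtain ⟨a, ha⟩ := IsAlgClosed.exists_pow_nat_eq (G z) hp
  have ha0 : a ≠ 0 := by
    rintro rfl
    rw [zero_pow hp.ne'] at ha
    exact hG0 ha.symm
  refine ⟨fun w => a * Complex.exp (Complex.log (G w / G z) / p), ?_, ?_, ?_⟩
  · have h1 : AnalyticAt ℂ (fun w => Complex.log (G w / G z)) z :=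
      (hG.div analyticAt_const hG0).clog (by simp [hG0])
    exact analyticAt_const.mul (h1.div_const).cexp
  · exact mul_ne_zero ha0 (Complex.exp_ne_zero _)
  · filter_upwards [hG.continuousAt.eventually_ne hG0] with w hw
    have hp' : (p : ℂ) ≠ 0 := by exact_mod_cast hp.ne'
    rw [mul_pow, ← Complex.exp_nat_mul, mul_div_cancel₀ _ hp', Complex.exp_log (div_ne_zero hw hG0),
      ha, mul_div_cancel₀ _ hG0]

theorem tendsto_mk_left (t₀ : ℂ) : Tendsto (fun s : ℂ => (s, t₀)) (𝓝 0) (𝓝 ((0 : ℂ), t₀)) :=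
  (Continuous.prodMk_left (X := ℂ) t₀).tendsto 0

theorem tendsto_mk_right (t₀ : ℂ) : Tendsto (fun t : ℂ => ((0 : ℂ), t)) (𝓝 t₀) (𝓝 ((0 : ℂ), t₀)) :=
  (Continuous.prodMk_right (0 : ℂ)).tendsto t₀

theorem analyticOrderAt_slice {H Ξ : ℂ × ℂ → ℂ} {t₀ : ℂ} {m : ℕ}
    (hΞ : AnalyticAt ℂ Ξ (0, t₀)) (he : ∀ᶠ z in 𝓝 ((0 : ℂ), t₀), H z = z.1 ^ m * Ξ z) :
    ∀ᶠ t in 𝓝 t₀, analyticOrderAt (fun s => H (s, t)) 0 =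
      m + analyticOrderAt (fun s => Ξ (s, t)) 0 := by
  filter_upwards [(tendsto_mk_right t₀).eventually he.eventually_nhds,
    (tendsto_mk_right t₀).eventually hΞ.eventually_analyticAt] with t ht hΞt
  have h1 : (fun s => H (s, t)) =ᶠ[𝓝 0] (fun s : ℂ => s ^ m) * fun s => Ξ (s, t) :=
    ((tendsto_mk_left t).eventually ht).mono fun s hs => hs
  have h2 : AnalyticAt ℂ (fun s => Ξ (s, t)) 0 := by
    refine AnalyticAt.comp (g := Ξ) (f := fun s => (s, t)) hΞt ?_
    fun_prop
  rw [analyticOrderAt_congr h1, analyticOrderAt_mul (by fun_prop) h2]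
  congr 1
  rw [AnalyticAt.analyticOrderAt_eq_natCast (by fun_prop)]
  exact ⟨fun _ => 1, analyticAt_const, one_ne_zero, Eventually.of_forall fun z => by simp⟩

/-- The order in `s` of `H(s, t)` at `s = 0` either is at least `m` for all `t` near `t₀`, or less
than `m` for all `t ≠ t₀` near `t₀`. -/
theorem order_slice_dichotomy {H : ℂ × ℂ → ℂ} {t₀ : ℂ} (hH : AnalyticAt ℂ H (0, t₀)) (m : ℕ) :
    (∀ᶠ t in 𝓝 t₀, (m : ℕ∞) ≤ analyticOrderAt (fun s => H (s, t)) 0) ∨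
      ∀ᶠ t in 𝓝[≠] t₀, ¬ (m : ℕ∞) ≤ analyticOrderAt (fun s => H (s, t)) 0 := by
  induction m with
  | zero => exact Or.inl (Eventually.of_forall fun t => by simp)
  | succ m ih =>
    rcases ih with h | h
    -- After division by s^m the question is whether Ξ(0, t) vanishes identically near t₀ or has t₀
    -- as its only possible zero.
    · obtain ⟨Ξ, hΞ, he⟩ := exists_analyticAt_eq_pow_mul hH m h
      have h1 := analyticOrderAt_slice hΞ he
      have h2 : AnalyticAt ℂ (fun t => Ξ (0, t)) t₀ := by
        refine AnalyticAt.comp (g := Ξ) (f := fun t => (0, t)) hΞ ?_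
        fun_prop
      have h3 : ∀ᶠ t in 𝓝 t₀, AnalyticAt ℂ (fun s => Ξ (s, t)) 0 := by
        filter_upwards [(tendsto_mk_right t₀).eventually hΞ.eventually_analyticAt] with t ht
        refine AnalyticAt.comp (g := Ξ) (f := fun s => (s, t)) ht ?_
        fun_prop
      rcases h2.eventually_eq_zero_or_eventually_ne_zero with h4 | h4
      · left
        filter_upwards [h1, h3, h4] with t ht1 ht3 ht4
        rw [ht1, Nat.cast_add, Nat.cast_one]
        gcongr
        rw [Order.one_le_iff_ne_zero, ht3.analyticOrderAt_ne_zero]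
        exact ht4
      · right
        filter_upwards [h1.filter_mono nhdsWithin_le_nhds, h3.filter_mono nhdsWithin_le_nhds, h4]
          with t ht1 ht3 ht4
        rw [ht1, ht3.analyticOrderAt_eq_zero.2 ht4, add_zero, not_le]
        exact_mod_cast Nat.lt_succ_self m
    · right
      filter_upwards [h] with t ht h'
      exact ht (le_trans (by exact_mod_cast Nat.le_succ m) h')

/-- Hurwitz's theorem for a family of zero-free functions. -/
theorem ne_zero_of_frequently_ne_zero {D : ℂ × ℂ → ℂ} {t₀ : ℂ} (hD : AnalyticAt ℂ D (0, t₀))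
    (h : ∀ᶠ z in 𝓝 ((0 : ℂ), t₀), z.1 ≠ 0 → D z ≠ 0) (hne : ∃ᶠ t in 𝓝 t₀, D (0, t) ≠ 0) :
    D (0, t₀) ≠ 0 := by
  have h1 : AnalyticAt ℂ (fun t => D (0, t)) t₀ := by
    refine AnalyticAt.comp (g := D) (f := fun t => (0, t)) hD ?_
    fun_prop
  have h2 : ∀ᶠ t in 𝓝[≠] t₀, D (0, t) ≠ 0 :=
    h1.eventually_eq_zero_or_eventually_ne_zero.resolve_left fun h0 =>
      hne (h0.mono fun t ht => not_not.2 ht)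
  rw [eventually_nhdsWithin_iff] at h2
  obtain ⟨ρ, hρ, hball⟩ : ∃ ρ > 0, ∀ s ∈ Metric.closedBall (0 : ℂ) ρ,
      ∀ t ∈ Metric.closedBall t₀ ρ, AnalyticAt ℂ D (s, t) ∧ (s ≠ 0 → D (s, t) ≠ 0) ∧
        (t ≠ t₀ → D (0, t) ≠ 0) := by
    have h3 : ∀ᶠ z in 𝓝 ((0 : ℂ), t₀), z.2 ≠ t₀ → D (0, z.2) ≠ 0 :=
      continuousAt_snd.eventually (p := fun t => t ≠ t₀ → D (0, t) ≠ 0) (by simpa using h2)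
    obtain ⟨ε, hε, hsub⟩ := Metric.nhds_basis_closedBall.eventually_iff.1
      (hD.eventually_analyticAt.and (h.and h3))
    refine ⟨ε, hε, fun s hs t ht => hsub ?_⟩
    rw [← closedBall_prod_same]
    exact ⟨hs, ht⟩
  have hD' : ContinuousOn D (Metric.closedBall (0 : ℂ) ρ ×ˢ Metric.closedBall t₀ ρ) :=
    fun z hz => (hball z.1 hz.1 z.2 hz.2).1.continuousAt.continuousWithinAt
  obtain ⟨δ, hδ, hδle⟩ : ∃ δ > 0, ∀ t ∈ Metric.sphere t₀ ρ, δ ≤ ‖D (0, t)‖ := by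
    have hcont : ContinuousOn (fun t => ‖D (0, t)‖) (Metric.sphere t₀ ρ) := by
      refine (hD'.comp (f := fun t => ((0 : ℂ), t)) (by fun_prop) fun t ht => ?_).norm
      exact ⟨by simp [hρ.le], Metric.sphere_subset_closedBall ht⟩
    obtain ⟨t, ht, hmin⟩ := (isCompact_sphere t₀ ρ).exists_isMinOn
      (NormedSpace.sphere_nonempty.2 hρ.le) hcont
    refine ⟨_, norm_pos_iff.2 ((hball 0 (by simp [hρ.le]) t
      (Metric.sphere_subset_closedBall ht)).2.2 ?_), fun t' ht' => hmin ht'⟩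
    rintro rfl
    simp [hρ.ne] at ht
  have hev : ∀ᶠ s in 𝓝 (0 : ℂ), ∀ t ∈ Metric.sphere t₀ ρ, δ / 2 < ‖D (s, t)‖ := by
    refine (isCompact_sphere t₀ ρ).eventually_forall_of_forall_eventually fun t ht => ?_
    have hc : ContinuousAt (fun z => ‖D z‖) (0, t) :=
      (hball 0 (by simp [hρ.le]) t (Metric.sphere_subset_closedBall ht)).1.continuousAt.norm
    exact hc.eventually (lt_mem_nhds (by linarith [hδle t ht]))
  -- For small s ≠ 0 the function 1/D(s, ·) is holomorphic on the disc and at most 2/δ on its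
  -- boundary. The resulting bound at the center survives the limit s → 0.
  have hev' : ∀ᶠ s in 𝓝[≠] (0 : ℂ), δ / 2 ≤ ‖D (s, t₀)‖ := by
    filter_upwards [hev.filter_mono nhdsWithin_le_nhds, self_mem_nhdsWithin,
      mem_nhdsWithin_of_mem_nhds (Metric.closedBall_mem_nhds (0 : ℂ) hρ)] with s hs hs0 hsρ
    have hd : DiffContOnCl ℂ (fun t => (D (s, t))⁻¹) (Metric.ball t₀ ρ) := by
      have hda : ∀ t ∈ Metric.closedBall t₀ ρ, AnalyticAt ℂ (fun t => (D (s, t))⁻¹) t := by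
        intro t ht
        refine AnalyticAt.inv (AnalyticAt.comp (g := D) (f := fun t => (s, t))
          (hball s hsρ t ht).1 ?_) ((hball s hsρ t ht).2.1 hs0)
        fun_prop
      refine ⟨fun t ht => (hda t (Metric.ball_subset_closedBall ht)).differentiableAt.differentiableWithinAt,
        fun t ht => (hda t (Metric.closure_ball_subset_closedBall ht)).continuousAt.continuousWithinAt⟩
    have h3 := Complex.norm_le_of_forall_mem_frontier_norm_le Metric.isBounded_ball hd
      (C := (δ / 2)⁻¹) (fun t ht => by
        rw [frontier_ball _ hρ.ne'] at ht
        rw [norm_inv]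
        exact inv_anti₀ (by positivity) (hs t ht).le)
      (subset_closure (Metric.mem_ball_self hρ))
    rw [norm_inv] at h3
    exact (inv_le_inv₀ (norm_pos_iff.2 ((hball s hsρ t₀ (Metric.mem_closedBall_self hρ.le)).2.1 hs0))
      (by positivity)).1 h3
  have hlim : Tendsto (fun s => ‖D (s, t₀)‖) (𝓝[≠] 0) (𝓝 ‖D (0, t₀)‖) :=
    ((hD.continuousAt.tendsto.comp (tendsto_mk_left t₀)).norm).mono_left nhdsWithin_le_nhds
  have := ge_of_tendsto hlim hev'
  exact norm_pos_iff.1 (by linarith)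

/-! ### Change of charts -/

section Charts

variable {M : Type*} [TopologicalSpace M] [ReducedComplexSpace M] {A : Set M} {χ : M}
  {c : OpenPartialHomeomorph M (ℂ × ℂ)}

/-- At a point with s = 0 the differential of (s R, T) is triangular with diagonal R and ∂T/∂t, so
the inverse function theorem applies. Multiplying s by a unit keeps the curve equal to the zero set
of the first coordinate. -/
theorem IsAdaptedChart.exists_trans (hc : IsAdaptedChart A χ c) {R T : ℂ × ℂ → ℂ}
    (hR : AnalyticAt ℂ R (c χ)) (hR0 : R (c χ) ≠ 0) (hT : AnalyticAt ℂ T (c χ))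
    (hT0 : fderiv ℂ T (c χ) (0, 1) ≠ 0) {W : Set M} (hW : W ∈ 𝓝 χ) :
    ∃ κ, IsAdaptedChart A χ κ ∧ κ.source ⊆ c.source ∩ W ∧
      ∀ q ∈ κ.source, κ q = ((c q).1 * R (c q), T (c q)) := by
  set z₀ := c χ with hz₀
  let ψ : ℂ × ℂ → ℂ × ℂ := fun z => (z.1 * R z, T z)
  have hψ : AnalyticAt ℂ ψ z₀ := (analyticAt_fst.mul hR).prod hT
  have hd : HasFDerivAt ψ ((z₀.1 • fderiv ℂ R z₀ + R z₀ • ContinuousLinearMap.fst ℂ ℂ ℂ).prod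
      (fderiv ℂ T z₀)) z₀ :=
    (hasFDerivAt_fst.mul hR.differentiableAt.hasFDerivAt).prodMk hT.differentiableAt.hasFDerivAt
  have hinj : Function.Injective (fderiv ℂ ψ z₀ : ℂ × ℂ →ₗ[ℂ] ℂ × ℂ) := by
    rw [hd.fderiv, injective_iff_map_eq_zero, hc.fst_eq_zero]
    rintro ⟨a, b⟩ h
    simp only [ContinuousLinearMap.coe_coe, ContinuousLinearMap.prod_apply, Prod.mk_eq_zero] at h
    obtain ⟨h0, h⟩ := h
    change 0 * fderiv ℂ R z₀ (a, b) + R z₀ * a = 0 at h0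
    obtain rfl : a = 0 := by simpa [hR0] using h0
    have h1 : ((0 : ℂ), b) = b • ((0 : ℂ), (1 : ℂ)) := by simp
    rw [h1, map_smul, smul_eq_mul, mul_eq_zero] at h
    rw [h.resolve_right hT0]
    rfl
  let e : (ℂ × ℂ) ≃L[ℂ] ℂ × ℂ :=
    (LinearEquiv.ofInjectiveEndo (fderiv ℂ ψ z₀ : ℂ × ℂ →ₗ[ℂ] ℂ × ℂ) hinj).toContinuousLinearEquiv
  have he : fderiv ℂ ψ z₀ = (e : ℂ × ℂ →L[ℂ] ℂ × ℂ) := by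
    ext <;> rfl
  have hs : HasStrictFDerivAt ψ (e : ℂ × ℂ →L[ℂ] ℂ × ℂ) z₀ := he ▸ hψ.hasStrictFDerivAt
  let Ψ := hs.toOpenPartialHomeomorph ψ
  have hΨ : ∀ z, Ψ z = ψ z := fun z => rfl
  have hz₀Ψ : z₀ ∈ Ψ.source := hs.mem_toOpenPartialHomeomorph_source
  have hsymm : AnalyticAt ℂ Ψ.symm (ψ z₀) := Ψ.analyticAt_symm' hz₀Ψ hψ he
  have hev : ∀ᶠ z in 𝓝 z₀, AnalyticAt ℂ ψ z ∧ AnalyticAt ℂ Ψ.symm (ψ z) ∧ R z ≠ 0 :=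
    hψ.eventually_analyticAt.and ((hψ.continuousAt.eventually hsymm.eventually_analyticAt).and
      (hR.continuousAt.eventually_ne hR0))
  obtain ⟨O, hO, hOo, hχO⟩ := mem_nhds_iff.1
    (Filter.inter_mem hW ((c.continuousAt hc.2.1).eventually hev))
  refine ⟨(c.trans Ψ).restrOpen O hOo, ⟨hc.1, ?_, ?_, ?_⟩, ?_, ?_⟩
  · exact ⟨by simpa [OpenPartialHomeomorph.trans_source] using ⟨hc.2.1, hz₀Ψ⟩, hχO⟩
  · rintro q ⟨hq, hqO⟩ f
    rw [OpenPartialHomeomorph.trans_source] at hq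
    obtain ⟨-, h1, h2, h3⟩ := hO hqO
    have h4 : AnalyticAt ℂ (f ∘ ((c.trans Ψ).restrOpen O hOo).symm) (((c.trans Ψ).restrOpen O hOo) q)
        ↔ AnalyticAt ℂ ((f ∘ c.symm) ∘ Ψ.symm) (ψ (c q)) := Iff.rfl
    rw [h4, hc.2.2.1 q hq.1 f]
    refine ⟨fun h => AnalyticAt.comp ?_ h2, fun h => ?_⟩
    · have : Ψ.symm (ψ (c q)) = c q := Ψ.left_inv hq.2
      rwa [this]
    · refine (AnalyticAt.comp (g := (f ∘ c.symm) ∘ Ψ.symm) (f := ψ) h h1).congr ?_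
      filter_upwards [Ψ.open_source.mem_nhds hq.2] with z hz
      have : Ψ.symm (ψ z) = z := Ψ.left_inv hz
      simp [this]
  · rintro q ⟨hq, hqO⟩
    rw [OpenPartialHomeomorph.trans_source] at hq
    obtain ⟨-, h1, h2, h3⟩ := hO hqO
    rw [hc.2.2.2 q hq.1]
    change _ ↔ (c q).1 * R (c q) = 0
    simp [h3]
  · rintro q ⟨hq, hqO⟩
    rw [OpenPartialHomeomorph.trans_source] at hq
    exact ⟨hq.1, (hO hqO).1⟩
  · rintro q -
    rfl

end Charts

end CurvesAtInfinity
end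

/-! ### Existence of coordinates in which y is the generic Puiseux series. -/

noncomputable section

namespace CurvesAtInfinity

open ReducedComplexSpace (HolAt)

/-! ### Conjugates of a Puiseux polynomial in families -/

theorem finite_roots_of_unity {p : ℕ} (hp : 0 < p) : {ω : ℂ | ω ^ p = 1}.Finite := by
  refine (Polynomial.nthRootsFinset p (1 : ℂ)).finite_toSet.subset fun ω hω => ?_
  simpa [Polynomial.mem_nthRootsFinset hp] using hω

/-- If, for all `t` near `t₀`, a function agrees up to order `k` with a conjugate of
`φ(s ^ (-p))`, then it does so with the same conjugate for all `t`, and the difference is divisible by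
`s ^ k`. -/
theorem exists_conjugate_expansion {p : ℕ} (hp : 0 < p) {φ : ℚ →₀ ℂ} {k l : ℤ} {h : ℂ × ℂ → ℂ}
    {t₀ : ℂ} (hh : AnalyticAt ℂ h (0, t₀))
    (hord : ∀ᶠ t in 𝓝 t₀, ∃ ω : ℂ, ω ^ p = 1 ∧ (k : WithTop ℤ) ≤
      meromorphicOrderAt (fun s => s ^ l * h (s, t) - evalPuiseux φ p (ω * s)) 0) :
    ∃ ω : ℂ, ω ^ p = 1 ∧ ∃ Ξ : ℂ × ℂ → ℂ, AnalyticAt ℂ Ξ (0, t₀) ∧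
      ∀ᶠ z in 𝓝 ((0 : ℂ), t₀), z.1 ≠ 0 →
        z.1 ^ l * h z = evalPuiseux φ p (ω * z.1) + z.1 ^ k * Ξ z := by
  -- Multiplication by s^L clears all negative powers, so that the differences become holomorphic
  -- functions `H ω`.
  obtain ⟨L, hLl, hLk, hLe⟩ : ∃ L : ℕ, 0 ≤ l + L ∧ 0 ≤ k + L ∧ ∀ e ∈ φ.support, 0 ≤ expo p e + L := by
    obtain ⟨b, hb⟩ := (φ.support.image fun e => -expo p e).bddAbove
    refine ⟨(max (-l) (max (-k) b)).toNat, ?_, ?_, fun e he => ?_⟩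
    · omega
    · omega
    · have := hb (Finset.mem_coe.2 (Finset.mem_image_of_mem _ he))
      omega
  obtain ⟨a, ha⟩ := Int.eq_ofNat_of_zero_le hLl
  obtain ⟨m, hm⟩ := Int.eq_ofNat_of_zero_le hLk
  have hunit : ∀ {s : ℂ}, s ≠ 0 → ∀ (j : ℤ) (n : ℕ), j + L = n → s ^ n = s ^ L * s ^ j := by
    intro s hs j n hj
    rw [← zpow_natCast, ← hj, zpow_add₀ hs, mul_comm, zpow_natCast]
  let H : ℂ → ℂ × ℂ → ℂ := fun ω z => z.1 ^ a * h z -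
    ∑ e ∈ φ.support, φ e * ω ^ expo p e * z.1 ^ (expo p e + L).toNat
  have hHe : ∀ ω (z : ℂ × ℂ), z.1 ≠ 0 →
      H ω z = z.1 ^ L * (z.1 ^ l * h z - evalPuiseux φ p (ω * z.1)) := by
    intro ω z hz
    simp only [H, evalPuiseux_eq_sum subset_rfl]
    rw [hunit hz l a ha, mul_sub, Finset.mul_sum, mul_assoc]
    congr 1
    refine Finset.sum_congr rfl fun e he => ?_
    rw [hunit hz (expo p e) _ (Int.toNat_of_nonneg (hLe e he)).symm, mul_zpow]
    ring
  have hHan : ∀ ω, ∀ᶠ t in 𝓝 t₀, AnalyticAt ℂ (H ω) (0, t) := by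
    intro ω
    filter_upwards [(tendsto_mk_right t₀).eventually hh.eventually_analyticAt] with t ht
    have : ∀ n : ℕ, AnalyticAt ℂ (fun z : ℂ × ℂ => z.1 ^ n) (0, t) := fun n => analyticAt_fst.pow n
    exact ((this a).mul ht).sub (Finset.analyticAt_fun_sum _ fun e _ =>
      analyticAt_const.mul (this _))
  have hHord : ∀ ω, ∀ᶠ t in 𝓝 t₀, (k : WithTop ℤ) ≤
      meromorphicOrderAt (fun s => s ^ l * h (s, t) - evalPuiseux φ p (ω * s)) 0 →
      (m : ℕ∞) ≤ analyticOrderAt (fun s => H ω (s, t)) 0 := by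
    intro ω
    filter_upwards [hHan ω, (tendsto_mk_right t₀).eventually hh.eventually_analyticAt]
      with t ht hht hk
    have h1 : AnalyticAt ℂ (fun s => H ω (s, t)) 0 := by
      refine AnalyticAt.comp (g := H ω) (f := fun s => (s, t)) ht ?_
      fun_prop
    have h2 : MeromorphicAt (fun s => s ^ l * h (s, t) - evalPuiseux φ p (ω * s)) 0 := by
      have h3 : AnalyticAt ℂ (fun s => h (s, t)) 0 := by
        refine AnalyticAt.comp (g := h) (f := fun s => (s, t)) hht ?_
        fun_prop
      have h4 : MeromorphicAt (fun s : ℂ => s ^ l) 0 := by fun_prop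
      exact (h4.mul h3.meromorphicAt).sub (meromorphicAt_evalPuiseux φ p ω 0)
    have h3 : meromorphicOrderAt (fun s => H ω (s, t)) 0 = (L : ℤ) +
        meromorphicOrderAt (fun s => s ^ l * h (s, t) - evalPuiseux φ p (ω * s)) 0 := by
      have h4 : meromorphicOrderAt (fun s : ℂ => s ^ L) 0 = (L : ℤ) := by
        have := meromorphicOrderAt_const_mul_zpow one_ne_zero L
        simpa using this
      rw [← h4, ← meromorphicOrderAt_mul (by fun_prop) h2]
      refine meromorphicOrderAt_congr ?_
      filter_upwards [self_mem_nhdsWithin] with s hs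
      exact hHe ω (s, t) hs
    rw [h1.meromorphicOrderAt_eq] at h3
    have h5 : ((L : ℤ) : WithTop ℤ) + (k : WithTop ℤ) ≤
        (analyticOrderAt (fun s => H ω (s, t)) 0).map (Nat.cast : ℕ → ℤ) := by
      rw [h3]
      gcongr
    revert h5
    cases analyticOrderAt (fun s => H ω (s, t)) 0 with
    | top => simp
    | coe n =>
      intro h5
      have h6 : (L : ℤ) + k ≤ (n : ℤ) := by rw [ENat.map_natCast] at h5; exact_mod_cast h5
      have h7 : m ≤ n := by omega
      exact_mod_cast h7
  have hfin := finite_roots_of_unity hp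
  -- For each of the finitely many ω, the agreement holds for all t near t₀ or fails for all t ≠ t₀
  -- near t₀. If it failed for every ω, a common t ≠ t₀ would have no conjugate at all.
  obtain ⟨ω, hω, hωm⟩ : ∃ ω : ℂ, ω ^ p = 1 ∧
      ∀ᶠ t in 𝓝 t₀, (m : ℕ∞) ≤ analyticOrderAt (fun s => H ω (s, t)) 0 := by
    by_contra! hcon
    have h1 : ∀ ω ∈ {ω : ℂ | ω ^ p = 1}, ∀ᶠ t in 𝓝[≠] t₀,
        ¬ (m : ℕ∞) ≤ analyticOrderAt (fun s => H ω (s, t)) 0 := fun ω hω =>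
      (order_slice_dichotomy (hHan ω).self_of_nhds m).resolve_left fun h =>
        hcon ω hω (h.mono fun t ht => not_lt.2 ht)
    have h2 : ∀ᶠ t in 𝓝[≠] t₀, ∀ ω ∈ {ω : ℂ | ω ^ p = 1}, (k : WithTop ℤ) ≤
        meromorphicOrderAt (fun s => s ^ l * h (s, t) - evalPuiseux φ p (ω * s)) 0 →
        (m : ℕ∞) ≤ analyticOrderAt (fun s => H ω (s, t)) 0 :=
      (hfin.eventually_all.2 fun ω _ => hHord ω).filter_mono nhdsWithin_le_nhds
    obtain ⟨t, ht1, ht2, ω, hω, ht3⟩ := ((hfin.eventually_all.2 h1).and (h2.and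
      (hord.filter_mono nhdsWithin_le_nhds))).exists
    exact ht1 ω hω (ht2 ω hω ht3)
  obtain ⟨Ξ, hΞ, hΞe⟩ := exists_analyticAt_eq_pow_mul (hHan ω).self_of_nhds m hωm
  refine ⟨ω, hω, Ξ, hΞ, hΞe.mono fun z hz hz0 => ?_⟩
  rw [hHe ω z hz0, hunit hz0 k m hm, mul_assoc] at hz
  rw [← mul_left_cancel₀ (pow_ne_zero _ hz0) hz]
  ring

/-! ### Charts in which `y` is the generic Puiseux series -/

section Charts

variable {M : Type*} [TopologicalSpace M] [ReducedComplexSpace M] {K : Compactification M}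
  {A : Set M} {χ : M}

/-- A chart `(τ, ξ)` in which `x = τ ^ (-p)` and `y = φ(x) + ξ x ^ r`. -/
def IsNormalChart (K : Compactification M) (A : Set M) (φ : ℚ →₀ ℂ) (r : ℚ) (p : ℕ) (χ : M)
    (κ : OpenPartialHomeomorph M (ℂ × ℂ)) : Prop :=
  IsAdaptedChart A χ κ ∧ ∀ q ∈ κ.source, (κ q).1 ≠ 0 →
    ∃ w, K.ι w = q ∧ w 0 = ((κ q).1 ^ p)⁻¹ ∧
      w 1 = evalPuiseux φ p (κ q).1 + (κ q).2 * (κ q).1 ^ expo p r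

/-- If x = s^(-p) G with G a unit, then s times a p-th root of 1/G is the new first coordinate. -/
theorem exists_chart_fst_eq {p : ℕ} (hp : 0 < p) (h : HasOrderAt K A χ ratX (-p)) :
    ∃ c, IsAdaptedChart A χ c ∧ ∀ q ∈ c.source, ∀ w, K.ι w = q → w 0 = ((c q).1 ^ p)⁻¹ := by
  obtain ⟨c, -, hc, -⟩ := id h
  obtain ⟨G, hG, hG0, hGe⟩ := HasOrderAt.inChart h hc
  obtain ⟨R, hR, hR0, hRe⟩ := exists_analyticAt_pow_eq (hG.inv hG0) (inv_ne_zero hG0) hp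
  obtain ⟨κ, hκ, hsub, hκe⟩ := hc.exists_trans hR hR0 analyticAt_snd
    (by simp [fderiv_snd]) (Filter.inter_mem hGe ((c.continuousAt hc.2.1).eventually hRe))
  refine ⟨κ, hκ, fun q hq w hw => ?_⟩
  obtain ⟨-, h1, h2⟩ := hsub hq
  have h3 : MvPolynomial.eval w (MvPolynomial.X 0) = _ := h1 w hw
  rw [MvPolynomial.eval_X] at h3
  have h4 : R (c q) ^ p = (G (c q))⁻¹ := h2
  rw [hκe q hq, mul_pow, h4, mul_inv, inv_inv, h3, zpow_neg, zpow_natCast]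

theorem ratX_ne_zero : ratX ≠ 0 := by
  rw [ratX, toRat, Ne, IsFractionRing.to_map_eq_zero_iff]
  exact MvPolynomial.X_ne_zero 0

theorem toRat_ne_zero {f : MvPolynomial (Fin 2) ℂ} (hf : f ≠ 0) : toRat f ≠ 0 := by
  rwa [toRat, Ne, IsFractionRing.to_map_eq_zero_iff]

variable {c : OpenPartialHomeomorph M (ℂ × ℂ)}

/-- The order of a polynomial along a vertical curve. -/
theorem HasOrderAt.meromorphicOrderAt_slice {f : MvPolynomial (Fin 2) ℂ} {n : ℤ}
    (h : HasOrderAt K A χ (toRat f) n) (hc : IsAdaptedChart A χ c) (X Y : ℂ × ℂ → ℂ)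
    (hW : ∀ᶠ z in 𝓝 (c χ), z.1 ≠ 0 → K.ι ![X z, Y z] = c.symm z)
    (hX : MeromorphicAt (fun s => X (s, (c χ).2)) 0)
    (hY : MeromorphicAt (fun s => Y (s, (c χ).2)) 0) :
    meromorphicOrderAt (fun s => MvPolynomial.eval ![X (s, (c χ).2), Y (s, (c χ).2)] f) 0 = n := by
  obtain ⟨G, hG, hG0, hGe⟩ := HasOrderAt.inChart h hc
  rw [hc.eq_mk] at hG hG0 hW
  have hlim := tendsto_mk_left (c χ).2
  have h1 := (c.tendsto_symm hc.2.1)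
  rw [hc.eq_mk] at h1
  have htar : ∀ᶠ z in 𝓝 ((0 : ℂ), (c χ).2), z ∈ c.target := by
    rw [← hc.eq_mk]
    exact c.open_target.mem_nhds (c.map_source hc.2.1)
  rw [meromorphicOrderAt_eq_int_iff (meromorphicAt_eval hX hY f)]
  refine ⟨fun s => G (s, (c χ).2), ?_, hG0, ?_⟩
  · refine AnalyticAt.comp (g := G) (f := fun s => (s, (c χ).2)) hG ?_
    fun_prop
  · filter_upwards [self_mem_nhdsWithin, (hlim.eventually hW).filter_mono nhdsWithin_le_nhds,
      ((h1.comp hlim).eventually hGe).filter_mono nhdsWithin_le_nhds,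
      (hlim.eventually htar).filter_mono nhdsWithin_le_nhds] with s hs hWs hGs hts
    have h2 := hGs _ (hWs hs)
    simp only [Function.comp_apply, c.right_inv hts] at h2
    rw [h2, sub_zero, smul_eq_mul]

/-- The function `Ξ` in `y = ψ(s) + s ^ k Ξ(s, t)` is a coordinate on the curves `s = const`. -/
theorem IsAdaptedChart.fderiv_ne_zero (hc : IsAdaptedChart A χ c) {X ψ g : ℂ → ℂ} {Ξ : ℂ × ℂ → ℂ}
    {z : ℂ × ℂ} (hz : z ∈ c.target) (hΞ : AnalyticAt ℂ Ξ z)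
    (hW : ∀ᶠ z in 𝓝 z, K.ι ![X z.1, ψ z.1 + g z.1 * Ξ z] = c.symm z) :
    fderiv ℂ Ξ z (0, 1) ≠ 0 := by
  intro h0
  have hsource := c.map_target hz
  -- On X the second coordinate t is a holomorphic function of (x, y). If ∂Ξ/∂t vanished at z, then
  -- (x, y) would be stationary in t at z, and so would t itself.
  have hT : AnalyticAt ℂ ((fun q => (c q).2) ∘ K.ι) ![X z.1, ψ z.1 + g z.1 * Ξ z] := by
    rw [← K.holAt_iff, hW.self_of_nhds]
    exact hc.holAt_comp hsource analyticAt_snd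
  have hlim : Tendsto (fun t : ℂ => (z.1, t)) (𝓝 z.2) (𝓝 z) :=
    (Continuous.prodMk_right z.1).tendsto z.2
  have h1 : HasDerivAt (fun t : ℂ => (z.1, t)) ((0 : ℂ), (1 : ℂ)) z.2 :=
    (hasDerivAt_const _ _).prodMk (hasDerivAt_id _)
  have h2 : HasDerivAt (fun t : ℂ => Ξ (z.1, t)) 0 z.2 := by
    rw [← h0]
    exact HasFDerivAt.comp_hasDerivAt (l := Ξ) z.2 hΞ.differentiableAt.hasFDerivAt h1
  have h3 : HasDerivAt (fun t : ℂ => ![X z.1, ψ z.1 + g z.1 * Ξ (z.1, t)]) 0 z.2 := by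
    rw [hasDerivAt_pi]
    intro i
    fin_cases i
    · exact hasDerivAt_const _ _
    · simpa using (h2.const_mul (g z.1)).const_add (ψ z.1)
  have h4 := HasFDerivAt.comp_hasDerivAt (l := (fun q => (c q).2) ∘ K.ι) z.2
    hT.differentiableAt.hasFDerivAt h3
  rw [map_zero] at h4
  have h5 : (fun t : ℂ => t) =ᶠ[𝓝 z.2]
      ((fun q => (c q).2) ∘ K.ι) ∘ fun t : ℂ => ![X z.1, ψ z.1 + g z.1 * Ξ (z.1, t)] := by
    filter_upwards [hlim.eventually hW, hlim.eventually (c.open_target.mem_nhds hz)] with t ht ht'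
    simp only [Function.comp_apply, ht, c.right_inv ht']
  exact one_ne_zero ((hasDerivAt_id z.2).unique (h4.congr_of_eventuallyEq h5))

theorem IsAdaptedChart.eventually_slice [T2Space M] (hc : IsAdaptedChart A χ c) {F : Set M}
    (hF : F.Finite) (hχ : χ ∉ F) :
    ∀ᶠ t in 𝓝 (c χ).2, (0, t) ∈ c.target ∧ c.symm (0, t) ∈ A \ F := by
  have hlim := tendsto_mk_right (c χ).2
  rw [← hc.eq_mk] at hlim
  filter_upwards [hlim.eventually (c.open_target.mem_nhds (c.map_source hc.2.1)),
    ((c.tendsto_symm hc.2.1).comp hlim).eventually (hF.isClosed.isOpen_compl.mem_nhds hχ)]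
    with t h1 h2
  refine ⟨h1, ?_, h2⟩
  rw [hc.2.2.2 _ (c.map_target h1), c.right_inv h1]

/-- The curve has no isolated points, so near χ it contains points outside any finite set, even if χ
itself is exceptional. -/
theorem IsAdaptedChart.exists_slice [T2Space M] (hc : IsAdaptedChart A χ c)
    (hA : IsCurveAtInfinity K A) {F : Set M} (hF : F.Finite) {P : ℂ → Prop}
    (hP : ∀ᶠ t in 𝓝 (c χ).2, P t) : ∃ t, (0, t) ∈ c.target ∧ c.symm (0, t) ∈ A \ F ∧ P t := by
  have h1 : ∀ᶠ q in 𝓝 χ, P (c q).2 :=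
    (continuousAt_snd.comp (c.continuousAt hc.2.1)).eventually hP
  obtain ⟨q, hq, hPq, hqc⟩ := ((hA.frequently_mem_diff hc.1 hF).and_eventually
    (h1.and (c.open_source.mem_nhds hc.2.1))).exists
  have h2 : ((0 : ℂ), (c q).2) = c q := Prod.ext ((hc.2.2.2 q hqc).1 hq.1).symm rfl
  exact ⟨(c q).2, by rw [h2]; exact c.map_source hqc, by rw [h2, c.left_inv hqc]; exact hq, hPq⟩

variable {ν : RatFun → ℤ} {φ : ℚ →₀ ℂ} {r : ℚ}

set_option maxHeartbeats 800000 in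
/-- Near all but finitely many points of the curve, the parameters `(τ, ξ)` of the generic Puiseux
series are coordinates. -/
theorem exists_isNormalChart [T2Space M] (hA : IsCurveAtInfinity K A) (hν : IsOrderAlong K A ν)
    (hx : ν ratX < 0) (hφ : IsGenericPuiseux ν φ r) :
    ∃ p : ℕ, 0 < p ∧ ν ratX = -p ∧ HasDenominator φ p ∧ (∃ j : ℤ, (j : ℚ) = p * r) ∧
      ∃ F : Set M, F.Finite ∧ ∀ χ ∈ A \ F, ∃ κ, IsNormalChart K A φ r p χ κ := by
  obtain ⟨p, hpx⟩ := Int.eq_ofNat_of_zero_le (neg_nonneg.2 hx.le)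
  have hp : 0 < p := by omega
  have hxp : ν ratX = -p := by omega
  -- This one polynomial detects agreement with a conjugate of φ. The exceptional set `F` below
  -- consists of the points at which x, y or `f₀` does not have its generic order.
  obtain ⟨f₀, hf₀, hf₀'⟩ := exists_polynomial_order_sub_eq hφ.1 hp
  have horder : ∀ f : MvPolynomial (Fin 2) ℂ, f ≠ 0 →
      ∃ d, IsDegree (substSeries φ r f) d ∧ (ν (toRat f) : ℚ) = -(p * d) := fun f hf => by
    obtain ⟨d, hd, hd'⟩ := hφ.2 f hf
    refine ⟨d, hd, ?_⟩
    rw [hd', hxp]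
    push_cast
    ring
  obtain ⟨d₀, hd₀, hd₀'⟩ := horder f₀ hf₀
  have hY : (MvPolynomial.X 1 : MvPolynomial (Fin 2) ℂ) ≠ 0 := MvPolynomial.X_ne_zero 1
  set F : Set M := {χ ∈ A | ¬ HasOrderAt K A χ ratX (ν ratX)} ∪
    ({χ ∈ A | ¬ HasOrderAt K A χ ratY (ν ratY)} ∪
      {χ ∈ A | ¬ HasOrderAt K A χ (toRat f₀) (ν (toRat f₀))}) with hFdef
  have hF : F.Finite := (hν _ ratX_ne_zero).union ((hν _ (toRat_ne_zero hY)).union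
    (hν _ (toRat_ne_zero hf₀)))
  have hFx : ∀ χ ∈ A \ F, HasOrderAt K A χ ratX (-p) := fun χ hχ => by
    by_contra h
    exact hχ.2 (Or.inl ⟨hχ.1, by rwa [hxp]⟩)
  have hFy : ∀ χ ∈ A \ F, HasOrderAt K A χ ratY (ν ratY) := fun χ hχ => by
    by_contra h
    exact hχ.2 (Or.inr (Or.inl ⟨hχ.1, h⟩))
  have hFf : ∀ χ ∈ A \ F, HasOrderAt K A χ (toRat f₀) (ν (toRat f₀)) := fun χ hχ => by
    by_contra h
    exact hχ.2 (Or.inr (Or.inr ⟨hχ.1, h⟩))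
  set k := expo p r with hk
  set l := ν ratY with hl
  -- the chart with `x = s ^ (-p)`, and the function `y` in it
  have hlocal : ∀ χ ∈ A \ F, ∃ (c : OpenPartialHomeomorph M (ℂ × ℂ)) (h : ℂ × ℂ → ℂ),
      IsAdaptedChart A χ c ∧ AnalyticAt ℂ h (c χ) ∧ ∀ᶠ z in 𝓝 (c χ), z ∈ c.target ∧
        (z.1 ≠ 0 → K.ι ![(z.1 ^ p)⁻¹, z.1 ^ l * h z] = c.symm z) := by
    intro χ hχ
    obtain ⟨c, hc, hcx⟩ := exists_chart_fst_eq hp (hFx χ hχ)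
    obtain ⟨h, hh, hh0, hhe⟩ := HasOrderAt.inChart (hFy χ hχ) hc
    have hxc := HasOrderAt.inChart (hFx χ hχ) hc
    have hyc := HasOrderAt.inChart (hFy χ hχ) hc
    simp only [MvPolynomial.eval_X] at hxc hyc hhe
    have hmem := eventually_mem_range hc hxc hyc
    refine ⟨c, h, hc, hh, ?_⟩
    filter_upwards [(c.tendsto_symm hc.2.1).eventually hmem, (c.tendsto_symm hc.2.1).eventually hhe,
      c.open_target.mem_nhds (c.map_source hc.2.1)] with z h1 h2 h3
    refine ⟨h3, fun hz0 => ?_⟩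
    rw [c.right_inv h3] at h1 h2
    obtain ⟨w, hw⟩ := h1 hz0
    rw [← hw]
    congr 1
    have hwx := hcx _ (c.map_target h3) w hw
    rw [c.right_inv h3] at hwx
    ext i
    fin_cases i
    · exact hwx.symm
    · exact (h2 w hw).symm
  have hmx : MeromorphicAt (fun s : ℂ => (s ^ p)⁻¹) 0 := by fun_prop
  have hmer : ∀ {h : ℂ × ℂ → ℂ} {t : ℂ}, AnalyticAt ℂ h (0, t) →
      MeromorphicAt (fun s => s ^ l * h (s, t)) 0 := by
    intro h t hh
    have h3 : AnalyticAt ℂ (fun s => h (s, t)) 0 := by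
      refine AnalyticAt.comp (g := h) (f := fun s => (s, t)) hh ?_
      fun_prop
    have h4 : MeromorphicAt (fun s : ℂ => s ^ l) 0 := by fun_prop
    exact h4.mul h3.meromorphicAt
  -- conjugates of the Puiseux polynomial on vertical curves
  have hconj : ∀ (c : OpenPartialHomeomorph M (ℂ × ℂ)) (h : ℂ × ℂ → ℂ) (χ : M),
      IsAdaptedChart A χ c → AnalyticAt ℂ h (c χ) → χ ∈ A \ F → (∀ᶠ z in 𝓝 (c χ),
        z.1 ≠ 0 → K.ι ![(z.1 ^ p)⁻¹, z.1 ^ l * h z] = c.symm z) →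
      HasDenominator φ p ∧ (∃ j : ℤ, (j : ℚ) = p * r) ∧ ∃ ω : ℂ, ω ^ p = 1 ∧
        meromorphicOrderAt (fun s => s ^ l * h (s, (c χ).2) - evalPuiseux φ p (ω * s)) 0 = k := by
    intro c h χ hc hh hχ hW
    have hh' := hh
    rw [hc.eq_mk] at hh'
    have h1 := (hFf χ hχ).meromorphicOrderAt_slice hc (fun z => (z.1 ^ p)⁻¹)
      (fun z => z.1 ^ l * h z) hW hmx (hmer hh')
    exact hf₀' d₀ hd₀ (fun s => s ^ l * h (s, (c χ).2)) _ (hmer hh') hd₀' h1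
  have hden : HasDenominator φ p ∧ ∃ j : ℤ, (j : ℚ) = p * r := by
    obtain ⟨χ, hχA, hχF⟩ := (hA.2.sdiff hF).nonempty
    obtain ⟨c, h, hc, hh, hW⟩ := hlocal χ ⟨hχA, hχF⟩
    obtain ⟨h1, h2, -⟩ := hconj c h χ hc hh ⟨hχA, hχF⟩ (hW.mono fun z hz => hz.2)
    exact ⟨h1, h2⟩
  refine ⟨p, hp, hxp, hden.1, hden.2, F, hF, fun χ hχ => ?_⟩
  obtain ⟨c, h, hc, hh, hW⟩ := hlocal χ hχ
  set t₀ := (c χ).2 with ht₀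
  have hcχ : c χ = (0, t₀) := hc.eq_mk
  have hcχ' : 𝓝 (c χ) = 𝓝 (0, t₀) := by rw [hcχ]
  rw [hcχ'] at hW
  have hh' := hh
  rw [hcχ] at hh'
  have hright := tendsto_mk_right t₀
  have hslice : ∀ᶠ t in 𝓝 t₀, AnalyticAt ℂ h (0, t) ∧ ∀ᶠ z in 𝓝 ((0 : ℂ), t), z.1 ≠ 0 →
      K.ι ![(z.1 ^ p)⁻¹, z.1 ^ l * h z] = c.symm z := by
    filter_upwards [hright.eventually hh'.eventually_analyticAt, hright.eventually hW.eventually_nhds]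
      with t h1 h2
    exact ⟨h1, h2.mono fun z hz => hz.2⟩
  obtain ⟨ω, hω, Ξ, hΞ, hΞe⟩ : ∃ ω : ℂ, ω ^ p = 1 ∧ ∃ Ξ : ℂ × ℂ → ℂ, AnalyticAt ℂ Ξ (0, t₀) ∧
      ∀ᶠ z in 𝓝 ((0 : ℂ), t₀), z.1 ≠ 0 →
        z.1 ^ l * h z = evalPuiseux φ p (ω * z.1) + z.1 ^ k * Ξ z := by
    refine exists_conjugate_expansion hp hh' ?_
    filter_upwards [hslice, hc.eventually_slice hF hχ.2] with t ht1 ht2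
    have h1 : c (c.symm (0, t)) = (0, t) := c.right_inv ht2.1
    obtain ⟨-, -, ω, hω, hωk⟩ := hconj c h _ (hc.of_mem ht2.2.1 (c.map_target ht2.1))
      (by rw [h1]; exact ht1.1) ht2.2 (by rw [h1]; exact ht1.2)
    rw [h1] at hωk
    exact ⟨ω, hω, hωk.ge⟩
  have hω0 : ω ≠ 0 := by
    rintro rfl
    simp [zero_pow hp.ne'] at hω
  have hΞt : ∀ᶠ t in 𝓝 t₀, AnalyticAt ℂ Ξ (0, t) ∧ ∀ᶠ z in 𝓝 ((0 : ℂ), t), z.1 ≠ 0 →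
        z.1 ^ l * h z = evalPuiseux φ p (ω * z.1) + z.1 ^ k * Ξ z :=
    (hright.eventually hΞ.eventually_analyticAt).and (hright.eventually hΞe.eventually_nhds)
  -- `Ξ` is not constant on the curve
  have hnc : ¬ ∀ᶠ t in 𝓝 t₀, Ξ (0, t) = Ξ (0, t₀) := by
    intro hconst
    -- The constant is chosen so that c (ω s)^k = Ξ(0, t₀) s^k. If Ξ(0, t) were constant, y would
    -- agree with the conjugate of φ + c x^r beyond the exponent r, which this polynomial forbids.
    obtain ⟨f, hf, hf'⟩ := exists_polynomial_order_sub_le hφ.1 hp hden.1 hden.2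
      (Ξ (0, t₀) * (ω ^ k)⁻¹)
    obtain ⟨d, hd, hd'⟩ := horder f hf
    -- The new polynomial has its own exceptional points, possibly including χ, so the argument is
    -- run at a nearby t.
    obtain ⟨t, ht, htA, ⟨hht, hWt⟩, ⟨hΞt, hΞet⟩, hct⟩ := hc.exists_slice hA
      (hν _ (toRat_ne_zero hf)) (hslice.and (hΞt.and hconst))
    have h1 : c (c.symm (0, t)) = (0, t) := c.right_inv ht
    have h2 : HasOrderAt K A (c.symm (0, t)) (toRat f) (ν (toRat f)) := by
      by_contra hcon
      exact htA.2 ⟨htA.1, hcon⟩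
    have h3 := h2.meromorphicOrderAt_slice (hc.of_mem htA.1 (c.map_target ht))
      (fun z => (z.1 ^ p)⁻¹) (fun z => z.1 ^ l * h z) (by rw [h1]; exact hWt) hmx
      (by rw [h1]; exact hmer hht)
    rw [h1] at h3
    have h4 := hf' d hd (fun s => s ^ l * h (s, t)) _ (hmer hht) hd' h3 ω hω
    have h5 : AnalyticAt ℂ (fun s => Ξ (s, t) - Ξ (0, t)) 0 := by
      refine (AnalyticAt.comp (g := Ξ) (f := fun s => (s, t)) hΞt ?_).sub analyticAt_const
      fun_prop
    have h6 : 0 < meromorphicOrderAt (fun s => Ξ (s, t) - Ξ (0, t)) 0 := by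
      rw [← tendsto_zero_iff_meromorphicOrderAt_pos h5.meromorphicAt]
      have := h5.continuousAt.tendsto
      rw [sub_self] at this
      exact this.mono_left nhdsWithin_le_nhds
    have h7 : meromorphicOrderAt (fun s => s ^ l * h (s, t) -
        evalPuiseux (φ + Finsupp.single r (Ξ (0, t₀) * (ω ^ k)⁻¹)) p (ω * s)) 0 =
          (k : WithTop ℤ) + meromorphicOrderAt (fun s => Ξ (s, t) - Ξ (0, t)) 0 := by
      have h8 : meromorphicOrderAt (fun s : ℂ => s ^ k) 0 = k := by
        simpa using meromorphicOrderAt_const_mul_zpow one_ne_zero k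
      rw [← h8, ← meromorphicOrderAt_mul (by fun_prop) h5.meromorphicAt]
      refine meromorphicOrderAt_congr ?_
      filter_upwards [self_mem_nhdsWithin,
        ((tendsto_mk_left t).eventually hΞet).filter_mono nhdsWithin_le_nhds] with s hs hs'
      have h9 := hs' hs
      rw [h9, evalPuiseux_add, evalPuiseux_single, Pi.mul_apply, hct, mul_zpow, ← hk]
      field_simp [zpow_ne_zero k hω0]
      ring
    rw [h7] at h4
    revert h4 h6
    cases meromorphicOrderAt (fun s => Ξ (s, t) - Ξ (0, t)) 0 with
    | top => simp
    | coe n =>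
      intro h4 h6
      have h6' : 0 < n := by exact_mod_cast h6
      have h4' : k + n ≤ k := by exact_mod_cast h4
      omega
  -- `Ξ` is a coordinate
  have hD : AnalyticAt ℂ (fun z => fderiv ℂ Ξ z (0, 1)) (0, t₀) :=
    ((ContinuousLinearMap.apply ℂ ℂ ((0 : ℂ), (1 : ℂ))).analyticAt _).comp hΞ.fderiv
  have hD0 : fderiv ℂ Ξ (0, t₀) (0, 1) ≠ 0 := by
    -- Off the curve ∂Ξ/∂t has no zeros because (x, y) are coordinates of X. On the curve it is not
    -- identically zero because Ξ(0, t) is not constant.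
    refine ne_zero_of_frequently_ne_zero (D := fun z => fderiv ℂ Ξ z (0, 1)) hD ?_ ?_
    · filter_upwards [hW.eventually_nhds, hΞe.eventually_nhds, hΞ.eventually_analyticAt]
        with z h1 h2 h3 hz0
      refine hc.fderiv_ne_zero (K := K) (X := fun s => (s ^ p)⁻¹) (ψ := fun s => evalPuiseux φ p (ω * s))
        (g := fun s => s ^ k) h1.self_of_nhds.1 h3 ?_
      filter_upwards [h1, h2, continuousAt_fst.eventually_ne hz0] with z' h1' h2' h0'
      rw [← h2' h0', h1'.2 h0']
    · intro hcon
      refine hnc ?_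
      have h1 : ∀ᶠ t in 𝓝 t₀, HasDerivAt (fun t => Ξ (0, t)) 0 t := by
        filter_upwards [hcon, hΞt] with t ht1 ht2
        rw [not_not] at ht1
        have h2 := HasFDerivAt.comp_hasDerivAt (l := Ξ) t ht2.1.differentiableAt.hasFDerivAt
          ((hasDerivAt_const t (0 : ℂ)).prodMk (hasDerivAt_id t))
        rw [ht1] at h2
        exact h2
      obtain ⟨ε, hε, hball⟩ := Metric.eventually_nhds_iff_ball.1 h1
      filter_upwards [Metric.ball_mem_nhds t₀ hε] with t ht
      exact Metric.isOpen_ball.is_const_of_deriv_eq_zero (f := fun t => Ξ (0, t))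
        (convex_ball t₀ ε).isPreconnected
        (fun t ht => (hball t ht).differentiableAt.differentiableWithinAt)
        (fun t ht => (hball t ht).deriv) ht (Metric.mem_ball_self hε)
  have hωk : (ω ^ k)⁻¹ ≠ 0 := inv_ne_zero (zpow_ne_zero k hω0)
  -- The coordinates are τ = ω s and ξ = ω^(-k) Ξ: then τ^p = s^p, and ξ τ^k = s^k Ξ.
  obtain ⟨κ, hκ, hsub, hκe⟩ := hc.exists_trans (R := fun _ => ω)
    (T := fun z => (ω ^ k)⁻¹ * Ξ z) (W := {q | ((c q).1 ≠ 0 →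
      K.ι ![((c q).1 ^ p)⁻¹, (c q).1 ^ l * h (c q)] = c.symm (c q)) ∧ ((c q).1 ≠ 0 →
        (c q).1 ^ l * h (c q) = evalPuiseux φ p (ω * (c q).1) + (c q).1 ^ k * Ξ (c q))})
    analyticAt_const hω0 (by rw [hcχ]; exact analyticAt_const.mul hΞ)
    (by
      rw [hcχ, fderiv_const_mul hΞ.differentiableAt]
      exact mul_ne_zero hωk hD0)
    ((c.continuousAt hc.2.1).eventually (p := fun z : ℂ × ℂ => (z.1 ≠ 0 →
      K.ι ![(z.1 ^ p)⁻¹, z.1 ^ l * h z] = c.symm z) ∧ (z.1 ≠ 0 →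
        z.1 ^ l * h z = evalPuiseux φ p (ω * z.1) + z.1 ^ k * Ξ z)) (by
      rw [hcχ]
      exact (hW.mono fun z hz => hz.2).and hΞe))
  refine ⟨κ, hκ, fun q hq hq0 => ?_⟩
  obtain ⟨hqc, hq1, hq2⟩ := hsub hq
  rw [hκe q hq] at hq0 ⊢
  have hs0 : (c q).1 ≠ 0 := left_ne_zero_of_mul hq0
  refine ⟨_, (hq1 hs0).trans (c.left_inv hqc), ?_, ?_⟩
  · simp [mul_pow, hω]
  · simp only [Matrix.cons_val_one, Matrix.cons_val_fin_one]
    rw [hq2 hs0, mul_comm ω, mul_zpow, ← hk]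
    field_simp [zpow_ne_zero k hω0]

end Charts

end CurvesAtInfinity
end

/-! ### The image of C_ν and of its curvettes at [0 : 1 : 0]. -/

noncomputable section

namespace CurvesAtInfinity

open ReducedComplexSpace (HolAt)

/-! ### The degree of the generic Puiseux series -/

theorem coeff_genericSeries (φ : ℚ →₀ ℂ) (r e : ℚ) :
    (genericSeries φ r).coeff e = Polynomial.C (φ e) + if e = r then Polynomial.X else 0 := by
  classical
  rw [genericSeries, AddMonoidAlgebra.coeff_add, Finsupp.add_apply,
    AddMonoidAlgebra.coeff_single, Finsupp.single_apply]
  congr 1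
  · simp only [Finsupp.sum, AddMonoidAlgebra.coeff_sum, Finsupp.finsetSum_apply,
      AddMonoidAlgebra.coeff_single, Finsupp.single_apply, Finset.sum_ite_eq', Finsupp.mem_support_iff]
    by_cases h : φ e = 0 <;> simp [h]
  · simp only [eq_comm]

theorem IsDegree.le_of_mem_support {φ : ℚ →₀ ℂ} {r d e : ℚ} (hr : ∀ e ∈ φ.support, r < e)
    (hd : IsDegree (genericSeries φ r) d) (he : e ∈ φ.support) : e ≤ d := by
  refine hd.2 ?_
  rw [Set.mem_ofPred_eq, coeff_genericSeries, if_neg (hr e he).ne', add_zero]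
  simpa using he

theorem IsDegree.le {φ : ℚ →₀ ℂ} {r d : ℚ} (hr : ∀ e ∈ φ.support, r < e)
    (hd : IsDegree (genericSeries φ r) d) : r ≤ d := by
  have h : φ r = 0 := by
    by_contra h
    exact lt_irrefl r (hr r (Finsupp.mem_support_iff.2 h))
  refine hd.2 ?_
  rw [Set.mem_ofPred_eq, coeff_genericSeries, if_pos rfl, h]
  simp

theorem exists_isDegree_genericSeries {ν : RatFun → ℤ} {φ : ℚ →₀ ℂ} {r : ℚ}
    (hφ : IsGenericPuiseux ν φ r) :
    ∃ d, IsDegree (genericSeries φ r) d ∧ (ν ratY : ℚ) = (ν ratX : ℚ) * d := by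
  obtain ⟨d, hd, hd'⟩ := hφ.2 (MvPolynomial.X 1) (MvPolynomial.X_ne_zero 1)
  refine ⟨d, ?_, hd'⟩
  rw [substSeries, MvPolynomial.aeval_X] at hd
  exact hd

/-- Substituting into y gives the generic series itself, so ν(y) = ν(x) d with d its degree.
Dividing by ν(x) < 0 reverses the inequality. -/
theorem lt_iff_degree_lt_one {ν : RatFun → ℤ} {φ : ℚ →₀ ℂ} {r : ℚ} (hx : ν ratX < 0)
    (hφ : IsGenericPuiseux ν φ r) :
    ν ratX < ν ratY ↔ ∃ d : ℚ, IsDegree (genericSeries φ r) d ∧ d < 1 := by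
  obtain ⟨d, hd, hd'⟩ := exists_isDegree_genericSeries hφ
  have hx' : (ν ratX : ℚ) < 0 := by exact_mod_cast hx
  have h1 : ν ratX < ν ratY ↔ d < 1 := by
    rw [← Int.cast_lt (R := ℚ), hd']
    constructor <;> intro h <;> nlinarith
  rw [h1]
  exact ⟨fun h => ⟨d, hd, h⟩, fun ⟨d', h, h'⟩ => hd.unique h ▸ h'⟩

/-! ### The Puiseux series at `[0 : 1 : 0]` -/

theorem reversed_sum (φ : ℚ →₀ ℂ) (g : ℚ → ℂ → ℂ) :
    (reversed φ).sum g = φ.sum fun e a => g (1 - e) a :=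
  Finsupp.sum_mapDomain_index_inj sub_right_injective

/-- Since e ≤ 1 and p e is an integer, p (1 - e) is already a natural number: the floors in the
expansions round nothing. -/
theorem natFloor_cast {p : ℕ} {e : ℚ} (h : ∃ j : ℤ, (j : ℚ) = p * e) (he : e ≤ 1) :
    ((⌊(p : ℚ) * (1 - e)⌋₊ : ℕ) : ℚ) = p * (1 - e) := by
  obtain ⟨j, hj⟩ := h
  have h1 : (0 : ℚ) ≤ p * (1 - e) := mul_nonneg (by positivity) (by linarith)
  have h2 : (p : ℚ) * (1 - e) = ((p - j : ℤ) : ℚ) := by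
    push_cast
    rw [hj]
    ring
  rw [h2] at h1 ⊢
  obtain ⟨n, hn⟩ := Int.eq_ofNat_of_zero_le (by exact_mod_cast h1 : (0 : ℤ) ≤ p - j)
  rw [hn]
  simp

theorem natFloor_eq_expo {p : ℕ} {e : ℚ} (h : ∃ j : ℤ, (j : ℚ) = p * e) (he : e ≤ 1) :
    ((⌊(p : ℚ) * (1 - e)⌋₊ : ℕ) : ℤ) = expo p e + p := by
  have h1 := natFloor_cast h he
  have h2 := expo_cast h
  have h3 : (((⌊(p : ℚ) * (1 - e)⌋₊ : ℕ) : ℤ) : ℚ) = ((expo p e + p : ℤ) : ℚ) := by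
    push_cast
    rw [h1, h2]
    ring
  exact_mod_cast h3

/-- The function `v = y / x` in the parameters of the generic Puiseux series. -/
def imageV (φ : ℚ →₀ ℂ) (r : ℚ) (p : ℕ) (z : ℂ × ℂ) : ℂ :=
  ((reversed φ).sum fun e a => a * z.1 ^ ⌊(p : ℚ) * e⌋₊) + z.2 * z.1 ^ ⌊(p : ℚ) * (1 - r)⌋₊

theorem analyticAt_imageV (φ : ℚ →₀ ℂ) (r : ℚ) (p : ℕ) (z : ℂ × ℂ) :
    AnalyticAt ℂ (imageV φ r p) z := by
  have h : ∀ n : ℕ, AnalyticAt ℂ (fun z : ℂ × ℂ => z.1 ^ n) z := fun n => analyticAt_fst.pow n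
  exact (Finset.analyticAt_fun_sum _ fun e _ => analyticAt_const.mul (h _)).add
    (analyticAt_snd.mul (h _))

/-- The data of a generic Puiseux series of degree less than `1` with denominator `p`. -/
structure IsSmallPuiseux (φ : ℚ →₀ ℂ) (r : ℚ) (p : ℕ) : Prop where
  pos : 0 < p
  lt : ∀ e ∈ φ.support, r < e
  hasDenominator : HasDenominator φ p
  exists_int : ∃ j : ℤ, (j : ℚ) = p * r
  lt_one : ∀ e ∈ φ.support, e < 1
  r_lt_one : r < 1

variable {φ : ℚ →₀ ℂ} {r : ℚ} {p : ℕ}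

theorem IsSmallPuiseux.imageV_eq (h : IsSmallPuiseux φ r p) {z : ℂ × ℂ} (hz : z.1 ≠ 0) :
    imageV φ r p z = (evalPuiseux φ p z.1 + z.2 * z.1 ^ expo p r) * z.1 ^ p := by
  have key : ∀ e : ℚ, (∃ j : ℤ, (j : ℚ) = p * e) → e ≤ 1 →
      z.1 ^ ⌊(p : ℚ) * (1 - e)⌋₊ = z.1 ^ expo p e * z.1 ^ p := by
    intro e he he1
    rw [← zpow_natCast, natFloor_eq_expo he he1, zpow_add₀ hz, zpow_natCast]
  rw [imageV, reversed_sum, evalPuiseux, add_mul, key r h.exists_int h.r_lt_one.le]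
  simp only [Finsupp.sum, Finset.sum_mul]
  rw [Finset.sum_congr rfl fun e he => by
    rw [key e (h.hasDenominator e he) (h.lt_one e he).le, ← mul_assoc]]
  ring

/-- All exponents p (1 - e) and p (1 - r) are positive because the degree is less than 1. Here ν(y)
> ν(x) forces the center to be P. -/
theorem IsSmallPuiseux.imageV_zero (h : IsSmallPuiseux φ r p) (ξ : ℂ) : imageV φ r p (0, ξ) = 0 := by
  have key : ∀ e : ℚ, (∃ j : ℤ, (j : ℚ) = p * e) → e < 1 →
      (0 : ℂ) ^ ⌊(p : ℚ) * (1 - e)⌋₊ = 0 := by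
    intro e he he1
    refine zero_pow fun h0 => ?_
    have h1 := natFloor_cast he he1.le
    rw [h0, Nat.cast_zero] at h1
    have h2 : (0 : ℚ) < p * (1 - e) := mul_pos (by exact_mod_cast h.pos) (by linarith)
    linarith
  rw [imageV, reversed_sum, Finsupp.sum, key r h.exists_int h.r_lt_one, mul_zero, add_zero]
  exact Finset.sum_eq_zero fun e he => by
    rw [key e (h.hasDenominator e he) (h.lt_one e he), mul_zero]

/-! ### The images of curvettes -/

section Charts

variable {M : Type*} [TopologicalSpace M] [ReducedComplexSpace M] {K : Compactification M}
  {A : Set M} {χ : M} {κ : OpenPartialHomeomorph M (ℂ × ℂ)}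

theorem IsNormalChart.of_mem (hκ : IsNormalChart K A φ r p χ κ) {q : M} (hq : q ∈ A)
    (hqκ : q ∈ κ.source) : IsNormalChart K A φ r p q κ :=
  ⟨hκ.1.of_mem hq hqκ, hκ.2⟩

theorem IsNormalChart.eq_of_ι_eq (hκ : IsNormalChart K A φ r p χ κ) {q : M} (hq : q ∈ κ.source)
    (h0 : (κ q).1 ≠ 0) {w : Fin 2 → ℂ} (hw : K.ι w = q) :
    w 0 = ((κ q).1 ^ p)⁻¹ ∧ w 1 = evalPuiseux φ p (κ q).1 + (κ q).2 * (κ q).1 ^ expo p r := by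
  obtain ⟨w', hw', h⟩ := hκ.2 q hq h0
  rwa [K.isOpenEmbedding.injective (hw.trans hw'.symm)]

/-- The coordinates `(u, v)` at `[0 : 1 : 0]`, along a curve. -/
def imageCurve (φ : ℚ →₀ ℂ) (r : ℚ) (p : ℕ) (κ : M → ℂ × ℂ) (γ : ℂ → M) (z : ℂ) : Fin 2 → ℂ :=
  ![(κ (γ z)).1 ^ p, imageV φ r p (κ (γ z))]

theorem IsCurvette.tendsto {γ : ℂ → M} (hγ : IsCurvette A χ γ) : Tendsto γ (𝓝[≠] 0) (𝓝 χ) := by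
  obtain ⟨rfl, h, -⟩ := hγ
  exact h.tendsto.mono_left nhdsWithin_le_nhds

/-- A curvette does not meet the curve outside its base point. -/
theorem IsCurvette.eventually_fst_ne_zero {γ : ℂ → M} (hγ : IsCurvette A χ γ)
    (hκ : IsAdaptedChart A χ κ) : ∀ᶠ z in 𝓝[≠] (0 : ℂ), (κ (γ z)).1 ≠ 0 := by
  obtain ⟨han, hd⟩ := hγ.chart hκ
  have h1 : AnalyticAt ℂ (fun z => (κ (γ z)).1) 0 := analyticAt_fst.comp han
  have h2 := h1.differentiableAt.hasDerivAt.eventually_ne hd (c := 0)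
  exact h2

theorem IsCurvette.eventually_imageCurve (h : IsSmallPuiseux φ r p)
    (hκ : IsNormalChart K A φ r p χ κ) {γ : ℂ → M} (hγ : IsCurvette A χ γ) :
    ∀ᶠ z in 𝓝[≠] (0 : ℂ), ∃ w, K.ι w = γ z ∧ w 0 ≠ 0 ∧
      imageCurve φ r p κ γ z = ![1 / w 0, w 1 / w 0] := by
  have hlim := hγ.tendsto
  filter_upwards [hγ.eventually_fst_ne_zero hκ.1,
    hlim.eventually (κ.open_source.mem_nhds hκ.1.2.1)] with z h0 hz
  obtain ⟨w, hw, hw0, hw1⟩ := hκ.2 _ hz h0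
  refine ⟨w, hw, ?_, ?_⟩
  · rw [hw0]
    exact inv_ne_zero (pow_ne_zero _ h0)
  · rw [imageCurve, h.imageV_eq h0, hw0, hw1]
    simp

/-- For injectivity: away from z = 0, (u, v) determines (x, y), hence the point γ(z) of X, hence its
coordinate τ, which is injective along γ by transversality. The value at z = 0 is not repeated,
since u = 1/x ≠ 0 elsewhere. -/
theorem IsCurvette.isImageGerm (h : IsSmallPuiseux φ r p) (hκ : IsNormalChart K A φ r p χ κ)
    {γ : ℂ → M} (hγ : IsCurvette A χ γ) : IsImageGerm K γ (imageCurve φ r p κ γ) := by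
  obtain ⟨han, hd⟩ := hγ.chart hκ.1
  have hfst : AnalyticAt ℂ (fun z => (κ (γ z)).1) 0 := analyticAt_fst.comp han
  have h00 : (κ (γ 0)).1 = 0 := by rw [hγ.1, hκ.1.fst_eq_zero]
  refine ⟨?_, ?_, ?_, hγ.eventually_imageCurve h hκ⟩
  · rw [analyticAt_pi_iff]
    intro i
    fin_cases i
    · exact hfst.pow p
    · exact AnalyticAt.comp (g := imageV φ r p) (f := fun z => κ (γ z))
        (analyticAt_imageV φ r p _) han
  · have h1 : κ (γ 0) = (0, (κ (γ 0)).2) := Prod.ext h00 rfl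
    rw [imageCurve, h1, h.imageV_zero]
    ext i
    fin_cases i
    · simp [h.pos.ne']
    · rfl
  · obtain ⟨U, hU, hinj⟩ : ∃ U ∈ 𝓝 (0 : ℂ), Set.InjOn (fun z => (κ (γ z)).1) U :=
      ⟨_, (hfst.hasStrictDerivAt.hasStrictFDerivAt_equiv hd).eventually_left_inverse,
        fun z₁ hz₁ z₂ hz₂ heq =>
          (show _ = z₁ from hz₁).symm.trans ((congrArg _ heq).trans (show _ = z₂ from hz₂))⟩
    have h1 : ∀ᶠ z in 𝓝 (0 : ℂ), z ≠ 0 → ∃ w, K.ι w = γ z ∧ w 0 ≠ 0 ∧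
        imageCurve φ r p κ γ z = ![1 / w 0, w 1 / w 0] :=
      eventually_nhdsWithin_iff.1 (hγ.eventually_imageCurve h hκ)
    refine ⟨U ∩ _, Filter.inter_mem hU h1, ?_⟩
    have h2 : ∀ z : ℂ, z ≠ 0 → (∃ w, K.ι w = γ z ∧ w 0 ≠ 0 ∧
        imageCurve φ r p κ γ z = ![1 / w 0, w 1 / w 0]) →
        imageCurve φ r p κ γ z ≠ imageCurve φ r p κ γ 0 := by
      rintro z - ⟨w, -, hw0, hw⟩ heq
      have h3 := congrFun (hw.symm.trans heq) 0
      simp [imageCurve, h00, h.pos.ne', hw0] at h3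
    rintro z₁ ⟨hz₁, hw₁⟩ z₂ ⟨hz₂, hw₂⟩ heq
    by_cases h01 : z₁ = 0
    · by_cases h02 : z₂ = 0
      · rw [h01, h02]
      · rw [h01] at heq
        exact absurd heq.symm (h2 z₂ h02 (hw₂ h02))
    · by_cases h02 : z₂ = 0
      · rw [h02] at heq
        exact absurd heq (h2 z₁ h01 (hw₁ h01))
      · obtain ⟨w₁, hw₁, hw₁0, he₁⟩ := hw₁ h01
        obtain ⟨w₂, hw₂, hw₂0, he₂⟩ := hw₂ h02
        rw [he₁, he₂] at heq
        have e0 : w₁ 0 = w₂ 0 := by simpa using congrFun heq 0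
        have e1 : w₁ 1 = w₂ 1 := by
          have h3 := congrFun heq 1
          simp only [Matrix.cons_val_one, Matrix.cons_val_fin_one, e0] at h3
          exact (div_left_inj' hw₂0).1 h3
        have e2 : w₁ = w₂ := by
          ext i
          fin_cases i
          · exact e0
          · exact e1
        refine hinj hz₁ hz₂ ?_
        change (κ (γ z₁)).1 = (κ (γ z₂)).1
        rw [← hw₁, ← hw₂, e2]

/-- By transversality τ ∘ γ has a local inverse θ. In the parameter s = τ one has u = s^p and ξ =
ξ(χ) + s g(s), and the second summand produces exactly the higher order terms. -/
theorem IsCurvette.hasPuiseuxExpansion (h : IsSmallPuiseux φ r p)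
    (hκ : IsNormalChart K A φ r p χ κ) {γ : ℂ → M} (hγ : IsCurvette A χ γ) :
    HasPuiseuxExpansion (imageCurve φ r p κ γ) (reversed φ) (1 - r) (κ χ).2 := by
  obtain ⟨han, hd⟩ := hγ.chart hκ.1
  have hfst : AnalyticAt ℂ (fun z => (κ (γ z)).1) 0 := analyticAt_fst.comp han
  have h00 : (κ (γ 0)).1 = 0 := by rw [hγ.1, hκ.1.fst_eq_zero]
  set θ := hfst.hasStrictDerivAt.localInverse _ _ _ hd with hθ
  have hθan : AnalyticAt ℂ θ 0 := by
    have := hfst.analyticAt_localInverse hd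
    rwa [h00] at this
  have hθ0 : θ 0 = 0 := by
    have := (hfst.hasStrictDerivAt.hasStrictFDerivAt_equiv hd).localInverse_apply_image
    simp only [h00] at this
    exact this
  have hright : ∀ᶠ s in 𝓝 (0 : ℂ), (κ (γ (θ s))).1 = s := by
    have := (hfst.hasStrictDerivAt.hasStrictFDerivAt_equiv hd).eventually_right_inverse
    rwa [h00] at this
  have hθd : deriv θ 0 ≠ 0 := by
    intro h0
    have h1 : HasDerivAt (fun s => (κ (γ (θ s))).1) (deriv (fun z => (κ (γ z)).1) (θ 0) * deriv θ 0) 0 := by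
      refine HasDerivAt.comp (h₂ := fun z => (κ (γ z)).1) 0 ?_ hθan.differentiableAt.hasDerivAt
      rw [hθ0]
      exact hfst.differentiableAt.hasDerivAt
    rw [h0, mul_zero] at h1
    exact one_ne_zero ((hasDerivAt_id (0 : ℂ)).unique
      (h1.congr_of_eventuallyEq (hright.mono fun s hs => hs.symm)))
  have hξ : AnalyticAt ℂ (fun s => (κ (γ (θ s))).2) 0 := by
    refine AnalyticAt.comp (g := fun z => (κ (γ z)).2) (f := θ) ?_ hθan
    rw [hθ0]
    exact analyticAt_snd.comp han
  obtain ⟨g, hg, hge⟩ : ∃ g : ℂ → ℂ, AnalyticAt ℂ g 0 ∧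
      ∀ᶠ s in 𝓝 (0 : ℂ), (κ (γ (θ s))).2 = (κ χ).2 + s * g s := by
    have h1 : (κ (γ (θ 0))).2 = (κ χ).2 := by rw [hθ0, hγ.1]
    refine ⟨dslope (fun s => (κ (γ (θ s))).2) 0, ?_, Eventually.of_forall fun s => ?_⟩
    · obtain ⟨P, hP⟩ := hξ
      exact hP.has_fpower_series_dslope_fslope.analyticAt
    · have := sub_smul_dslope (fun s => (κ (γ (θ s))).2) 0 s
      simp only [sub_zero, smul_eq_mul, h1] at this
      rw [this]
      ring
  refine ⟨p, ⌊(p : ℚ) * (1 - r)⌋₊, θ, g, h.pos, natFloor_cast h.exists_int h.r_lt_one.le, ?_, hθan,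
    hθ0, hθd, hg, ?_⟩
  · intro e he
    classical
    rw [reversed, Finsupp.mapDomain_support_of_injective sub_right_injective, Finset.mem_image] at he
    obtain ⟨e, he, rfl⟩ := he
    exact ⟨_, natFloor_cast (h.hasDenominator e he) (h.lt_one e he).le⟩
  · filter_upwards [hright, hge] with s hs hgs
    refine ⟨by simp [imageCurve, hs], ?_⟩
    simp only [imageCurve, Matrix.cons_val_one, Matrix.cons_val_fin_one, imageV, hs, hgs]
    ring

theorem IsCurvette.imageHasExpansion (h : IsSmallPuiseux φ r p)
    (hκ : IsNormalChart K A φ r p χ κ) {γ : ℂ → M} (hγ : IsCurvette A χ γ) :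
    ImageHasExpansion K γ (reversed φ) (1 - r) (κ χ).2 :=
  ⟨_, hγ.isImageGerm h hκ, hγ.hasPuiseuxExpansion h hκ⟩

/-! ### The center -/

/-- In homogeneous coordinates [1 : x : y] = [u : 1 : v], and the right-hand side is holomorphic
across the curve. -/
theorem IsNormalChart.sigmaMapsTo (h : IsSmallPuiseux φ r p) (hκ : IsNormalChart K A φ r p χ κ)
    (hA : ∀ w, K.ι w ∉ A) : SigmaMapsTo K χ pointP := by
  have hval : (fun i => (![fun q => (κ q).1 ^ p, fun _ => 1, fun q => imageV φ r p (κ q)] :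
      Fin 3 → M → ℂ) i χ) = ![0, 1, 0] := by
    ext i
    fin_cases i
    · simp [hκ.1.fst_eq_zero, h.pos.ne']
    · rfl
    · change imageV φ r p (κ χ) = 0
      rw [hκ.1.eq_mk, h.imageV_zero]
  have hne : (![0, 1, 0] : Fin 3 → ℂ) ≠ 0 := fun h => by simpa using congrFun h 1
  refine ⟨![fun q => (κ q).1 ^ p, fun _ => 1, fun q => imageV φ r p (κ q)], by rwa [hval], ?_, ?_, ?_⟩
  · intro i
    fin_cases i
    · exact hκ.1.holAt_comp (G := fun z => z.1 ^ p) hκ.1.2.1 (analyticAt_fst.pow p)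
    · exact holAt_const 1 χ
    · exact hκ.1.holAt_comp hκ.1.2.1 (analyticAt_imageV φ r p _)
  · filter_upwards [κ.open_source.mem_nhds hκ.1.2.1] with q hq w hw
    have h0 : (κ q).1 ≠ 0 := fun h0 => hA w (hw ▸ (hκ.1.2.2.2 q hq).2 h0)
    obtain ⟨hw0, hw1⟩ := hκ.eq_of_ι_eq hq h0 hw
    change 1 = w 0 * (κ q).1 ^ p ∧ imageV φ r p (κ q) = w 1 * (κ q).1 ^ p
    rw [hw0, hw1, h.imageV_eq h0]
    exact ⟨(inv_mul_cancel₀ (pow_ne_zero _ h0)).symm, rfl⟩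
  · simp only [pointP, hval]

/-- Any holomorphic lift of σ satisfies f₀ = u f₁ and f₂ = v f₁ on X. Letting a vertical curvette
run into χ, where u and v tend to 0, gives the claim. -/
theorem IsNormalChart.eq_zero_of_sigma (h : IsSmallPuiseux φ r p)
    (hκ : IsNormalChart K A φ r p χ κ) {f : Fin 3 → M → ℂ} (hf : ∀ i, HolAt (f i) χ)
    (hfe : ∀ᶠ q in 𝓝 χ, ∀ w, K.ι w = q → f 1 q = w 0 * f 0 q ∧ f 2 q = w 1 * f 0 q) :
    f 0 χ = 0 ∧ f 2 χ = 0 := by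
  have hγ := hκ.1.isCurvette
  have hlim : Tendsto (fun z => κ.symm (z, (κ χ).2)) (𝓝[≠] 0) (𝓝 χ) := hγ.tendsto
  have hev : ∀ᶠ z in 𝓝[≠] (0 : ℂ), f 0 (κ.symm (z, (κ χ).2)) =
      f 1 (κ.symm (z, (κ χ).2)) * (κ (κ.symm (z, (κ χ).2))).1 ^ p ∧
      f 2 (κ.symm (z, (κ χ).2)) =
        f 1 (κ.symm (z, (κ χ).2)) * imageV φ r p (κ (κ.symm (z, (κ χ).2))) := by
    filter_upwards [hγ.eventually_fst_ne_zero hκ.1, hlim.eventually hfe,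
      hlim.eventually (κ.open_source.mem_nhds hκ.1.2.1)] with z h0 hz hzs
    obtain ⟨w, hw, hw0, hw1⟩ := hκ.2 _ hzs h0
    obtain ⟨e1, e2⟩ := hz w hw
    have hp0 := pow_ne_zero p h0
    rw [h.imageV_eq h0, ← hw1, e1, e2, hw0]
    constructor <;> field_simp
  have hf' : ∀ i, Tendsto (fun z => f i (κ.symm (z, (κ χ).2))) (𝓝[≠] 0) (𝓝 (f i χ)) := fun i =>
    (HolAt.continuousAt (hf i)).tendsto.comp hlim
  have hκ' : Tendsto (fun z => κ (κ.symm (z, (κ χ).2))) (𝓝[≠] 0) (𝓝 (κ χ)) :=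
    (κ.continuousAt hκ.1.2.1).tendsto.comp hlim
  have h1 : Tendsto (fun z => (κ (κ.symm (z, (κ χ).2))).1 ^ p) (𝓝[≠] 0) (𝓝 0) := by
    have := (continuousAt_fst.tendsto.comp hκ').pow p
    rwa [hκ.1.fst_eq_zero, zero_pow h.pos.ne'] at this
  have h2 : Tendsto (fun z => imageV φ r p (κ (κ.symm (z, (κ χ).2)))) (𝓝[≠] 0) (𝓝 0) := by
    have := (analyticAt_imageV φ r p (κ χ)).continuousAt.tendsto.comp hκ'
    have h3 : imageV φ r p (κ χ) = 0 := by rw [hκ.1.eq_mk, h.imageV_zero]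
    rwa [h3] at this
  constructor
  · refine tendsto_nhds_unique (hf' 0) ?_
    have := (hf' 1).mul h1
    rw [mul_zero] at this
    exact this.congr' (hev.mono fun z hz => hz.1.symm)
  · refine tendsto_nhds_unique (hf' 2) ?_
    have := (hf' 1).mul h2
    rw [mul_zero] at this
    exact this.congr' (hev.mono fun z hz => hz.2.symm)

/-- The map σ may also be defined at exceptional points. There a lift still has vanishing outer
components by continuity, because they vanish at nearby unexceptional points of the curve. -/
theorem center_eq [T2Space M] (hA : IsCurveAtInfinity K A) (h : IsSmallPuiseux φ r p) {F : Set M}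
    (hF : F.Finite) (hchart : ∀ χ ∈ A \ F, ∃ κ, IsNormalChart K A φ r p χ κ) :
    center K A = {pointP} := by
  refine Set.Subset.antisymm ?_ ?_
  · rintro P ⟨χ, hχ, f, hf0, hf, hfe, rfl⟩
    have hfreq : ∃ᶠ q in 𝓝 χ, f 0 q = 0 ∧ f 2 q = 0 := by
      refine ((hA.frequently_mem_diff hχ hF).and_eventually ((eventually_all.2 fun i =>
        HolAt.eventually (hf i)).and hfe.eventually_nhds)).mono ?_
      rintro q ⟨hq, hqf, hqe⟩
      obtain ⟨κ, hκ⟩ := hchart q hq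
      exact hκ.eq_zero_of_sigma h hqf hqe
    have hzero : ∀ i, (∃ᶠ q in 𝓝 χ, f i q = 0) → f i χ = 0 := by
      intro i hi
      by_contra h0
      exact hi ((HolAt.continuousAt (hf i)).eventually_ne h0)
    have e0 := hzero 0 (hfreq.mono fun q hq => hq.1)
    have e2 := hzero 2 (hfreq.mono fun q hq => hq.2)
    rw [Set.mem_singleton_iff, pointP, Projectivization.mk_eq_mk_iff']
    refine ⟨f 1 χ, ?_⟩
    ext i
    fin_cases i
    · simp [e0]
    · simp
    · simp [e2]
  · rintro _ rfl
    obtain ⟨χ, hχ⟩ := (hA.2.sdiff hF).nonempty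
    obtain ⟨κ, hκ⟩ := hchart χ hχ
    exact ⟨χ, hχ.1, hκ.sigmaMapsTo h fun w => hA.notMem⟩

end Charts

end CurvesAtInfinity
end

/-! ### Conjugate parameters, and finiteness of the set of points with a given expansion. -/

noncomputable section

namespace CurvesAtInfinity

open ReducedComplexSpace (HolAt)

/-! ### Conjugate parameters -/

/-- If τ - ω s vanished identically for none of the finitely many ω, all these differences would be
non-zero near 0, yet τ(s)/s is always a p-th root of unity. -/
theorem exists_eq_mul_of_pow_eq {p : ℕ} (hp : 0 < p) {τ : ℂ → ℂ} (hτ : AnalyticAt ℂ τ 0)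
    (he : ∀ᶠ s in 𝓝[≠] (0 : ℂ), τ s ^ p = s ^ p) :
    ∃ ω : ℂ, ω ^ p = 1 ∧ ∀ᶠ s in 𝓝[≠] (0 : ℂ), τ s = ω * s := by
  by_contra! hcon
  have h1 : ∀ ω ∈ {ω : ℂ | ω ^ p = 1}, ∀ᶠ s in 𝓝[≠] (0 : ℂ), τ s - ω * s ≠ 0 := by
    intro ω hω
    refine AnalyticAt.eventually_eq_zero_or_eventually_ne_zero (f := fun s => τ s - ω * s)
      (hτ.sub (by fun_prop)) |>.resolve_left fun h0 => ?_
    refine hcon ω hω ?_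
    filter_upwards [h0.filter_mono nhdsWithin_le_nhds] with s hs
    exact fun hne => hne (sub_eq_zero.1 hs)
  obtain ⟨s, hs, hsp, hs0⟩ := (((finite_roots_of_unity hp).eventually_all.2 h1).and
    (he.and self_mem_nhdsWithin)).exists
  have hs0 : s ≠ 0 := hs0
  refine hs (τ s / s) ?_ ?_
  · change (τ s / s) ^ p = 1
    rw [div_pow, hsp, div_self (pow_ne_zero _ hs0)]
  · rw [div_mul_cancel₀ _ hs0, sub_self]

variable {φ : ℚ →₀ ℂ} {r : ℚ} {p : ℕ}

theorem expo_lt_expo {N : ℕ} (hN : 0 < N) {e e' : ℚ} (he : ∃ j : ℤ, (j : ℚ) = N * e)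
    (he' : ∃ j : ℤ, (j : ℚ) = N * e') (h : e' < e) : expo N e < expo N e' := by
  rw [← Int.cast_lt (R := ℚ), expo_cast he, expo_cast he', neg_lt_neg_iff]
  exact mul_lt_mul_of_pos_left h (by exact_mod_cast hN)

/-- If two generic Puiseux series differ by the substitution `s ↦ ω s`, then `ω` fixes `φ`, and
the generic coefficients agree up to a power of `ω`. -/
theorem IsSmallPuiseux.eq_of_conjugate (h : IsSmallPuiseux φ r p) {ω : ℂ} {a b : ℂ → ℂ}
    (ha : AnalyticAt ℂ a 0) (hb : AnalyticAt ℂ b 0)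
    (he : ∀ᶠ s in 𝓝[≠] (0 : ℂ), evalPuiseux φ p (ω * s) + a s * (ω * s) ^ expo p r =
      evalPuiseux φ p s + b s * s ^ expo p r) :
    (∀ s, evalPuiseux φ p (ω * s) = evalPuiseux φ p s) ∧ a 0 * ω ^ expo p r = b 0 := by
  set k := expo p r with hk
  let g : ℂ → ℂ := fun s => b s - a s * ω ^ k
  have hg : AnalyticAt ℂ g 0 := hb.sub (ha.mul analyticAt_const)
  have hdiff : ∀ s, evalPuiseux φ p (ω * s) - evalPuiseux φ p s =
      ∑ e ∈ φ.support, (φ e * (ω ^ expo p e - 1)) * s ^ expo p e := by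
    intro s
    simp only [evalPuiseux_eq_sum subset_rfl, ← Finset.sum_sub_distrib, mul_zpow]
    exact Finset.sum_congr rfl fun e _ => by ring
  have hgs : ∀ᶠ s in 𝓝[≠] (0 : ℂ), (∑ e ∈ φ.support, (φ e * (ω ^ expo p e - 1)) * s ^ expo p e) =
      s ^ k * g s := by
    filter_upwards [he] with s hs
    rw [← hdiff, mul_zpow] at *
    simp only [g]
    linear_combination hs
  have hord : (k : WithTop ℤ) ≤ meromorphicOrderAt (fun s : ℂ => ∑ e ∈ φ.support,
      (φ e * (ω ^ expo p e - 1)) * s ^ expo p e) 0 := by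
    have h8 : meromorphicOrderAt (fun s : ℂ => s ^ k) 0 = k := by
      simpa using meromorphicOrderAt_const_mul_zpow one_ne_zero k
    have h9 : meromorphicOrderAt ((fun s : ℂ => s ^ k) * g) 0 = _ :=
      meromorphicOrderAt_mul (by fun_prop) hg.meromorphicAt
    rw [meromorphicOrderAt_congr (hgs.mono fun s hs => hs :
      _ =ᶠ[𝓝[≠] 0] (fun s : ℂ => s ^ k) * g), h9, h8]
    exact le_add_of_nonneg_right hg.meromorphicOrderAt_nonneg
  -- The difference of the two copies of φ is divisible by s^k, while all its possible exponents are
  -- smaller than k. So it vanishes term by term.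
  have hzero : ∀ e ∈ φ.support, φ e * (ω ^ expo p e - 1) = 0 := by
    intro e he
    by_contra h0
    have h1 := hord.trans (meromorphicOrderAt_sum_zpow_le
      (expo_injOn h.pos fun e he => h.hasDenominator e he) he h0)
    have h2 := expo_lt_expo h.pos (h.hasDenominator e he) h.exists_int (h.lt e he)
    have h3 : k ≤ expo p e := by exact_mod_cast h1
    omega
  have hsum : ∀ s : ℂ, (∑ e ∈ φ.support, (φ e * (ω ^ expo p e - 1)) * s ^ expo p e) = 0 := fun s =>
    Finset.sum_eq_zero fun e he => by rw [hzero e he, zero_mul]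
  refine ⟨fun s => sub_eq_zero.1 ((hdiff s).trans (hsum s)), ?_⟩
  have hg0 : ∀ᶠ s in 𝓝[≠] (0 : ℂ), g s = 0 := by
    filter_upwards [hgs, self_mem_nhdsWithin] with s hs hs0
    rw [hsum, eq_comm, mul_eq_zero] at hs
    exact hs.resolve_left (zpow_ne_zero k hs0)
  have hlim : Tendsto g (𝓝[≠] 0) (𝓝 (g 0)) := hg.continuousAt.tendsto.mono_left nhdsWithin_le_nhds
  have : g 0 = 0 := tendsto_nhds_unique hlim
    (tendsto_const_nhds.congr' (hg0.mono fun s hs => hs.symm))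
  exact (sub_eq_zero.1 this).symm

section Charts

variable {M : Type*} [TopologicalSpace M] [ReducedComplexSpace M] {K : Compactification M}
  {A : Set M} {χ : M} {κ : OpenPartialHomeomorph M (ℂ × ℂ)}

/-- The value of the generic coefficient in a normal chart is determined, up to conjugation, by a
curvette parametrized as in the Puiseux series. -/
theorem IsNormalChart.exists_conjugate (h : IsSmallPuiseux φ r p)
    (hκ : IsNormalChart K A φ r p χ κ) {η : ℂ → M} (hη : IsCurvette A χ η) {b : ℂ → ℂ}
    (hb : AnalyticAt ℂ b 0) (he : ∀ᶠ s in 𝓝[≠] (0 : ℂ), ∃ w, K.ι w = η s ∧ w 0 = (s ^ p)⁻¹ ∧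
      w 1 = evalPuiseux φ p s + b s * s ^ expo p r) :
    ∃ ω : ℂ, ω ^ p = 1 ∧ (∀ s, evalPuiseux φ p (ω * s) = evalPuiseux φ p s) ∧
      (κ χ).2 * ω ^ expo p r = b 0 := by
  obtain ⟨han, -⟩ := hη.chart hκ.1
  have hfst : AnalyticAt ℂ (fun z => (κ (η z)).1) 0 := analyticAt_fst.comp han
  have hsnd : AnalyticAt ℂ (fun z => (κ (η z)).2) 0 := analyticAt_snd.comp han
  have hev : ∀ᶠ s in 𝓝[≠] (0 : ℂ), (κ (η s)).1 ^ p = s ^ p ∧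
      evalPuiseux φ p (κ (η s)).1 + (κ (η s)).2 * (κ (η s)).1 ^ expo p r =
        evalPuiseux φ p s + b s * s ^ expo p r := by
    filter_upwards [he, hη.eventually_fst_ne_zero hκ.1,
      hη.tendsto.eventually (κ.open_source.mem_nhds hκ.1.2.1)] with s hs h0 hsource
    obtain ⟨w, hw, hw0, hw1⟩ := hs
    obtain ⟨hw0', hw1'⟩ := hκ.eq_of_ι_eq hsource h0 hw
    exact ⟨inv_injective (hw0'.symm.trans hw0), hw1'.symm.trans hw1⟩
  obtain ⟨ω, hω, hωe⟩ := exists_eq_mul_of_pow_eq h.pos hfst (hev.mono fun s hs => hs.1)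
  have h1 := h.eq_of_conjugate (ω := ω) hsnd hb (by
    filter_upwards [hev, hωe] with s hs hs'
    rw [← hs']
    exact hs.2)
  rw [hη.1] at h1
  exact ⟨ω, hω, h1⟩

theorem IsNormalChart.eventually_symm (hκ : IsNormalChart K A φ r p χ κ) :
    ∀ᶠ s in 𝓝[≠] (0 : ℂ), K.ι ![(s ^ p)⁻¹, evalPuiseux φ p s + (κ χ).2 * s ^ expo p r] =
      κ.symm (s, (κ χ).2) := by
  have htar : ∀ᶠ z in 𝓝 ((0 : ℂ), (κ χ).2), z ∈ κ.target := by
    rw [← hκ.1.eq_mk]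
    exact κ.open_target.mem_nhds (κ.map_source hκ.1.2.1)
  filter_upwards [((tendsto_mk_left (κ χ).2).eventually htar).filter_mono nhdsWithin_le_nhds,
    self_mem_nhdsWithin] with s hs hs0
  have h1 := κ.right_inv hs
  obtain ⟨w, hw, hw0, hw1⟩ := hκ.2 _ (κ.map_target hs) (by rw [h1]; exact hs0)
  rw [← hw]
  congr 1
  rw [h1] at hw0 hw1
  ext i
  fin_cases i
  · exact hw0.symm
  · exact hw1.symm

/-- The curve on the left depends on the chart only through the coefficient ξ(χ). As limits are
unique, the coefficient determines the point. -/
theorem IsNormalChart.tendsto (hκ : IsNormalChart K A φ r p χ κ) :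
    Tendsto (fun s => K.ι ![(s ^ p)⁻¹, evalPuiseux φ p s + (κ χ).2 * s ^ expo p r]) (𝓝[≠] 0)
      (𝓝 χ) :=
  hκ.1.isCurvette.tendsto.congr' (hκ.eventually_symm.mono fun _ hs => hs.symm)

/-- A normal chart is determined by its generic coefficient up to conjugation. -/
theorem IsNormalChart.exists_conjugate_chart (h : IsSmallPuiseux φ r p)
    {κ' : OpenPartialHomeomorph M (ℂ × ℂ)} (hκ : IsNormalChart K A φ r p χ κ)
    (hκ' : IsNormalChart K A φ r p χ κ') :
    ∃ ω : ℂ, ω ^ p = 1 ∧ (∀ s, evalPuiseux φ p (ω * s) = evalPuiseux φ p s) ∧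
      (κ χ).2 * ω ^ expo p r = (κ' χ).2 := by
  refine hκ.exists_conjugate h hκ'.1.isCurvette (b := fun _ => (κ' χ).2) analyticAt_const ?_
  filter_upwards [hκ'.eventually_symm] with s hs
  exact ⟨_, hs, rfl, rfl⟩

/-- Replacing τ by ω⁻¹ τ changes neither x nor φ(x) and compensates for the new coefficient. The
coefficients belonging to a point are thus closed under multiplication by ω^k for these ω. -/
theorem IsNormalChart.exists_rotate (h : IsSmallPuiseux φ r p) (hκ : IsNormalChart K A φ r p χ κ)
    {ω : ℂ} (hω : ω ^ p = 1) (hfix : ∀ s, evalPuiseux φ p (ω * s) = evalPuiseux φ p s) :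
    ∃ κ', IsNormalChart K A φ r p χ κ' ∧ (κ' χ).2 = (κ χ).2 * ω ^ expo p r := by
  have hω0 : ω ≠ 0 := by
    rintro rfl
    simp [zero_pow h.pos.ne'] at hω
  obtain ⟨κ', hκ', hsub, he⟩ := hκ.1.exists_trans (R := fun _ => ω⁻¹)
    (T := fun z => ω ^ expo p r * z.2) analyticAt_const (inv_ne_zero hω0)
    (analyticAt_const.mul analyticAt_snd) (by
      rw [fderiv_const_mul differentiableAt_snd, fderiv_snd]
      simpa using zpow_ne_zero _ hω0) univ_mem
  refine ⟨κ', ⟨hκ', fun q hq hq0 => ?_⟩, ?_⟩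
  · rw [he q hq] at hq0 ⊢
    have h0 : (κ q).1 ≠ 0 := left_ne_zero_of_mul hq0
    obtain ⟨w, hw, hw0, hw1⟩ := hκ.2 q (hsub hq).1 h0
    refine ⟨w, hw, ?_, ?_⟩
    · rw [hw0]
      simp [mul_pow, inv_pow, hω]
    · rw [hw1]
      simp only
      rw [← hfix ((κ q).1 * ω⁻¹), mul_zpow, inv_zpow]
      have h1 : ω * ((κ q).1 * ω⁻¹) = (κ q).1 := by field_simp
      have h2 := zpow_ne_zero (expo p r) hω0
      rw [h1]
      field_simp
  · rw [he χ hκ'.2.1]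
    exact mul_comm _ _

/-! ### The expansion determines the point -/

theorem IsCurvette.comp {γ : ℂ → M} {θ : ℂ → ℂ} (hγ : IsCurvette A χ γ) (hθ : AnalyticAt ℂ θ 0)
    (hθ0 : θ 0 = 0) (hθd : deriv θ 0 ≠ 0) : IsCurvette A χ fun s => γ (θ s) := by
  obtain ⟨hγ0, hγc, c, hc, han, hd⟩ := hγ
  rw [← hθ0] at hγc han
  refine ⟨by simp only [hθ0, hγ0], ContinuousAt.comp (g := γ) hγc hθ.continuousAt, c, hc,
    AnalyticAt.comp (g := fun z => c (γ z)) han hθ, ?_⟩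
  have h1 : HasDerivAt (fun z => (c (γ z)).1) (deriv (fun z => (c (γ z)).1) (θ 0)) (θ 0) :=
    (analyticAt_fst.comp han).differentiableAt.hasDerivAt
  have h2 := HasDerivAt.comp (h₂ := fun z => (c (γ z)).1) 0 h1 hθ.differentiableAt.hasDerivAt
  have h3 : deriv (fun s => (c (γ (θ s))).1) 0 = _ := h2.deriv
  rw [h3, hθ0]
  exact mul_ne_zero hd hθd

theorem eq_of_pow_eq_pow {τ : ℂ → ℂ} {p n : ℕ} (hτ : AnalyticAt ℂ τ 0) (hτ0 : τ 0 = 0)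
    (hτd : deriv τ 0 ≠ 0) (he : ∀ᶠ s in 𝓝[≠] (0 : ℂ), τ s ^ p = s ^ n) (hn : 0 < n) (hp : 0 < p) :
    n = p := by
  have h1 : analyticOrderAt τ 0 = 1 := by
    have h0 := hτ.analyticOrderAt_sub_eq_one_of_deriv_ne_zero hτd
    simpa [hτ0] using h0
  have h2 : τ ^ p =ᶠ[𝓝 0] fun s => s ^ n := by
    have := eventually_nhdsWithin_iff.1 he
    filter_upwards [this] with s hs
    by_cases h0 : s = 0
    · simp [h0, hτ0, hn.ne', hp.ne']
    · exact hs h0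
  have h3 : analyticOrderAt (fun s : ℂ => s ^ n) 0 = n := by
    rw [AnalyticAt.analyticOrderAt_eq_natCast (by fun_prop)]
    exact ⟨fun _ => 1, analyticAt_const, one_ne_zero, Eventually.of_forall fun z => by simp⟩
  have h4 := analyticOrderAt_congr h2
  rw [analyticOrderAt_pow hτ, h1, h3] at h4
  have h5 : (p : ℕ∞) = n := by simpa using h4
  exact_mod_cast h5.symm

/-- A curvette whose image has a given expansion can be parametrized as in the Puiseux series. -/
theorem ImageHasExpansion.exists_curvette (h : IsSmallPuiseux φ r p)
    (hκ : IsNormalChart K A φ r p χ κ) {γ : ℂ → M} (hγ : IsCurvette A χ γ) {c : ℂ}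
    (hc : ImageHasExpansion K γ (reversed φ) (1 - r) c) :
    ∃ (η : ℂ → M) (b : ℂ → ℂ), IsCurvette A χ η ∧ AnalyticAt ℂ b 0 ∧ b 0 = c ∧
      ∀ᶠ s in 𝓝[≠] (0 : ℂ), ∃ w, K.ι w = η s ∧ w 0 = (s ^ p)⁻¹ ∧
        w 1 = evalPuiseux φ p s + b s * s ^ expo p r := by
  obtain ⟨δ, ⟨-, -, -, hδ⟩, n, k, θ, g, hn, hk, -, hθ, hθ0, hθd, hg, he⟩ := hc
  have hη := hγ.comp hθ hθ0 hθd
  have hθne : Tendsto θ (𝓝[≠] 0) (𝓝[≠] 0) := by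
    refine tendsto_nhdsWithin_iff.2 ⟨?_, ?_⟩
    · have := hθ.continuousAt.tendsto
      rw [hθ0] at this
      exact this.mono_left nhdsWithin_le_nhds
    · exact hθ.differentiableAt.hasDerivAt.eventually_ne hθd
  have he' := he.filter_mono (nhdsWithin_le_nhds (s := {0}ᶜ))
  obtain ⟨han, hd⟩ := hη.chart hκ.1
  -- The ramification index in the expansion is arbitrary a priori, but u = τ^p has order exactly p
  -- along a curvette.
  have hnp : n = p := by
    refine eq_of_pow_eq_pow (τ := fun s => (κ (γ (θ s))).1) (analyticAt_fst.comp han)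
      (by simp only [hη.1, hκ.1.fst_eq_zero]) hd ?_ hn h.pos
    filter_upwards [hθne.eventually hδ, he', hη.eventually_fst_ne_zero hκ.1,
      hη.tendsto.eventually (κ.open_source.mem_nhds hκ.1.2.1)] with s ⟨w, hw, hw0, hδw⟩ hs h0 hsource
    rw [← hs.1, hδw, Matrix.cons_val_zero, (hκ.eq_of_ι_eq hsource h0 hw).1]
    simp
  subst hnp
  refine ⟨_, fun s => c + s * g s, hη, analyticAt_const.add (analyticAt_id.mul hg), by simp, ?_⟩
  filter_upwards [hθne.eventually hδ, he', self_mem_nhdsWithin] with s ⟨w, hw, hw0, hδw⟩ hs hs0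
  have hs0 : s ≠ 0 := hs0
  rw [hδw] at hs
  simp only [Matrix.cons_val_zero, Matrix.cons_val_one, Matrix.cons_val_fin_one] at hs
  have hw0' : w 0 = (s ^ n)⁻¹ := by rw [← hs.1, one_div, inv_inv]
  refine ⟨w, hw, hw0', ?_⟩
  have hkk : k = ⌊(n : ℚ) * (1 - r)⌋₊ := by
    have := hk.trans (natFloor_cast h.exists_int h.r_lt_one.le).symm
    exact_mod_cast this
  have h1 : w 1 / w 0 = imageV φ r n (s, c + s * g s) := by
    rw [hs.2, imageV, ← hkk]
    ring
  rw [h.imageV_eq hs0, hw0', div_inv_eq_mul] at h1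
  exact mul_right_cancel₀ (pow_ne_zero n hs0) h1

/-- An expansion with coefficient c forces ξ(χ) = c ω^(-k) for some p-th root of unity ω. Each of
these finitely many values belongs to at most one point. -/
theorem finite_setOf_imageHasExpansion [T2Space M] (h : IsSmallPuiseux φ r p) {S : Set M}
    (hchart : ∀ χ ∈ S, ∃ κ, IsNormalChart K A φ r p χ κ) (c : ℂ) :
    {χ ∈ S | ∃ γ, IsCurvette A χ γ ∧ ImageHasExpansion K γ (reversed φ) (1 - r) c}.Finite := by
  refine ((finite_roots_of_unity h.pos).biUnion (t := fun ω => {χ : M | Tendsto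
    (fun s => K.ι ![(s ^ p)⁻¹, evalPuiseux φ p s + c * (ω ^ expo p r)⁻¹ * s ^ expo p r]) (𝓝[≠] 0)
      (𝓝 χ)}) fun ω _ => Set.Subsingleton.finite fun χ hχ χ' hχ' =>
        tendsto_nhds_unique hχ hχ').subset ?_
  rintro χ ⟨hχ, γ, hγ, hexp⟩
  obtain ⟨κ, hκ⟩ := hchart χ hχ
  obtain ⟨η, b, hη, hb, rfl, he⟩ := hexp.exists_curvette h hκ hγ
  obtain ⟨ω, hω, -, hωe⟩ := hκ.exists_conjugate h hη hb he
  have hω0 : ω ≠ 0 := by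
    rintro rfl
    simp [zero_pow h.pos.ne'] at hω
  refine Set.mem_biUnion (x := ω) hω ?_
  rw [Set.mem_ofPred_eq, ← hωe, mul_inv_cancel_right₀ (zpow_ne_zero _ hω0)]
  exact hκ.tendsto

end Charts

end CurvesAtInfinity
end

/-! ### The generic coefficient omits only finitely many values. -/

noncomputable section

namespace CurvesAtInfinity

open ReducedComplexSpace (HolAt)

section Values

variable {M : Type*} [TopologicalSpace M] [ReducedComplexSpace M]

/-! ### Families of points degenerating to a finite set -/

/-- Holomorphic functions near a finite set, with no other common zeros. -/
theorem exists_holomorphic_separating [T2Space M] {F : Set M} (hF : F.Finite) :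
    ∃ (I : Type) (_ : Fintype I) (O : Set M) (Θ : M → I → ℂ), IsOpen O ∧ F ⊆ O ∧
      (∀ i, ∀ q ∈ O, HolAt (fun q => Θ q i) q) ∧ ∀ q ∈ O, Θ q = 0 ↔ q ∈ F := by
  classical
  induction F, hF using Set.Finite.induction_on with
  | empty => exact ⟨Empty, inferInstance, ∅, fun _ => Empty.elim, isOpen_empty, subset_rfl, by simp, by simp⟩
  | @insert x F hx hF ih =>
    obtain ⟨I, _, O, Θ, hO, hFO, hΘ, hΘ0⟩ := ih
    obtain ⟨n, U, e, hU, hxU, -, hinj, hhol, -⟩ := exists_local_embedding x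
    obtain ⟨U₁, O₁, hU₁, hO₁, hxU₁, hFO₁, hdisj⟩ :=
      SeparatedNhds.of_isCompact_isCompact isCompact_singleton hF.isCompact
        (Set.disjoint_singleton_left.2 hx)
    rw [Set.singleton_subset_iff] at hxU₁
    have hnot : ∀ q ∈ O₁, q ∉ U₁ := fun q hq hq' => Set.disjoint_left.1 hdisj hq' hq
    -- On disjoint neighbourhoods, one block consists of centered embedding coordinates at x and the
    -- other of the earlier functions. Each block is extended by zero to the other neighbourhood.
    let Θ' : M → Fin n ⊕ I → ℂ := fun q =>
      Sum.elim (fun i => if q ∈ U₁ then e q i - e x i else 0) fun i => if q ∈ U₁ then 0 else Θ q i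
    refine ⟨Fin n ⊕ I, inferInstance, (U ∩ U₁) ∪ (O ∩ O₁), Θ', (hU.inter hU₁).union (hO.inter hO₁),
      ?_, ?_, ?_⟩
    · rw [Set.insert_subset_iff]
      exact ⟨Or.inl ⟨hxU, hxU₁⟩, fun q hq => Or.inr ⟨hFO hq, hFO₁ hq⟩⟩
    · rintro i q (⟨hq, hq₁⟩ | ⟨hq, hq₁⟩)
      · rcases i with i | i
        · refine HolAt.congr (holAt_add (hhol i q hq) (holAt_const (-(e x i)) q)) ?_
          filter_upwards [hU₁.mem_nhds hq₁] with q' hq'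
          simp [Θ', hq', sub_eq_add_neg]
        · refine HolAt.congr (holAt_const 0 q) ?_
          filter_upwards [hU₁.mem_nhds hq₁] with q' hq'
          simp [Θ', hq']
      · rcases i with i | i
        · refine HolAt.congr (holAt_const 0 q) ?_
          filter_upwards [hO₁.mem_nhds hq₁] with q' hq'
          simp [Θ', hnot q' hq']
        · refine HolAt.congr (hΘ i q hq) ?_
          filter_upwards [hO₁.mem_nhds hq₁] with q' hq'
          simp [Θ', hnot q' hq']
    · rintro q (⟨hq, hq₁⟩ | ⟨hq, hq₁⟩)
      · have hqF : q ∉ F := fun h => hnot q (hFO₁ h) hq₁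
        rw [Set.mem_insert_iff, or_iff_left hqF]
        constructor
        · intro h0
          refine hinj hq hxU (funext fun i => sub_eq_zero.1 ?_)
          have := congrFun h0 (Sum.inl i)
          simpa [Θ', hq₁] using this
        · rintro rfl
          ext (i | i) <;> simp [Θ', hq₁]
      · have hqx : q ≠ x := fun h => hnot q hq₁ (h ▸ hxU₁)
        rw [Set.mem_insert_iff, or_iff_right hqx, ← hΘ0 q hq]
        constructor
        · intro h0
          ext i
          have := congrFun h0 (Sum.inr i)
          simpa [Θ', hnot q hq₁] using this
        · intro h0
          ext (i | i) <;> simp [Θ', hnot q hq₁, h0]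

/-- Functions whose common zeros are F are pulled back along β and extended by 0 off V. They are
continuous because β(c) approaches F at points outside V, and they have no common zero on V because
β avoids F. -/
theorem isLocalZeroSet_of_map [T2Space M] {V : Set ℂ} (hV : IsOpen V) {β : ℂ → M} {F : Set M}
    (hF : F.Finite) (hβF : ∀ c ∈ V, β c ∉ F)
    (hhol : ∀ c ∈ V, ∀ f : M → ℂ, HolAt f (β c) → AnalyticAt ℂ (f ∘ β) c)
    (hprop : ∀ z ∉ V, ∀ O : Set M, (∀ x ∈ F, O ∈ 𝓝 x) → ∀ᶠ c in 𝓝 z, c ∈ V → β c ∈ O) {z : ℂ}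
    (hz : z ∉ V) : IsLocalZeroSet V z := by
  classical
  obtain ⟨I, _, O, Θ, hO, hFO, hΘ, hΘ0⟩ := exists_holomorphic_separating hF
  obtain ⟨R, hR, hball⟩ := Metric.nhds_basis_closedBall.eventually_iff.1
    (hprop z hz O fun x hx => hO.mem_nhds (hFO hx))
  let e := Fintype.equivFin I
  let E : ℂ → Fin (Fintype.card I) → ℂ := fun c => if c ∈ V then fun i => Θ (β c) (e.symm i) else 0
  have hEd : ∀ c ∈ V ∩ Metric.closedBall z R, DifferentiableAt ℂ E c := by
    rintro c ⟨hcV, hcR⟩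
    refine differentiableAt_pi.2 fun i => ?_
    have h1 := hhol c hcV _ (hΘ (e.symm i) (β c) (hball hcR hcV))
    refine h1.differentiableAt.congr_of_eventuallyEq ?_
    filter_upwards [hV.mem_nhds hcV] with c' hc'
    simp [E, hc']
  refine ⟨Fintype.card I, R, E, hR, fun c hc => ?_, fun c hc => ?_, ?_, ?_⟩
  · by_cases hcV : c ∈ V
    · exact (hEd c ⟨hcV, hc⟩).continuousAt.continuousWithinAt
    · refine ContinuousAt.continuousWithinAt (tendsto_pi_nhds.2 fun i => ?_)
      have h0 : E c i = 0 := by simp [E, hcV]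
      rw [h0]
      intro S hS
      have h1 := hprop c hcV {q | Θ q (e.symm i) ∈ S} fun x hx => by
        have h2 : Θ x (e.symm i) = 0 := congrFun ((hΘ0 x (hFO hx)).2 hx) _
        exact (HolAt.continuousAt (hΘ (e.symm i) x (hFO hx))).preimage_mem_nhds (by rwa [h2])
      change ∀ᶠ c' in 𝓝 c, E c' i ∈ S
      filter_upwards [h1] with c' hc'
      by_cases hc'V : c' ∈ V
      · have : Θ (β c') (e.symm i) ∈ S := hc' hc'V
        simpa [E, hc'V] using this
      · simpa [E, hc'V] using mem_of_mem_nhds hS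
  · exact (hEd c ⟨hc.1, Metric.ball_subset_closedBall hc.2⟩).differentiableWithinAt
  · intro c _ hcV
    simp [E, hcV]
  · rintro c ⟨hcV, hcR⟩ h0
    refine hβF c hcV ((hΘ0 _ (hball (Metric.ball_subset_closedBall hcR) hcV)).1 (funext fun i => ?_))
    have := congrFun h0 (e i)
    simpa [E, hcV] using this

/-! ### The values of the generic coefficient -/

variable {K : Compactification M} {A : Set M} {φ : ℚ →₀ ℂ} {r : ℚ} {p : ℕ}

/-- All but finitely many complex numbers are values of the generic coefficient. -/
theorem finite_compl_setOf_value [T2Space M] [CompactSpace M] (hA : IsCurveAtInfinity K A)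
    (h : IsSmallPuiseux φ r p) {F : Set M} (hF : F.Finite)
    (hchart : ∀ χ ∈ A \ F, ∃ κ, IsNormalChart K A φ r p χ κ) :
    {c : ℂ | ∃ χ ∈ A \ F, ∃ κ, IsNormalChart K A φ r p χ κ ∧ (κ χ).2 = c}ᶜ.Finite := by
  set V := {c : ℂ | ∃ χ ∈ A \ F, ∃ κ, IsNormalChart K A φ r p χ κ ∧ (κ χ).2 = c} with hVdef
  obtain ⟨χ₀, hχ₀⟩ := (hA.2.sdiff hF).nonempty
  have hneM : Nonempty M := ⟨χ₀⟩
  have hne : V.Nonempty := by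
    obtain ⟨κ, hκ⟩ := hchart χ₀ hχ₀
    exact ⟨_, χ₀, hχ₀, κ, hκ, rfl⟩
  choose! β hβ using fun c (hc : c ∈ V) => hc
  -- The chosen point β(c) does not depend on choices, since the coefficient determines the point.
  -- Near c the map β is therefore the curve τ = 0 parametrized by ξ, which makes V open and β
  -- holomorphic.
  have huniq : ∀ {c χ κ}, χ ∈ A \ F → IsNormalChart K A φ r p χ κ → (κ χ).2 = c →
      c ∈ V ∧ β c = χ := by
    rintro _ χ κ hχ hκ rfl
    have hc : (κ χ).2 ∈ V := ⟨χ, hχ, κ, hκ, rfl⟩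
    obtain ⟨-, κ', hκ', he⟩ := hβ _ hc
    have h1 := hκ'.tendsto
    rw [he] at h1
    exact ⟨hc, tendsto_nhds_unique h1 hκ.tendsto⟩
  have hloc : ∀ c ∈ V, ∃ κ, IsNormalChart K A φ r p (β c) κ ∧ (κ (β c)).2 = c ∧
      ∀ᶠ t in 𝓝 c, t ∈ V ∧ β t = κ.symm (0, t) := by
    intro c hc
    obtain ⟨hβc, κ, hκ, he⟩ := hβ c hc
    refine ⟨κ, hκ, he, ?_⟩
    have h1 := hκ.1.eventually_slice hF hβc.2
    rw [he] at h1
    filter_upwards [h1] with t ht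
    refine huniq ht.2 (hκ.of_mem ht.2.1 (κ.map_target ht.1)) ?_
    rw [κ.right_inv ht.1]
  have hV : IsOpen V := isOpen_iff_mem_nhds.2 fun c hc => by
    obtain ⟨κ, -, -, he⟩ := hloc c hc
    exact he.mono fun t ht => ht.1
  have hhol : ∀ c ∈ V, ∀ f : M → ℂ, HolAt f (β c) → AnalyticAt ℂ (f ∘ β) c := by
    intro c hc f hf
    obtain ⟨κ, hκ, he, hev⟩ := hloc c hc
    have h1 := hκ.1.analyticAt_comp_symm hκ.1.2.1 hf
    rw [hκ.1.eq_mk, he] at h1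
    refine (AnalyticAt.comp (g := f ∘ κ.symm) (f := fun t => ((0 : ℂ), t)) h1 (by fun_prop)).congr ?_
    filter_upwards [hev] with t ht
    simp [ht.2]
  -- Properness of β, for a filter so that finite limits and infinity are treated alike. Were it
  -- false, compactness of the curve would give a cluster point χ of β along `l` outside F.
  have hprop : ∀ l : Filter ℂ, (∀ c ∈ V, Disjoint (𝓝 c) l) → ∀ O : Set M, (∀ x ∈ F, O ∈ 𝓝 x) →
      ∀ᶠ c in l, c ∈ V → β c ∈ O := by
    intro l hl O hO
    by_contra hcon
    rw [not_eventually] at hcon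
    have hNe : (l ⊓ 𝓟 {c | ¬ (c ∈ V → β c ∈ O)}).NeBot := frequently_mem_iff_neBot.1 hcon
    have hcomp : IsCompact (A \ interior O) := (hA.isClosed.sdiff isOpen_interior).isCompact
    have hle : map β (l ⊓ 𝓟 {c | ¬ (c ∈ V → β c ∈ O)}) ≤ 𝓟 (A \ interior O) := by
      rw [le_principal_iff, mem_map]
      refine mem_of_superset (mem_inf_of_right (mem_principal_self _)) fun c hc => ?_
      obtain ⟨hcV, hcO⟩ := Classical.not_imp.1 hc
      exact ⟨(hβ c hcV).1.1, fun h => hcO (interior_subset h)⟩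
    obtain ⟨χ, hχ, hclust⟩ := hcomp hle
    have hχF : χ ∈ A \ F := ⟨hχ.1, fun hχF => hχ.2 (mem_interior_iff_mem_nhds.2 (hO χ hχF))⟩
    obtain ⟨κ, hκ⟩ := hchart χ hχF
    -- All conjugates of the coefficient of χ lie in V, so each has a neighbourhood `S ω` that `l`
    -- avoids. But if β(c) is close to χ, then c is a conjugate of the coefficient of β(c) and lies
    -- in some `S ω`.
    have hS : ∀ ω : ℂ, ∃ S : Set ℂ, ω ^ p = 1 → (∀ s, evalPuiseux φ p (ω * s) = evalPuiseux φ p s) →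
        S ∈ 𝓝 ((κ χ).2 * ω ^ expo p r) ∧ Sᶜ ∈ l := by
      intro ω
      by_cases hω : ω ^ p = 1 ∧ ∀ s, evalPuiseux φ p (ω * s) = evalPuiseux φ p s
      · obtain ⟨κ', hκ', he⟩ := hκ.exists_rotate h hω.1 hω.2
        obtain ⟨S, hS, T, hT, hST⟩ := Filter.disjoint_iff.1 (hl _ (huniq hχF hκ' he).1)
        exact ⟨S, fun _ _ => ⟨hS, mem_of_superset hT fun c hc hcS =>
          Set.disjoint_left.1 hST hcS hc⟩⟩
      · exact ⟨∅, fun h1 h2 => absurd ⟨h1, h2⟩ hω⟩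
    choose S hS using hS
    let Ω := {ω : ℂ | ω ^ p = 1 ∧ ∀ s, evalPuiseux φ p (ω * s) = evalPuiseux φ p s}
    have hΩ : Ω.Finite := (finite_roots_of_unity h.pos).subset fun ω hω => hω.1
    have hN : ∀ᶠ q in 𝓝 χ, q ∈ κ.source ∧ ∀ ω ∈ Ω, (κ q).2 * ω ^ expo p r ∈ S ω := by
      refine Filter.inter_mem (κ.open_source.mem_nhds hκ.1.2.1) (hΩ.eventually_all.2 fun ω hω => ?_)
      have hc : ContinuousAt (fun q => (κ q).2 * ω ^ expo p r) χ :=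
        (continuousAt_snd.comp (κ.continuousAt hκ.1.2.1)).mul continuousAt_const
      exact hc.preimage_mem_nhds (hS ω hω.1 hω.2).1
    have hl' : ∀ᶠ c in l ⊓ 𝓟 {c | ¬ (c ∈ V → β c ∈ O)}, (∀ ω ∈ Ω, c ∉ S ω) ∧ c ∈ V := by
      refine Filter.inter_mem (mem_inf_of_left (hΩ.eventually_all.2 fun ω hω =>
        (hS ω hω.1 hω.2).2)) (mem_of_superset (mem_inf_of_right (mem_principal_self _)) fun c hc => ?_)
      exact (Classical.not_imp.1 hc).1
    have hfreq : ∃ᶠ q in map β (l ⊓ 𝓟 {c | ¬ (c ∈ V → β c ∈ O)}),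
        q ∈ κ.source ∧ ∀ ω ∈ Ω, (κ q).2 * ω ^ expo p r ∈ S ω := hclust.frequently hN
    rw [frequently_map] at hfreq
    obtain ⟨c, ⟨hcs, hcS⟩, hcS', hcV⟩ := (hfreq.and_eventually hl').exists
    obtain ⟨hβc, κ', hκ', he⟩ := hβ c hcV
    obtain ⟨ω, hω, hfix, hωe⟩ := (hκ.of_mem hβc.1 hcs).exists_conjugate_chart h hκ'
    refine hcS' ω ⟨hω, hfix⟩ ?_
    rw [← he, ← hωe]
    exact hcS ω ⟨hω, hfix⟩
  have hnhds : ∀ z ∉ V, ∀ O : Set M, (∀ x ∈ F, O ∈ 𝓝 x) → ∀ᶠ c in 𝓝 z, c ∈ V → β c ∈ O :=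
    fun z hz => hprop (𝓝 z) fun c hc => disjoint_nhds_nhds.2 fun hcz => hz (hcz ▸ hc)
  refine finite_compl_of_isLocalZeroSet hV hne
    (fun z hz => isLocalZeroSet_of_map hV hF (fun c hc => (hβ c hc).1.2) hhol hnhds hz) ?_
  have hV' : IsOpen {w : ℂ | w ≠ 0 ∧ w⁻¹ ∈ V} :=
    (continuousOn_inv₀ (G₀ := ℂ)).isOpen_inter_preimage isOpen_compl_singleton hV
  refine isLocalZeroSet_of_map (β := fun w => β w⁻¹) hV' hF (fun w hw => (hβ _ hw.2).1.2) ?_ ?_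
    fun h0 => h0.1 rfl
  · rintro w ⟨hw0, hw⟩ f hf
    exact AnalyticAt.comp (g := f ∘ β) (f := fun w => w⁻¹) (hhol _ hw f hf) (analyticAt_inv hw0)
  · intro z hz O hO
    by_cases hz0 : z = 0
    · subst hz0
      -- At the origin of the coordinate w = 1/c, the filter is that of c escaping to infinity.
      have h1 := hprop (cocompact ℂ) (fun c _ => disjoint_nhds_cocompact c) O hO
      rw [← Metric.cobounded_eq_cocompact] at h1
      have h2 := eventually_nhdsWithin_iff.1 (tendsto_inv₀_nhdsNE_zero.eventually h1)
      filter_upwards [h2] with w hw hwV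
      exact hw hwV.1 hwV.2
    · have h1 := hnhds z⁻¹ (fun hzV => hz ⟨hz0, hzV⟩) O hO
      filter_upwards [(continuousAt_inv₀ hz0).eventually h1] with w hw hwV
      exact hw hwV.2

end Values

end CurvesAtInfinity
end

/-! ### Orders of f(1/x, y/x) along C_ν as intersection multiplicities. -/

noncomputable section

namespace CurvesAtInfinity

open ReducedComplexSpace (HolAt)

/-! ### Rational functions in the coordinates `(1 / x, y / x)` -/

/-- `f(1 / x, y / x)` with the denominator cleared. -/
theorem exists_homogenization (f : MvPolynomial (Fin 2) ℂ) :
    ∃ (N : ℕ) (H : MvPolynomial (Fin 2) ℂ), toRat H = ratX ^ N * inUV f ∧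
      ∀ w : Fin 2 → ℂ, w 0 ≠ 0 →
        MvPolynomial.eval w H = w 0 ^ N * MvPolynomial.eval ![1 / w 0, w 1 / w 0] f := by
  have hX := ratX_ne_zero
  induction f using MvPolynomial.induction_on with
  | C a =>
    refine ⟨0, MvPolynomial.C a, ?_, by simp⟩
    rw [inUV, MvPolynomial.algHom_C, pow_zero, one_mul, toRat,
      ← MvPolynomial.algebraMap_eq, ← IsScalarTower.algebraMap_apply]
  | add f g hf hg =>
    obtain ⟨N₁, H₁, h₁, e₁⟩ := hf
    obtain ⟨N₂, H₂, h₂, e₂⟩ := hg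
    refine ⟨N₁ + N₂, MvPolynomial.X 0 ^ N₂ * H₁ + MvPolynomial.X 0 ^ N₁ * H₂, ?_, fun w hw => ?_⟩
    · have h3 : toRat (MvPolynomial.X 0 ^ N₂ * H₁ + MvPolynomial.X 0 ^ N₁ * H₂) =
          ratX ^ N₂ * toRat H₁ + ratX ^ N₁ * toRat H₂ := by
        simp only [toRat, ratX, map_add, map_mul, map_pow]
      have h4 : inUV (f + g) = inUV f + inUV g := map_add _ _ _
      rw [h3, h4, h₁, h₂]
      ring
    · simp only [map_add, map_mul, map_pow, MvPolynomial.eval_X, e₁ w hw, e₂ w hw]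
      ring
  | mul_X f i hf =>
    obtain ⟨N, H, h, e⟩ := hf
    have h4 : inUV (f * MvPolynomial.X i) = inUV f * ![1 / ratX, ratY / ratX] i := by
      simp only [inUV, map_mul, MvPolynomial.aeval_X]
    fin_cases i
    · refine ⟨N + 1, H, ?_, fun w hw => ?_⟩
      · rw [h4, h]
        simp only [Fin.zero_eta, Matrix.cons_val_zero]
        field_simp
        ring
      · rw [e w hw]
        simp only [map_mul, MvPolynomial.eval_X, Fin.zero_eta, Matrix.cons_val_zero]
        field_simp
        ring
    · refine ⟨N + 1, H * MvPolynomial.X 1, ?_, fun w hw => ?_⟩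
      · have h3 : toRat (H * MvPolynomial.X 1) = toRat H * ratY := by
          simp only [toRat, ratY, map_mul]
        rw [h4, h3, h]
        simp only [Fin.mk_one, Matrix.cons_val_one, Matrix.cons_val_fin_one]
        field_simp
        ring
      · rw [map_mul, e w hw]
        simp only [map_mul, MvPolynomial.eval_X, Fin.mk_one, Matrix.cons_val_one,
          Matrix.cons_val_fin_one]
        field_simp
        ring

/-- The map (x, y) ↦ (1/x, y/x) is an involution on x ≠ 0, so a vanishing homogenization makes f
vanish at all points with x ≠ 0. -/
theorem inUV_ne_zero {f : MvPolynomial (Fin 2) ℂ} (hf : f ≠ 0) : inUV f ≠ 0 := by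
  intro h0
  obtain ⟨N, H, h, e⟩ := exists_homogenization f
  rw [h0, mul_zero, toRat, IsFractionRing.to_map_eq_zero_iff] at h
  have h1 : MvPolynomial.X 0 * f = 0 := by
    refine MvPolynomial.funext fun z => ?_
    rw [map_mul, MvPolynomial.eval_X, map_zero, mul_eq_zero, or_iff_not_imp_left]
    intro hz
    have h2 := e ![1 / z 0, z 1 / z 0] (by simpa using hz)
    have h3 : (![1 / (![1 / z 0, z 1 / z 0] : Fin 2 → ℂ) 0, (![1 / z 0, z 1 / z 0] : Fin 2 → ℂ) 1 /
        (![1 / z 0, z 1 / z 0] : Fin 2 → ℂ) 0] : Fin 2 → ℂ) = z := by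
      ext i
      fin_cases i
      · simp
      · simp only [Fin.mk_one, Matrix.cons_val_one, Matrix.cons_val_fin_one, Matrix.cons_val_zero]
        field_simp
    rw [h, map_zero, h3, eq_comm, mul_eq_zero] at h2
    exact h2.resolve_left (pow_ne_zero _ (by simpa using hz))
  exact hf ((mul_eq_zero.1 h1).resolve_left (MvPolynomial.X_ne_zero 0))

/-- Orders along the curve are defined through the reduced fraction of an element of ℂ(x, y). This
translates it into values of f at (1/x, y/x). -/
theorem eval_num_eq_eval_mul_eval_den (f : MvPolynomial (Fin 2) ℂ) {w : Fin 2 → ℂ} (hw : w 0 ≠ 0) :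
    MvPolynomial.eval w (IsFractionRing.num (MvPolynomial (Fin 2) ℂ) (inUV f)) =
      MvPolynomial.eval ![1 / w 0, w 1 / w 0] f *
        MvPolynomial.eval w (IsFractionRing.den (MvPolynomial (Fin 2) ℂ) (inUV f)).1 := by
  obtain ⟨N, H, h, e⟩ := exists_homogenization f
  set d := IsFractionRing.den (MvPolynomial (Fin 2) ℂ) (inUV f)
  set n := IsFractionRing.num (MvPolynomial (Fin 2) ℂ) (inUV f)
  have hd0 : toRat d ≠ 0 := toRat_ne_zero (nonZeroDivisors.ne_zero d.2)
  have h1 : toRat n = inUV f * toRat d := by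
    have h3 := IsFractionRing.mk'_num_den' (MvPolynomial (Fin 2) ℂ) (inUV f)
    exact (div_eq_iff hd0).1 h3
  have h2 : MvPolynomial.X 0 ^ N * n = H * (d : MvPolynomial (Fin 2) ℂ) := by
    refine IsFractionRing.injective (MvPolynomial (Fin 2) ℂ) RatFun ?_
    have h3 : ratX ^ N * toRat n = toRat H * toRat d := by rw [h1, h, mul_assoc]
    simpa only [toRat, ratX, map_mul, map_pow] using h3
  have h3 := congrArg (MvPolynomial.eval w) h2
  rw [map_mul, map_mul, map_pow, MvPolynomial.eval_X, e w hw, mul_assoc] at h3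
  exact mul_left_cancel₀ (pow_ne_zero N hw) h3

/-! ### Intersection multiplicities -/

section Curvettes

variable {M : Type*} [TopologicalSpace M] [ReducedComplexSpace M] {K : Compactification M}
  {A : Set M} {φ : ℚ →₀ ℂ} {r : ℚ} {p : ℕ} {χ : M}

/-- The order of a product of a power of the first coordinate and a unit, along a curvette. -/
theorem IsCurvette.meromorphicOrderAt_eq {c : OpenPartialHomeomorph M (ℂ × ℂ)} {γ : ℂ → M}
    (hγ : IsCurvette A χ γ) (hc : IsAdaptedChart A χ c) {G : ℂ × ℂ → ℂ} (hG : AnalyticAt ℂ G (c χ))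
    (hG0 : G (c χ) ≠ 0) (k : ℤ) :
    meromorphicOrderAt (fun z => (c (γ z)).1 ^ k * G (c (γ z))) 0 = k := by
  obtain ⟨han, hd⟩ := hγ.chart hc
  have hfst : AnalyticAt ℂ (fun z => (c (γ z)).1) 0 := analyticAt_fst.comp han
  have hGan : AnalyticAt ℂ (fun z => G (c (γ z))) 0 := by
    refine AnalyticAt.comp (g := G) (f := fun z => c (γ z)) ?_ han
    rwa [hγ.1]
  have h1 : analyticOrderAt (fun z => (c (γ z)).1) 0 = 1 := by
    refine hfst.analyticOrderAt_eq_one_of_zero_deriv_ne_zero ?_ hd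
    simp only [hγ.1, hc.fst_eq_zero]
  have h2 : meromorphicOrderAt (fun z => (c (γ z)).1) 0 = 1 := by
    rw [hfst.meromorphicOrderAt_eq, h1]
    rfl
  have h3 : meromorphicOrderAt (fun z => G (c (γ z))) 0 = 0 := by
    rw [hGan.meromorphicOrderAt_eq, hGan.analyticOrderAt_eq_zero.2 (by rwa [hγ.1])]
    rfl
  have h4 := meromorphicOrderAt_mul (hfst.meromorphicAt.zpow k) hGan.meromorphicAt
  rw [meromorphicOrderAt_zpow hfst.meromorphicAt, h2, h3, add_zero, mul_one] at h4
  exact h4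

/-- Along a curvette τ has a simple zero, so τ^k times a unit has order k. The hypothesis on the
denominator makes it non-zero near χ off the curve, so that f(u, v) can be isolated in the equation
of the reduced fraction. Since f(u, v) is holomorphic along γ, k cannot be negative. -/
theorem IsCurvette.intersectionMultiplicity_eq (h : IsSmallPuiseux φ r p)
    {κ : OpenPartialHomeomorph M (ℂ × ℂ)} (hκ : IsNormalChart K A φ r p χ κ) {γ : ℂ → M}
    (hγ : IsCurvette A χ γ) {f : MvPolynomial (Fin 2) ℂ} {k l : ℤ}
    (hk : HasOrderAt K A χ (inUV f) k)
    (hl : HasOrderAt K A χ (toRat (IsFractionRing.den (MvPolynomial (Fin 2) ℂ) (inUV f)).1) l) :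
    ∃ m : ℕ, intersectionMultiplicity f (imageCurve φ r p κ γ) = m ∧ k = m := by
  obtain ⟨G, hG, hG0, hGe⟩ := hk.exists_eq hκ.1
  obtain ⟨D, hD, hD0, hDe⟩ := hl.inChart hκ.1
  have han : AnalyticAt ℂ (fun z => MvPolynomial.eval (imageCurve φ r p κ γ z) f) 0 := by
    have h1 := (hγ.isImageGerm h hκ).1
    exact (AnalyticOnNhd.eval_mvPolynomial f _ (Set.mem_univ _)).comp h1
  have hDne : ∀ᶠ q in 𝓝 χ, D (κ q) ≠ 0 :=
    (κ.continuousAt hκ.1.2.1).eventually (hD.continuousAt.eventually_ne hD0)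
  have heq : (fun z => MvPolynomial.eval (imageCurve φ r p κ γ z) f) =ᶠ[𝓝[≠] 0]
      fun z => (κ (γ z)).1 ^ k * G (κ (γ z)) := by
    filter_upwards [hγ.eventually_imageCurve h hκ, hγ.eventually_fst_ne_zero hκ.1,
      hγ.tendsto.eventually hGe, hγ.tendsto.eventually hDe, hγ.tendsto.eventually hDne]
      with z ⟨w, hw, hw0, hδ⟩ h0 h1 h2 h3
    have h4 := h1 w hw
    rw [eval_num_eq_eval_mul_eval_den f hw0] at h4
    rw [hδ]
    refine mul_right_cancel₀ ?_ h4
    exact (h2 w hw).trans_ne (mul_ne_zero (zpow_ne_zero _ h0) h3)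
  have hord := (meromorphicOrderAt_congr heq).trans (hγ.meromorphicOrderAt_eq hκ.1 hG hG0 k)
  rw [han.meromorphicOrderAt_eq] at hord
  rw [intersectionMultiplicity]
  revert hord
  cases analyticOrderAt (fun z => MvPolynomial.eval (imageCurve φ r p κ γ z) f) 0 with
  | top => simp
  | coe m =>
    intro hord
    rw [ENat.map_natCast] at hord
    exact ⟨m, rfl, by exact_mod_cast hord.symm⟩

end Curvettes

end CurvesAtInfinity
end

/-! ### The theorem. -/

open CurvesAtInfinity in
theorem corollary1p3 {M : Type*} [TopologicalSpace M] [T2Space M] [CompactSpace M]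
    [ReducedComplexSpace M] (K : Compactification M) (A : Set M) (hA : IsCurveAtInfinity K A)
    (ν : RatFun → ℤ) (hν : IsOrderAlong K A ν) (hx : ν ratX < 0)
    (φ : ℚ →₀ ℂ) (r : ℚ) (hφ : IsGenericPuiseux ν φ r) :
    (ν ratX < ν ratY ↔ ∃ d : ℚ, IsDegree (genericSeries φ r) d ∧ d < 1) ∧
    (ν ratX < ν ratY →
      center K A = {pointP} ∧
      (∃ F : Set M, F.Finite ∧
        (∀ χ ∈ A \ F, (∃ γ, IsCurvette A χ γ) ∧
          ∃ ξ : ℂ, ∀ γ, IsCurvette A χ γ → ImageHasExpansion K γ (reversed φ) (1 - r) ξ) ∧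
        (∀ c : ℂ, {χ ∈ A \ F | ∃ γ, IsCurvette A χ γ ∧
          ImageHasExpansion K γ (reversed φ) (1 - r) c}.Finite) ∧
        {c : ℂ | ¬ ∃ χ ∈ A \ F, ∀ γ, IsCurvette A χ γ →
          ImageHasExpansion K γ (reversed φ) (1 - r) c}.Finite) ∧
      ∀ f : MvPolynomial (Fin 2) ℂ, f ≠ 0 →
        ∃ F : Set M, F.Finite ∧ ∀ χ ∈ A \ F, ∀ γ, IsCurvette A χ γ →
          ∃ (δ : ℂ → Fin 2 → ℂ) (m : ℕ), IsImageGerm K γ δ ∧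
            intersectionMultiplicity f δ = m ∧ ν (inUV f) = m) := by
  refine ⟨lt_iff_degree_lt_one hx hφ, fun hxy => ?_⟩
  obtain ⟨d, hd, hd1⟩ := (lt_iff_degree_lt_one hx hφ).1 hxy
  obtain ⟨p, hp, -, hden, hr, F, hF, hchart⟩ := exists_isNormalChart hA hν hx hφ
  have h : IsSmallPuiseux φ r p :=
    { pos := hp
      lt := hφ.1
      hasDenominator := hden
      exists_int := hr
      lt_one := fun e he => (hd.le_of_mem_support hφ.1 he).trans_lt hd1
      r_lt_one := (hd.le hφ.1).trans_lt hd1 }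
  refine ⟨center_eq hA h hF hchart, ⟨F, hF, fun χ hχ => ?_,
    finite_setOf_imageHasExpansion h hchart, ?_⟩, fun f hf => ?_⟩
  · obtain ⟨κ, hκ⟩ := hchart χ hχ
    exact ⟨⟨_, hκ.1.isCurvette⟩, (κ χ).2, fun γ hγ => hγ.imageHasExpansion h hκ⟩
  · refine (finite_compl_setOf_value hA h hF hchart).subset fun c hc hc' => hc ?_
    obtain ⟨χ, hχ, κ, hκ, rfl⟩ := hc'
    exact ⟨χ, hχ, fun γ hγ => hγ.imageHasExpansion h hκ⟩
  · set D := (IsFractionRing.den (MvPolynomial (Fin 2) ℂ) (inUV f)).1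
    have hD : toRat D ≠ 0 := toRat_ne_zero (nonZeroDivisors.ne_zero (Subtype.property _))
    -- Besides the points without a normal chart, those where f(u, v) or its reduced denominator
    -- does not have its generic order are excluded.
    refine ⟨F ∪ ({χ ∈ A | ¬ HasOrderAt K A χ (inUV f) (ν (inUV f))} ∪
      {χ ∈ A | ¬ HasOrderAt K A χ (toRat D) (ν (toRat D))}),
      hF.union ((hν _ (inUV_ne_zero hf)).union (hν _ hD)), fun χ hχ γ hγ => ?_⟩
    obtain ⟨κ, hκ⟩ := hchart χ ⟨hχ.1, fun h => hχ.2 (Or.inl h)⟩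
    obtain ⟨m, hm, hm'⟩ := hγ.intersectionMultiplicity_eq h hκ
      (not_not.1 fun h => hχ.2 (Or.inr (Or.inl ⟨hχ.1, h⟩)))
      (not_not.1 fun h => hχ.2 (Or.inr (Or.inr ⟨hχ.1, h⟩)))
    exact ⟨_, m, hγ.isImageGerm h hκ, hm, hm'⟩
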